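/- An instance of single-minded pricing (SMP) is a hypergraph on $n$ vertices (products) with $m\ge 0$ hyperedges (consumers; parallel hyperedges are allowed), where every hyperedge $e$ has a rational budget $B_e\ge 0$. A price function $p:V\to\mathbb R_{\ge 0}$ has revenue $\sum_{e:\,p(e)\le B_e}p(e)$, where $p(e)=\sum_{v\in e}p(v)$. An instance of graph vertex pricing (GVP) is an SMP instance in which every hyperedge consists of exactly two vertices, i.e. a loopless graph with possibly parallel edges. For $\alpha\ge 1$, a price function is an $\alpha$-approximate solution if no price function has revenue larger than $\alpha$ times its revenue. A tree decomposition of width at most $k$ consists of a finite tree $T$ and bags $V_t\subseteq V$ ($t\in T$) with $|V_t|\le k+1$, such that every vertex lies in some bag, every (hyper)edge is contained in some bag, and whenever $v\in V_{t_1}\cap V_{t_2}$, $v$ lies in $V_t$ for all $t$ on the path of $T$ from $t_1$ to $t_2$; the treewidth is at most $k$ if such a decomposition exists. The model of computation is a random access machine over the natural numbers in which each instruction (assignment of a constant, $+$, truncated $-$, $\times$, integer division, remainder, comparison, indirect load, indirect store, test of a condition) is one step. The input consists of $n$, $m$, $k$, the rational numbers $\epsilon$ and $B_e$ (numerators and denominators)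 and the incidence matrix; $L$ denotes its length in bits. The output is a price function with rational values. **Theorem.** There are a single program and absolute constants $A,c\in\mathbb N$ such that for all $k\ge 0$ and all rational $0<\epsilon\le 1$, given an instance of treewidth at most $k$, the program halts and outputs a $(1+\epsilon)$-approximate solution, all numbers that occur during the computation have at most $A L^c$ bits, and 1. if the instance is a GVP instance, then the number of steps is at most $A\,\bigl(n+(A m/\epsilon)^k+1\bigr)^c$, that is, $\operatorname{poly}(|V(G)|, O(m/\epsilon)^k)$; 2. for every SMP instance of treewidth at most $k$, the number of steps is at most $A\,\bigl(n+m+(A (k+1) m/\epsilon)^k+1\bigr)^c$. In particular, for every fixed $k$ this is an FPTAS for GVP on graphs, and for SMP on hypergraphs, of treewidth at most $k$. -/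

import Mathlib

/-! ## Single-minded pricing and graph vertex pricing -/

namespace Pricing

/-- An instance of single-minded item pricing: `n` products and `m` consumers; consumer `e` wants
exactly the products in `bundle e` and has budget `budget e`.  Equivalently, a hypergraph on
`Fin n` with `m` (possibly parallel) hyperedges, each carrying a budget. -/
structure Instance (n m : ℕ) where
  bundle : Fin m → Finset (Fin n)
  budget : Fin m → ℚ≥0

variable {n m : ℕ}

/-- The instance is one of graph vertex pricing: every consumer wants exactly two products, so the
hypergraph is a loopless graph (parallel edges are allowed). -/
def Instance.IsGraph (I : Instance n m) : Prop :=
  ∀ e, (I.bundle e).card = 2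

/-- The revenue of a price function: every consumer who can afford her bundle pays for it. -/
noncomputable def Instance.revenue (I : Instance n m) (p : Fin n → ℝ) : ℝ :=
  ∑ e, if ∑ v ∈ I.bundle e, p v ≤ (I.budget e : ℝ) then ∑ v ∈ I.bundle e, p v else 0

/-- `p` is an `α`-approximate solution: a nonnegative price function such that no nonnegative
real price function earns more than `α` times the revenue of `p`. -/
def Instance.IsApproxSolution (I : Instance n m) (α : ℝ) (p : Fin n → ℝ) : Prop :=
  (∀ v, 0 ≤ p v) ∧ ∀ q : Fin n → ℝ, (∀ v, 0 ≤ q v) → I.revenue q ≤ α * I.revenue p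

/-! ### Treewidth -/

/-- `(T, bag)` is a tree decomposition of the (hyper)graph of the instance. -/
structure Instance.IsTreeDecomposition (I : Instance n m) {ι : Type} (T : SimpleGraph ι)
    (bag : ι → Finset (Fin n)) : Prop where
  isTree : T.IsTree
  vertex_mem : ∀ v, ∃ t, v ∈ bag t
  edge_subset : ∀ e, ∃ t, I.bundle e ⊆ bag t
  mem_of_path : ∀ v t₁ t₂ t₃, v ∈ bag t₁ → v ∈ bag t₂ →
    ∀ W : T.Walk t₁ t₂, W.IsPath → t₃ ∈ W.support → v ∈ bag t₃

/-- The (hyper)graph of the instance has treewidth at most `k`. -/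
def Instance.TreewidthAtMost (I : Instance n m) (k : ℕ) : Prop :=
  ∃ (ι : Type) (_ : Finite ι) (T : SimpleGraph ι) (bag : ι → Finset (Fin n)),
    I.IsTreeDecomposition T bag ∧ ∀ t, (bag t).card ≤ k + 1

/-! ### A random access machine

Registers and memory cells hold natural numbers.  The machine has a word length `w`: an
instruction that would produce a number with more than `w` bits cannot be executed. -/

/-- Arithmetic instructions (`sub` is truncated at `0`, `lt` returns `1` or `0`). -/
inductive Op where
  | add | sub | mul | div | mod | lt

/-- The value of an arithmetic instruction. -/
def Op.eval : Op → ℕ → ℕ → ℕ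
  | .add, x, y => x + y
  | .sub, x, y => x - y
  | .mul, x, y => x * y
  | .div, x, y => x / y
  | .mod, x, y => x % y
  | .lt, x, y => if x < y then 1 else 0

/-- Programs; `d`, `a`, `b` are register names. -/
inductive Prog where
  | skip
  /-- `reg d := c` -/
  | const (d c : ℕ)
  /-- `reg d := o (reg a) (reg b)` -/
  | arith (o : Op) (d a b : ℕ)
  /-- `reg d := mem (reg a)` -/
  | load (d a : ℕ)
  /-- `mem (reg a) := reg b` -/
  | store (a b : ℕ)
  | seq (P Q : Prog)
  /-- if `reg a ≠ 0` then `P` else `Q` -/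
  | ite (a : ℕ) (P Q : Prog)
  /-- while `reg a ≠ 0` do `P` -/
  | loop (a : ℕ) (P : Prog)

/-- The contents of the registers and of the memory. -/
structure State where
  reg : ℕ → ℕ
  mem : ℕ → ℕ

/-- Write `x` into register `d`. -/
def State.setReg (s : State) (d x : ℕ) : State :=
  { s with reg := Function.update s.reg d x }

/-- Write `x` into memory cell `i`. -/
def State.setMem (s : State) (i x : ℕ) : State :=
  { s with mem := Function.update s.mem i x }

/-- `Exec w P s t s'`: with word length `w`, the program `P` started in state `s` halts in state
`s'` after exactly `t` steps.  Every instruction and every test of a condition is one step. -/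
inductive Exec (w : ℕ) : Prog → State → ℕ → State → Prop where
  | skip (s : State) : Exec w .skip s 1 s
  | const (s : State) (d c : ℕ) (h : c < 2 ^ w) : Exec w (.const d c) s 1 (s.setReg d c)
  | arith (s : State) (o : Op) (d a b : ℕ) (h : o.eval (s.reg a) (s.reg b) < 2 ^ w) :
      Exec w (.arith o d a b) s 1 (s.setReg d (o.eval (s.reg a) (s.reg b)))
  | load (s : State) (d a : ℕ) (h : s.mem (s.reg a) < 2 ^ w) :
      Exec w (.load d a) s 1 (s.setReg d (s.mem (s.reg a)))
  | store (s : State) (a b : ℕ) : Exec w (.store a b) s 1 (s.setMem (s.reg a) (s.reg b))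
  | seq {P Q : Prog} {s s' s'' : State} {t t' : ℕ} (hP : Exec w P s t s')
      (hQ : Exec w Q s' t' s'') : Exec w (.seq P Q) s (t + t') s''
  | ite_pos {a : ℕ} {P Q : Prog} {s s' : State} {t : ℕ} (h : s.reg a ≠ 0)
      (hP : Exec w P s t s') : Exec w (.ite a P Q) s (t + 1) s'
  | ite_neg {a : ℕ} {P Q : Prog} {s s' : State} {t : ℕ} (h : s.reg a = 0)
      (hQ : Exec w Q s t s') : Exec w (.ite a P Q) s (t + 1) s'
  | loop_pos {a : ℕ} {P : Prog} {s s' s'' : State} {t t' : ℕ} (h : s.reg a ≠ 0)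
      (hP : Exec w P s t s') (hL : Exec w (.loop a P) s' t' s'') :
      Exec w (.loop a P) s (t + t' + 1) s''
  | loop_neg {a : ℕ} {P : Prog} {s : State} (h : s.reg a = 0) : Exec w (.loop a P) s 1 s

/-! ### Input, output and approximation algorithms -/

/-- The input as a list of natural numbers: `n`, `m`, `k`, the numerator and the denominator of
`ε`, the numerators and denominators of the budgets, and the rows of the incidence matrix. -/
def Instance.encode (I : Instance n m) (k : ℕ) (ε : ℚ≥0) : List ℕ :=
  [n, m, k, ε.num, ε.den]
    ++ (List.finRange m).flatMap (fun e => [(I.budget e).num, (I.budget e).den])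
    ++ (List.finRange m).flatMap (fun e =>
        (List.finRange n).map (fun v => if v ∈ I.bundle e then 1 else 0))

/-- The length of the input in bits (one additional symbol terminates each number). -/
def Instance.inputSize (I : Instance n m) (k : ℕ) (ε : ℚ≥0) : ℕ :=
  ((I.encode k ε).map (fun x => x.size + 1)).sum

/-- Initially the input is in the cells `0, 1, 2, …`; all else is `0`. -/
def Instance.initState (I : Instance n m) (k : ℕ) (ε : ℚ≥0) : State where
  reg := fun _ => 0
  mem := fun i => (I.encode k ε).getD i 0

/-- The price of product `v` in the output: the fraction stored in the cells `2v` and `2v+1`. -/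
noncomputable def State.price (s : State) (v : Fin n) : ℝ :=
  (s.mem (2 * v) : ℝ) / (s.mem (2 * v + 1) : ℝ)

/-- With word length `w`, the program `P` run on the instance `I` and the parameters `k`, `ε`
halts after at most `τ` steps, and its output is a `(1 + ε)`-approximate price function. -/
def Prog.Approximates (P : Prog) (I : Instance n m) (k : ℕ) (ε : ℚ≥0) (w : ℕ) (τ : ℝ) : Prop :=
  ∃ (t : ℕ) (s : State), Exec w P (I.initState k ε) t s ∧ (t : ℝ) ≤ τ ∧
    (∀ v : Fin n, s.mem (2 * v + 1) ≠ 0) ∧ I.IsApproxSolution (1 + (ε : ℝ)) s.price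

end Pricing

namespace Pricing

/-! ### A structured language with bounded loops, and its compilation -/

/-! Rounding makes the problem finite. Let S be the sum of the bundle sizes, a/b the largest budget
of a nonempty bundle, N = ⌊S/ε⌋ + 1 and c = a/(Nb). Rounding prices down to multiples of c keeps
every sale and loses at most c per incidence, altogether Sc ≤ εNc = ε·a/b. Some assignment of
multiples of c earns at least a/b: charge the whole largest budget for one product of that bundle
and nothing for the others. Hence an optimal assignment of candidate prices is (1+ε)-approximate
(`Instance.IsCand.exists_rounding`, `Instance.IsCand.isApproxSolution`). If k = 0, bundles have at
most one product, and the rounded budgets together with 0 suffice as candidates; their number does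
not depend on ε, as the exponent 0 in the time bound demands.

The optimal assignment is found without computing a tree decomposition. The decomposition only
serves to prove that some order κ of the vertices exists in which every connected set has at most k
neighbours that precede all of it (`Instance.TreewidthAtMost.exists_order`): sort the vertices by
the depth of their topmost bags. The program enumerates the partial assignments D of at most k
vertices. For each component of the unassigned vertices it stores a continuation in a table, under a
key that encodes the component and the prices on its boundary. To recompute a row it tries every
vertex u of the component with every candidate price, takes the prices on the remaining pieces from
the table, and keeps the outcome of largest revenue. Optimality is claimed only for admissible
components, those preceded in κ by their boundary. For these the κ-first vertex is a good choice of
u: the pieces are admissible and smaller. The program does not know κ, but this u is among those it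
tries. Other rows may be poor, yet they hold candidate prices, so comparing the revenues actually
obtained is sound. After i rounds all admissible components with at most i vertices have optimal
rows (`Net.Complete.step`, `Plan.run_table`); after n rounds the rows for the empty assignment give
an optimum (`Net.Complete.val_le`).

With K candidates there are (SK+1)^k codes of partial assignments, because vertices are named by
incidences; this avoids a factor n^k. The keys, and with them the memory addresses, are
exponentially large but have polynomially many bits, and memory that is never touched costs nothing.

The program is written in a small language with bounded loops, which is compiled to the machine
(`Stm.exec_comp`) and verified by loop invariants. Static bounds on variables and arrays control the
word length (`Stm.Obeys.safe`), and the number of steps is polynomial in the largest number of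
iterations of a loop (`Stm.cost_le`). -/

/-- Expressions over variables, arrays and the input; `cap a b` is the minimum of `a` and `b`. -/
inductive Ex where
  | lit (c : ℕ)
  | var (x : ℕ)
  | op (o : Op) (a b : Ex)
  | cap (a b : Ex)
  | inp (a : Ex)
  | get (a : ℕ) (e : Ex)

/-- Statements; `loop x e P` runs `P` for `x = 0, …, e - 1`. -/
inductive Stm where
  | skip
  | set (x : ℕ) (e : Ex)
  | put (a : ℕ) (i e : Ex)
  | out (i e : Ex)
  | seq (P Q : Stm)
  | ite (e : Ex) (P Q : Stm)
  | loop (x : ℕ) (e : Ex) (P : Stm)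

/-- Values of the variables and arrays, and the contents of the input and output cells. -/
structure Store where
  v : ℕ → ℕ
  arr : ℕ → ℕ → ℕ
  low : ℕ → ℕ

namespace Store

def setV (s : Store) (x a : ℕ) : Store := { s with v := Function.update s.v x a }

def setA (s : Store) (a i x : ℕ) : Store :=
  { s with arr := Function.update s.arr a (Function.update (s.arr a) i x) }

def setL (s : Store) (i x : ℕ) : Store := { s with low := Function.update s.low i x }

@[simp] theorem setV_v (s : Store) (x a y : ℕ) :
    (s.setV x a).v y = if y = x then a else s.v y := by
  simp [setV, Function.update_apply]

@[simp] theorem setV_arr (s : Store) (x a : ℕ) : (s.setV x a).arr = s.arr := rfl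
@[simp] theorem setV_low (s : Store) (x a : ℕ) : (s.setV x a).low = s.low := rfl

@[simp] theorem setA_v (s : Store) (a i x : ℕ) : (s.setA a i x).v = s.v := rfl

theorem setA_arr (s : Store) (a i x b : ℕ) :
    (s.setA a i x).arr b = if b = a then Function.update (s.arr a) i x else s.arr b := by
  simp [setA, Function.update_apply]

@[simp] theorem setA_arr_apply (s : Store) (a i x b j : ℕ) :
    (s.setA a i x).arr b j = if b = a ∧ j = i then x else s.arr b j := by
  rw [setA_arr]
  by_cases h : b = a
  · subst h; by_cases hj : j = i <;> simp [hj]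
  · simp [h]

@[simp] theorem setA_low (s : Store) (a i x : ℕ) : (s.setA a i x).low = s.low := rfl
@[simp] theorem setL_v (s : Store) (i x : ℕ) : (s.setL i x).v = s.v := rfl
@[simp] theorem setL_arr (s : Store) (i x : ℕ) : (s.setL i x).arr = s.arr := rfl

@[simp] theorem setL_low (s : Store) (i x j : ℕ) :
    (s.setL i x).low j = if j = i then x else s.low j := by
  simp [setL, Function.update_apply]

/-- The store after the first `i` iterations of a loop with counter `x` and body `f`. -/
def iter (f : Store → Store) (x : ℕ) (s : Store) : ℕ → Store
  | 0 => s
  | i + 1 => f ((iter f x s i).setV x i)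

end Store

/-- The value of an expression. -/
@[simp] def Ex.eval (s : Store) : Ex → ℕ
  | .lit c => c
  | .var x => s.v x
  | .op o a b => o.eval (a.eval s) (b.eval s)
  | .cap a b => min (a.eval s) (b.eval s)
  | .inp a => s.low (a.eval s)
  | .get a e => s.arr a (e.eval s)

/-- The store after running a statement. -/
@[simp] def Stm.run : Stm → Store → Store
  | .skip, s => s
  | .set x e, s => s.setV x (e.eval s)
  | .put a i e, s => s.setA a (i.eval s) (e.eval s)
  | .out i e, s => s.setL (i.eval s) (e.eval s)
  | .seq P Q, s => Q.run (P.run s)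
  | .ite e P Q, s => if e.eval s ≠ 0 then P.run s else Q.run s
  | .loop x e P, s => s.iter P.run x (e.eval s)

/-- All values that occur in the evaluation are below `W`, and input cells are below `B`. -/
@[simp] def Ex.Safe (W B : ℕ) (s : Store) : Ex → Prop
  | .lit c => c < W
  | .var x => s.v x < W
  | .op o a b => a.Safe W B s ∧ b.Safe W B s ∧ o.eval (a.eval s) (b.eval s) < W
  | .cap a b => a.Safe W B s ∧ b.Safe W B s
  | .inp a => a.Safe W B s ∧ a.eval s < B ∧ s.low (a.eval s) < W
  | .get a e => a < 16 ∧ e.Safe W B s ∧ B + 16 * e.eval s + a < W ∧ s.arr a (e.eval s) < W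

/-- All values that occur are below `W`, and no loop has more than `X` iterations. -/
@[simp] def Stm.Safe (W B X : ℕ) : Stm → Store → Prop
  | .skip, _ => True
  | .set _ e, s => e.Safe W B s
  | .put a i e, s => a < 16 ∧ i.Safe W B s ∧ e.Safe W B s ∧ B + 16 * i.eval s + a < W
  | .out i e, s => i.Safe W B s ∧ e.Safe W B s ∧ i.eval s < B
  | .seq P Q, s => P.Safe W B X s ∧ Q.Safe W B X (P.run s)
  | .ite e P Q, s => e.Safe W B s ∧ (e.eval s ≠ 0 → P.Safe W B X s) ∧
      (e.eval s = 0 → Q.Safe W B X s)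
  | .loop x e P, s => e.Safe W B s ∧ e.eval s ≤ X ∧
      ∀ i < e.eval s, P.Safe W B X ((s.iter P.run x i).setV x i)

/-- The number of steps of the evaluation. -/
def Ex.cost : Ex → ℕ
  | .lit _ => 1
  | .var _ => 1
  | .op _ a b => a.cost + b.cost + 1
  | .cap a b => a.cost + b.cost + 2
  | .inp a => a.cost + 1
  | .get _ e => e.cost + 5

/-- A bound for the number of steps if no loop has more than `X` iterations. -/
def Stm.cost (X : ℕ) : Stm → ℕ
  | .skip => 1
  | .set _ e => e.cost + 1
  | .put _ i e => i.cost + e.cost + 5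
  | .out i e => i.cost + e.cost + 1
  | .seq P Q => P.cost X + Q.cost X
  | .ite e P Q => e.cost + (P.cost X + Q.cost X) + 1
  | .loop _ e P => e.cost + 3 + X * (P.cost X + 4)

/-- Evaluate an expression into the register `4 * d + 5`. -/
def Ex.comp : Ex → ℕ → Prog
  | .lit c, d => .const (4 * d + 5) c
  | .var x, d => .arith .add (4 * d + 5) (4 * x + 4) 0
  | .op o a b, d =>
      .seq (a.comp d) (.seq (b.comp (d + 1)) (.arith o (4 * d + 5) (4 * d + 5) (4 * (d + 1) + 5)))
  | .cap a b, d =>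
      .seq (a.comp d) (.seq (b.comp (d + 1)) (.seq
        (.arith .sub (4 * (d + 1) + 5) (4 * d + 5) (4 * (d + 1) + 5))
        (.arith .sub (4 * d + 5) (4 * d + 5) (4 * (d + 1) + 5))))
  | .inp a, d => .seq (a.comp d) (.load (4 * d + 5) (4 * d + 5))
  | .get a e, d =>
      .seq (e.comp d) (.seq (.arith .mul (4 * d + 5) (4 * d + 5) 3)
        (.seq (.arith .add (4 * d + 5) (4 * d + 5) 2) (.seq (.const (4 * (d + 1) + 5) a)
          (.seq (.arith .add (4 * d + 5) (4 * d + 5) (4 * (d + 1) + 5))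
            (.load (4 * d + 5) (4 * d + 5))))))

/-- The program for a statement at loop depth `l`. -/
def Stm.comp : Stm → ℕ → Prog
  | .skip, _ => .skip
  | .set x e, _ => .seq (e.comp 0) (.arith .add (4 * x + 4) 5 0)
  | .put a i e, _ =>
      .seq (i.comp 0) (.seq (e.comp 1) (.seq (.arith .mul 5 5 3) (.seq (.arith .add 5 5 2)
        (.seq (.const 13 a) (.seq (.arith .add 5 5 13) (.store 5 9))))))
  | .out i e, _ => .seq (i.comp 0) (.seq (e.comp 1) (.store 5 9))
  | .seq P Q, l => .seq (P.comp l) (Q.comp l)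
  | .ite e P Q, l => .seq (e.comp 0) (.ite 5 (P.comp l) (Q.comp l))
  | .loop x e P, l =>
      .seq (e.comp 0) (.seq (.arith .add (4 * l + 7) 5 0) (.seq (.const (4 * l + 6) 0)
        (.loop (4 * l + 7) (.seq (.arith .add (4 * x + 4) (4 * l + 6) 0) (.seq (P.comp (l + 1))
          (.seq (.arith .add (4 * l + 6) (4 * l + 6) 1)
            (.arith .sub (4 * l + 7) (4 * l + 7) 1)))))))

/-- The machine state `c` represents the store `s`; arrays lie above the cells `0, …, B - 1`. -/
structure Represents (B : ℕ) (s : Store) (c : State) : Prop where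
  v : ∀ x, c.reg (4 * x + 4) = s.v x
  arr : ∀ a < 16, ∀ i, c.mem (B + 16 * i + a) = s.arr a i
  low : ∀ i < B, c.mem i = s.low i
  r0 : c.reg 0 = 0
  r1 : c.reg 1 = 1
  r2 : c.reg 2 = B
  r3 : c.reg 3 = 16

/-! ### Correctness of the compilation. -/

@[simp] theorem State.setReg_reg (s : State) (d x r : ℕ) :
    (s.setReg d x).reg r = if r = d then x else s.reg r := by
  simp [State.setReg, Function.update_apply]

@[simp] theorem State.setReg_mem (s : State) (d x : ℕ) : (s.setReg d x).mem = s.mem := rfl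

@[simp] theorem State.setMem_mem (s : State) (i x j : ℕ) :
    (s.setMem i x).mem j = if j = i then x else s.mem j := by
  simp [State.setMem, Function.update_apply]

@[simp] theorem State.setMem_reg (s : State) (i x : ℕ) : (s.setMem i x).reg = s.reg := rfl

theorem Exec.arith' {w : ℕ} (s : State) (o : Op) (d a b y : ℕ)
    (hy : o.eval (s.reg a) (s.reg b) = y) (h : y < 2 ^ w) :
    Exec w (.arith o d a b) s 1 (s.setReg d y) := by
  subst hy; exact .arith s o d a b h

theorem Exec.load' {w : ℕ} (s : State) (d a y : ℕ) (hy : s.mem (s.reg a) = y) (h : y < 2 ^ w) :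
    Exec w (.load d a) s 1 (s.setReg d y) := by
  subst hy; exact .load s d a h

theorem Exec.store' {w : ℕ} (s : State) (a b i x : ℕ) (hi : s.reg a = i) (hx : s.reg b = x) :
    Exec w (.store a b) s 1 (s.setMem i x) := by
  subst hi hx; exact .store s a b

/-- Register numbers are divided by their residue modulo 4: residue 0 holds variables, 1
temporaries, 2 and 3 loop counters, while the registers below 4 hold constants. Temporaries and
counters can therefore change without affecting the represented store. -/
theorem Represents.congr {B : ℕ} {s : Store} {c c' : State} (h : Represents B s c)
    (hm : c'.mem = c.mem) (hr : ∀ r, r % 4 = 0 ∨ r < 4 → c'.reg r = c.reg r) :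
    Represents B s c' where
  v x := by rw [hr _ (by omega)]; exact h.v x
  arr := by rw [hm]; exact h.arr
  low := by rw [hm]; exact h.low
  r0 := by rw [hr _ (by omega)]; exact h.r0
  r1 := by rw [hr _ (by omega)]; exact h.r1
  r2 := by rw [hr _ (by omega)]; exact h.r2
  r3 := by rw [hr _ (by omega)]; exact h.r3

theorem Ex.Safe.eval_lt {W B : ℕ} {s : Store} {e : Ex} (h : e.Safe W B s) : e.eval s < W := by
  induction e with
  | lit => exact h
  | var => exact h
  | op => exact h.2.2
  | cap x y ihx ihy => exact lt_of_le_of_lt (min_le_left _ _) (ihx h.1)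
  | inp => exact h.2.2
  | get => exact h.2.2.2

/-- Temporaries form a stack. Evaluation at depth `d` leaves all lower temporaries alone, so the
first operand survives the evaluation of the second. -/
theorem Ex.exec_comp {w B : ℕ} {s : Store} (e : Ex) (d : ℕ) (c : State)
    (hc : Represents B s c) (he : e.Safe (2 ^ w) B s) :
    ∃ c', Exec w (e.comp d) c e.cost c' ∧ c'.reg (4 * d + 5) = e.eval s ∧ c'.mem = c.mem ∧
      ∀ r, r % 4 ≠ 1 ∨ r < 4 * d + 5 → c'.reg r = c.reg r := by
  induction e generalizing d c with
  | lit k =>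
    exact ⟨_, .const c _ k he, by simp, by simp, fun r hr => by
      rw [State.setReg_reg, if_neg (by omega)]⟩
  | var x =>
    refine ⟨_, .arith' c _ _ _ _ (s.v x) (by simp [Op.eval, hc.v, hc.r0]) he, by simp, by simp,
      fun r hr => ?_⟩
    rw [State.setReg_reg, if_neg (by omega)]
  | op o a b iha ihb =>
    obtain ⟨ha, hb, hab⟩ := he
    obtain ⟨c1, h1, v1, m1, r1⟩ := iha d c hc ha
    have hc1 : Represents B s c1 := hc.congr m1 fun r hr => r1 r (by omega)
    obtain ⟨c2, h2, v2, m2, r2⟩ := ihb (d + 1) c1 hc1 hb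
    refine ⟨c2.setReg (4 * d + 5) (o.eval (a.eval s) (b.eval s)), ?_, ?_, ?_, fun r hr => ?_⟩
    · simp only [Ex.cost, add_assoc]
      exact .seq h1 (.seq h2 (.arith' c2 o _ _ _ (o.eval (a.eval s) (b.eval s))
        (by rw [v2, r2 _ (by omega), v1]) hab))
    · simp
    · simp [m1, m2]
    · rw [State.setReg_reg, if_neg (by omega), r2 _ (by omega), r1 _ hr]
  | cap a b iha ihb =>
    obtain ⟨ha, hb⟩ := he
    obtain ⟨c1, h1, v1, m1, r1⟩ := iha d c hc ha
    have hc1 : Represents B s c1 := hc.congr m1 fun r hr => r1 r (by omega)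
    obtain ⟨c2, h2, v2, m2, r2⟩ := ihb (d + 1) c1 hc1 hb
    have hlt := ha.eval_lt
    -- With truncated subtraction, min x y = x - (x - y).
    refine ⟨(c2.setReg (4 * (d + 1) + 5) (a.eval s - b.eval s)).setReg (4 * d + 5)
      (min (a.eval s) (b.eval s)), ?_, ?_, ?_, fun r hr => ?_⟩
    · simp only [Ex.cost, add_assoc]
      refine .seq h1 (.seq h2 (.seq (t := 1) (t' := 1) (.arith' c2 .sub _ _ _
        (a.eval s - b.eval s) (by rw [v2, r2 _ (by omega), v1]; rfl) (by omega))
        (.arith' _ .sub _ _ _ (min (a.eval s) (b.eval s)) ?_ ?_)))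
      · rw [State.setReg_reg, State.setReg_reg, if_neg (by omega), if_pos rfl,
          r2 _ (by omega), v1]
        simp only [Op.eval]; omega
      · omega
    · simp
    · simp [m1, m2]
    · rw [State.setReg_reg, if_neg (by omega), State.setReg_reg, if_neg (by omega),
        r2 _ (by omega), r1 _ hr]
  | inp a iha =>
    obtain ⟨ha, hB, hv⟩ := he
    obtain ⟨c1, h1, v1, m1, r1⟩ := iha d c hc ha
    refine ⟨_, .seq h1 (.load' c1 _ _ (s.low (a.eval s)) ?_ hv), by simp, by simp [m1],
      fun r hr => ?_⟩
    · rw [v1, m1, hc.low _ hB]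
    · rw [State.setReg_reg, if_neg (by omega), r1 _ hr]
  | get a e ihe =>
    obtain ⟨ha, he, hb, hv⟩ := he
    obtain ⟨c1, h1, v1, m1, r1⟩ := ihe d c hc he
    have hc1 : Represents B s c1 := hc.congr m1 fun r hr => r1 r (by omega)
    refine ⟨((((c1.setReg (4 * d + 5) (16 * e.eval s)).setReg (4 * d + 5)
      (B + 16 * e.eval s)).setReg (4 * (d + 1) + 5) a).setReg (4 * d + 5)
      (B + 16 * e.eval s + a)).setReg (4 * d + 5) (s.arr a (e.eval s)), ?_, ?_, ?_, fun r hr => ?_⟩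
    · simp only [Ex.cost]
      refine .seq h1 (.seq (t := 1) (t' := 4) (.arith' _ .mul _ _ _ (16 * e.eval s) ?_ (by omega))
        (.seq (t := 1) (t' := 3) (.arith' _ .add _ _ _ (B + 16 * e.eval s) ?_ (by omega))
        (.seq (t := 1) (t' := 2) (.const _ _ a (by omega))
        (.seq (t := 1) (t' := 1) (.arith' _ .add _ _ _ (B + 16 * e.eval s + a) ?_ (by omega))
        (.load' _ _ _ (s.arr a (e.eval s)) ?_ hv)))))
      · rw [v1, hc1.r3]; exact mul_comm _ _
      · rw [State.setReg_reg, State.setReg_reg, if_pos rfl, if_neg (by omega), hc1.r2]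
        simp [Op.eval, add_comm]
      · simp [Op.eval]
      · simp [m1, hc.arr a ha]
    · simp
    · simp [m1]
    · simp only [State.setReg_reg]
      rw [if_neg (by omega), if_neg (by omega), if_neg (by omega), if_neg (by omega),
        if_neg (by omega), r1 _ hr]

theorem Represents.setV {B : ℕ} {s : Store} {c : State} (h : Represents B s c) (x a : ℕ) :
    Represents B (s.setV x a) (c.setReg (4 * x + 4) a) where
  v y := by
    simp only [State.setReg_reg, Store.setV_v, h.v]
    by_cases hy : y = x
    · simp [hy]
    · rw [if_neg (by omega), if_neg hy]
  arr := h.arr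
  low := h.low
  r0 := by rw [State.setReg_reg, if_neg (by omega), h.r0]
  r1 := by rw [State.setReg_reg, if_neg (by omega), h.r1]
  r2 := by rw [State.setReg_reg, if_neg (by omega), h.r2]
  r3 := by rw [State.setReg_reg, if_neg (by omega), h.r3]

theorem Represents.setA {B : ℕ} {s : Store} {c : State} (h : Represents B s c) {a : ℕ}
    (ha : a < 16) (i x : ℕ) :
    Represents B (s.setA a i x) (c.setMem (B + 16 * i + a) x) where
  v := h.v
  arr b hb j := by
    simp only [State.setMem_mem, Store.setA_arr_apply, h.arr b hb]
    by_cases hy : b = a ∧ j = i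
    · simp [hy]
    · rw [if_neg (by omega), if_neg hy]
  low j hj := by rw [State.setMem_mem, if_neg (by omega), h.low j hj]; rfl
  r0 := h.r0
  r1 := h.r1
  r2 := h.r2
  r3 := h.r3

theorem Represents.setL {B : ℕ} {s : Store} {c : State} (h : Represents B s c) {i : ℕ}
    (hi : i < B) (x : ℕ) : Represents B (s.setL i x) (c.setMem i x) where
  v := h.v
  arr b hb j := by rw [State.setMem_mem, if_neg (by omega), h.arr b hb j]; rfl
  low j hj := by simp [h.low j hj]
  r0 := h.r0
  r1 := h.r1
  r2 := h.r2
  r3 := h.r3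

/-- A loop at depth `l` owns two registers that no variable uses, and its body is compiled at depth
`l + 1`. The last clause, that counters of smaller depth survive, is what makes the induction
through nested loops work. -/
theorem Stm.exec_comp {w B X : ℕ} (P : Stm) (s : Store) (l : ℕ)
    (c : State) (hc : Represents B s c) (hP : P.Safe (2 ^ w) B X s) :
    ∃ t c', Exec w (P.comp l) c t c' ∧ t ≤ P.cost X ∧ Represents B (P.run s) c' ∧
      ∀ j < l, c'.reg (4 * j + 6) = c.reg (4 * j + 6) ∧ c'.reg (4 * j + 7) = c.reg (4 * j + 7) := by
  induction P generalizing s l c with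
  | skip => exact ⟨1, c, .skip c, le_rfl, hc, fun _ _ => ⟨rfl, rfl⟩⟩
  | set x e =>
    obtain ⟨c1, h1, v1, m1, r1⟩ := e.exec_comp 0 c hc hP
    have hc1 : Represents B s c1 := hc.congr m1 fun r hr => r1 r (by omega)
    refine ⟨_, _, .seq h1 (.arith' c1 .add _ _ _ (e.eval s) ?_ hP.eval_lt), le_rfl,
      hc1.setV x _, fun j hj => ?_⟩
    · rw [v1, hc1.r0]; rfl
    · rw [State.setReg_reg, State.setReg_reg, if_neg (by omega), if_neg (by omega),
        r1 _ (by omega), r1 _ (by omega)]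
      exact ⟨rfl, rfl⟩
  | put a i e =>
    obtain ⟨ha, hi, he, hb⟩ := hP
    obtain ⟨c1, h1, v1, m1, r1⟩ := i.exec_comp 0 c hc hi
    have hc1 : Represents B s c1 := hc.congr m1 fun r hr => r1 r (by omega)
    obtain ⟨c2, h2, v2, m2, r2⟩ := e.exec_comp 1 c1 hc1 he
    have hc2 : Represents B s c2 := hc1.congr m2 fun r hr => r2 r (by omega)
    have v12 : c2.reg 5 = i.eval s := by rw [r2 _ (by omega)]; exact v1
    have v2 : c2.reg 9 = e.eval s := v2
    refine ⟨i.cost + (e.cost + (1 + (1 + (1 + (1 + 1))))),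
      (((((c2.setReg 5 (16 * i.eval s)).setReg 5 (B + 16 * i.eval s)).setReg 13 a).setReg 5
        (B + 16 * i.eval s + a)).setMem (B + 16 * i.eval s + a) (e.eval s)), ?_, ?_, ?_, ?_⟩
    · refine .seq h1 (.seq h2 (.seq (.arith' _ .mul _ _ _ (16 * i.eval s) ?_ (by omega))
        (.seq (.arith' _ .add _ _ _ (B + 16 * i.eval s) ?_ (by omega))
        (.seq (.const _ _ a (by omega))
        (.seq (.arith' _ .add _ _ _ (B + 16 * i.eval s + a) ?_ (by omega))
        (.store' _ _ _ _ _ ?_ ?_))))))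
      · simp [Op.eval, v12, hc2.r3, mul_comm]
      · simp [Op.eval, hc2.r2, add_comm]
      · simp [Op.eval]
      · simp
      · simp [v2]
    · simp only [Stm.cost]; omega
    · refine Represents.setA (hc2.congr (by simp) fun r hr => ?_) ha _ _
      simp only [State.setReg_reg]
      rw [if_neg (by omega), if_neg (by omega), if_neg (by omega), if_neg (by omega)]
    · intro j hj
      simp only [State.setMem_reg, State.setReg_reg]
      repeat rw [if_neg (by omega)]
      rw [r2 _ (by omega), r2 _ (by omega), r1 _ (by omega), r1 _ (by omega)]
      exact ⟨rfl, rfl⟩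
  | out i e =>
    obtain ⟨hi, he, hb⟩ := hP
    obtain ⟨c1, h1, v1, m1, r1⟩ := i.exec_comp 0 c hc hi
    have hc1 : Represents B s c1 := hc.congr m1 fun r hr => r1 r (by omega)
    obtain ⟨c2, h2, v2, m2, r2⟩ := e.exec_comp 1 c1 hc1 he
    have hc2 : Represents B s c2 := hc1.congr m2 fun r hr => r2 r (by omega)
    have v12 : c2.reg 5 = i.eval s := by rw [r2 _ (by omega)]; exact v1
    have v2 : c2.reg 9 = e.eval s := v2
    refine ⟨i.cost + (e.cost + 1), c2.setMem (i.eval s) (e.eval s), ?_, ?_, ?_, ?_⟩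
    · refine .seq h1 (.seq h2 ?_)
      rw [← v12, ← v2]
      exact .store _ _ _
    · simp only [Stm.cost]; omega
    · exact hc2.setL hb _
    · intro j hj
      simp only [State.setMem_reg]
      rw [r2 _ (by omega), r2 _ (by omega), r1 _ (by omega), r1 _ (by omega)]
      exact ⟨rfl, rfl⟩
  | seq P Q ihP ihQ =>
    obtain ⟨t1, c1, h1, l1, hc1, f1⟩ := ihP s l c hc hP.1
    obtain ⟨t2, c2, h2, l2, hc2, f2⟩ := ihQ _ l c1 hc1 hP.2
    refine ⟨_, _, .seq h1 h2, Nat.add_le_add l1 l2, hc2, fun j hj => ?_⟩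
    rw [(f2 j hj).1, (f2 j hj).2, (f1 j hj).1, (f1 j hj).2]
    exact ⟨rfl, rfl⟩
  | ite e P Q ihP ihQ =>
    obtain ⟨he, hP, hQ⟩ := hP
    obtain ⟨c1, h1, v1, m1, r1⟩ := e.exec_comp 0 c hc he
    have hc1 : Represents B s c1 := hc.congr m1 fun r hr => r1 r (by omega)
    have v1 : c1.reg 5 = e.eval s := v1
    by_cases h : e.eval s = 0
    · obtain ⟨t2, c2, h2, l2, hc2, f2⟩ := ihQ _ l c1 hc1 (hQ h)
      refine ⟨_, _, .seq h1 (.ite_neg (v1.trans h) h2), ?_, ?_, fun j hj => ?_⟩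
      · simp only [Stm.cost]; omega
      · simpa [h] using hc2
      · rw [(f2 j hj).1, (f2 j hj).2, r1 _ (by omega), r1 _ (by omega)]
        exact ⟨rfl, rfl⟩
    · obtain ⟨t2, c2, h2, l2, hc2, f2⟩ := ihP _ l c1 hc1 (hP h)
      refine ⟨_, _, .seq h1 (.ite_pos (by rwa [v1]) h2), ?_, ?_, fun j hj => ?_⟩
      · simp only [Stm.cost]; omega
      · simpa [h] using hc2
      · rw [(f2 j hj).1, (f2 j hj).2, r1 _ (by omega), r1 _ (by omega)]
        exact ⟨rfl, rfl⟩
  | loop x e P ih =>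
    obtain ⟨he, hN, hP⟩ := hP
    have hlt := he.eval_lt
    obtain ⟨c1, h1, v1, m1, r1⟩ := e.exec_comp 0 c hc he
    have hc1 : Represents B s c1 := hc.congr m1 fun r hr => r1 r (by omega)
    have v1 : c1.reg 5 = e.eval s := v1
    -- The machine can only test for nonzero, so one register counts the remaining iterations `r`
    -- down while another counts `i` up; `i + r` is constant. The loop variable is a copy of the
    -- latter, so the body may overwrite it.
    have key : ∀ r i (c : State), i + r = e.eval s → Represents B (s.iter P.run x i) c →
        c.reg (4 * l + 7) = r → c.reg (4 * l + 6) = i →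
        ∃ t c', Exec w (.loop (4 * l + 7) (.seq (.arith .add (4 * x + 4) (4 * l + 6) 0)
          (.seq (P.comp (l + 1)) (.seq (.arith .add (4 * l + 6) (4 * l + 6) 1)
            (.arith .sub (4 * l + 7) (4 * l + 7) 1))))) c t c' ∧ t ≤ r * (P.cost X + 4) + 1 ∧
          Represents B (s.iter P.run x (e.eval s)) c' ∧ ∀ j < l,
            c'.reg (4 * j + 6) = c.reg (4 * j + 6) ∧ c'.reg (4 * j + 7) = c.reg (4 * j + 7) := by
      intro r
      induction r with
      | zero =>
        intro i c hi hc hr _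
        refine ⟨1, c, .loop_neg hr, by simp, ?_, fun _ _ => ⟨rfl, rfl⟩⟩
        rw [← hi]; exact hc
      | succ r ihr =>
        intro i c hi hc hr hI
        have hc' := hc.setV x i
        obtain ⟨t2, c2, h2, l2, hc2, f2⟩ := ih _ (l + 1) _ hc' (hP i (by omega))
        have fl := f2 l (by omega)
        rw [State.setReg_reg, State.setReg_reg, if_neg (by omega), if_neg (by omega), hr, hI] at fl
        obtain ⟨t3, c3, h3, l3, hc3, f3⟩ := ihr (i + 1)
          ((c2.setReg (4 * l + 6) (i + 1)).setReg (4 * l + 7) r) (by omega)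
          (hc2.congr (by simp) fun r hr => by
            rw [State.setReg_reg, if_neg (by omega), State.setReg_reg, if_neg (by omega)])
          (by simp) (by simp)
        refine ⟨1 + (t2 + (1 + 1)) + t3 + 1, c3, .loop_pos (by omega) (.seq
          (.arith' _ .add _ _ _ i (by rw [hI, hc.r0]; rfl) (by omega)) (.seq h2 (.seq
          (.arith' _ .add _ _ _ (i + 1) (by rw [fl.1, hc2.r1]; rfl) (by omega))
          (.arith' _ .sub _ _ _ r ?_ (by omega))))) h3, ?_, hc3, fun j hj => ?_⟩
        · rw [State.setReg_reg, State.setReg_reg, if_neg (by omega), if_neg (by omega), fl.2,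
            hc2.r1]
          simp [Op.eval]
        · have : (r + 1) * (P.cost X + 4) = r * (P.cost X + 4) + (P.cost X + 4) := by ring
          omega
        · rw [(f3 j hj).1, (f3 j hj).2]
          simp only [State.setReg_reg]
          repeat rw [if_neg (by omega)]
          rw [(f2 j (by omega)).1, (f2 j (by omega)).2]
          simp only [State.setReg_reg]
          repeat rw [if_neg (by omega)]
          exact ⟨rfl, rfl⟩
    obtain ⟨t, c2, h2, l2, hc2, f2⟩ := key (e.eval s) 0
      ((c1.setReg (4 * l + 7) (e.eval s)).setReg (4 * l + 6) 0) (by simp)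
      (hc1.congr (by simp) fun r hr => by
            rw [State.setReg_reg, if_neg (by omega), State.setReg_reg, if_neg (by omega)])
      (by simp) (by simp)
    refine ⟨e.cost + (1 + (1 + t)), c2, .seq h1 (.seq
      (.arith' _ .add _ _ _ _ (by rw [v1, hc1.r0]; rfl) (by omega))
      (.seq (.const _ _ 0 (by positivity)) h2)), ?_, hc2, fun j hj => ?_⟩
    · simp only [Stm.cost]
      have := Nat.mul_le_mul_right (P.cost X + 4) hN
      omega
    · rw [(f2 j hj).1, (f2 j hj).2]
      simp only [State.setReg_reg]
      repeat rw [if_neg (by omega)]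
      rw [r1 _ (by omega), r1 _ (by omega)]
      exact ⟨rfl, rfl⟩

/-! ### Loop invariants and frames -/

namespace Stm

/-- The statement may change the variable `x`. -/
@[simp] def writesV : Stm → ℕ → Bool
  | .skip, _ => false
  | .set y _, x => x == y
  | .put _ _ _, _ => false
  | .out _ _, _ => false
  | .seq P Q, x => P.writesV x || Q.writesV x
  | .ite _ P Q, x => P.writesV x || Q.writesV x
  | .loop y _ P, x => x == y || P.writesV x

/-- The statement may change the array `a`. -/
@[simp] def writesA : Stm → ℕ → Bool
  | .skip, _ => false
  | .set _ _, _ => false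
  | .put b _ _, a => a == b
  | .out _ _, _ => false
  | .seq P Q, a => P.writesA a || Q.writesA a
  | .ite _ P Q, a => P.writesA a || Q.writesA a
  | .loop _ _ P, a => P.writesA a

/-- The statement may change the input and output cells. -/
@[simp] def writesL : Stm → Bool
  | .out _ _ => true
  | .seq P Q => P.writesL || Q.writesL
  | .ite _ P Q => P.writesL || Q.writesL
  | .loop _ _ P => P.writesL
  | _ => false

/-- The stores `s` and `t` agree on everything that `P` does not change. -/
structure Frame (P : Stm) (s t : Store) : Prop where
  v : ∀ x, P.writesV x = false → t.v x = s.v x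
  arr : ∀ a, P.writesA a = false → t.arr a = s.arr a
  low : P.writesL = false → t.low = s.low

theorem Frame.refl (P : Stm) (s : Store) : P.Frame s s :=
  ⟨fun _ _ => rfl, fun _ _ => rfl, fun _ => rfl⟩

theorem Frame.trans {P : Stm} {s t u : Store} (h : P.Frame s t) (h' : P.Frame t u) :
    P.Frame s u :=
  ⟨fun x hx => (h'.v x hx).trans (h.v x hx), fun x hx => (h'.arr x hx).trans (h.arr x hx),
    fun hx => (h'.low hx).trans (h.low hx)⟩

theorem Frame.mono {P Q : Stm} {s t : Store} (h : P.Frame s t)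
    (hv : ∀ x, Q.writesV x = false → P.writesV x = false)
    (ha : ∀ x, Q.writesA x = false → P.writesA x = false)
    (hl : Q.writesL = false → P.writesL = false) : Q.Frame s t :=
  ⟨fun x hx => h.v x (hv x hx), fun x hx => h.arr x (ha x hx), fun hx => h.low (hl hx)⟩

/-- The sets of changed variables and arrays are computed from the syntax alone, so for a concrete
statement the side conditions of a frame are settled by `decide`. -/
theorem frame_run (P : Stm) (s : Store) : P.Frame s (P.run s) := by
  induction P generalizing s with
  | skip => exact .refl _ _
  | set y e => exact ⟨fun x hx => by simp_all, fun a _ => rfl, fun _ => rfl⟩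
  | put b i e =>
    refine ⟨fun x hx => rfl, fun a ha => ?_, fun _ => rfl⟩
    rw [run, Store.setA_arr, if_neg (by simpa using ha)]
  | out i e => exact ⟨fun x hx => rfl, fun a _ => rfl, fun h => by simp at h⟩
  | seq P Q ihP ihQ =>
    exact ((ihP s).mono (by simp +contextual) (by simp +contextual) (by simp +contextual)).trans
      ((ihQ _).mono (by simp +contextual) (by simp +contextual) (by simp +contextual))
  | ite e P Q ihP ihQ =>
    by_cases h : e.eval s = 0
    · simpa [h] using
        (ihQ s).mono (by simp +contextual) (by simp +contextual) (by simp +contextual)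
    · simpa [h] using
        (ihP s).mono (by simp +contextual) (by simp +contextual) (by simp +contextual)
  | loop y e P ih =>
    have : ∀ i, (loop y e P).Frame s (s.iter P.run y i) := by
      intro i
      induction i with
      | zero => exact .refl _ _
      | succ i ihi =>
        refine ihi.trans (.trans (t := (s.iter P.run y i).setV y i) ?_
          ((ih _).mono (by simp +contextual) (by simp +contextual) (by simp +contextual)))
        exact ⟨fun x hx => by simp_all, fun a _ => rfl, fun _ => rfl⟩
    exact this _

theorem run_seq (P Q : Stm) (s : Store) : (seq P Q).run s = Q.run (P.run s) := rfl

theorem run_ite_pos {e : Ex} {s : Store} (h : e.eval s ≠ 0) (P Q : Stm) :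
    (ite e P Q).run s = P.run s := if_pos h

theorem run_ite_neg {e : Ex} {s : Store} (h : ¬ e.eval s ≠ 0) (P Q : Stm) :
    (ite e P Q).run s = Q.run s := if_neg h

/-- The number of iterations plays no part in what a loop may change, so `.lit 0` is a placeholder
in the frame. -/
theorem iter_inv {x N : ℕ} {P : Stm} {s : Store} (Inv : ℕ → Store → Prop) (h0 : Inv 0 s)
    (hs : ∀ i t, i < N → (loop x (.lit 0) P).Frame s t → Inv i t →
      Inv (i + 1) (P.run (t.setV x i))) (i : ℕ) (hi : i ≤ N) :
    (loop x (.lit 0) P).Frame s (s.iter P.run x i) ∧ Inv i (s.iter P.run x i) := by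
  induction i with
  | zero => exact ⟨.refl _ _, h0⟩
  | succ i ih =>
    obtain ⟨h1, h2⟩ := ih (by omega)
    refine ⟨h1.trans (.trans (t := (s.iter P.run x i).setV x i) ?_
      ((frame_run _ _).mono (by simp +contextual) (by simp +contextual) (by simp +contextual))),
      hs i _ (by omega) h1 h2⟩
    exact ⟨fun x hx => by simp_all, fun a _ => rfl, fun _ => rfl⟩

/-- Verification of loops by invariants. -/
theorem loop_inv {x : ℕ} {e : Ex} {P : Stm} {s : Store} (Inv : ℕ → Store → Prop) {N : ℕ}
    (hN : e.eval s = N) (h0 : Inv 0 s)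
    (hs : ∀ i t, i < N → (loop x (.lit 0) P).Frame s t → Inv i t →
      Inv (i + 1) (P.run (t.setV x i))) : Inv N ((loop x e P).run s) := by
  subst hN
  exact (iter_inv Inv h0 hs _ le_rfl).2

end Stm

/-! ### Static bounds for numbers and running time -/

/-- Upper bounds for the variables, the arrays and the input and output cells. -/
structure Bounds where
  v : ℕ → ℕ
  arr : ℕ → ℕ
  low : ℕ

/-- All values in the store obey the bounds. -/
structure Store.Bounded (b : Bounds) (s : Store) : Prop where
  v : ∀ x, s.v x ≤ b.v x
  arr : ∀ a i, s.arr a i ≤ b.arr a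
  low : ∀ i, s.low i ≤ b.low

/-- A bound for the value of an expression. -/
@[simp] def Ex.ub (b : Bounds) : Ex → ℕ
  | .lit c => c
  | .var x => b.v x
  | .op .add d e => d.ub b + e.ub b
  | .op .mul d e => d.ub b * e.ub b
  | .op .sub d (.lit c) => d.ub b - c
  | .op .sub d _ => d.ub b
  | .op .div d _ => d.ub b
  | .op .mod d _ => d.ub b
  | .op .lt _ _ => 1
  | .cap _ e => e.ub b
  | .inp _ => b.low
  | .get a _ => b.arr a

theorem Ex.eval_le_ub {b : Bounds} {s : Store} (h : s.Bounded b) (e : Ex) : e.eval s ≤ e.ub b := by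
  induction e with
  | lit c => exact le_rfl
  | var x => exact h.v x
  | op o d e ihd ihe =>
    cases o with
    | add => exact Nat.add_le_add ihd ihe
    | mul => exact Nat.mul_le_mul ihd ihe
    | sub =>
      cases e with
      | lit c => exact Nat.sub_le_sub_right ihd c
      | _ => exact (Nat.sub_le _ _).trans ihd
    | div => exact (Nat.div_le_self _ _).trans ihd
    | mod => exact (Nat.mod_le _ _).trans ihd
    | lt => simp only [eval, Op.eval, ub]; split <;> omega
  | cap d e ihd ihe => exact (min_le_right _ _).trans ihe
  | inp e ih => exact h.low _
  | get a e ih => exact h.arr _ _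

/-- Input cells are read below `B` only. -/
@[simp] def Ex.InpOk (B : ℕ) (s : Store) : Ex → Prop
  | .lit _ => True
  | .var _ => True
  | .op _ d e => d.InpOk B s ∧ e.InpOk B s
  | .cap d e => d.InpOk B s ∧ e.InpOk B s
  | .inp e => e.InpOk B s ∧ e.eval s < B
  | .get _ e => e.InpOk B s

/-- Input cells are read below `B` only, according to the bounds. -/
@[simp] def Ex.InpLt (B : ℕ) (b : Bounds) : Ex → Prop
  | .lit _ => True
  | .var _ => True
  | .op _ d e => d.InpLt B b ∧ e.InpLt B b
  | .cap d e => d.InpLt B b ∧ e.InpLt B b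
  | .inp e => e.InpLt B b ∧ e.ub b < B
  | .get _ e => e.InpLt B b

theorem Ex.InpLt.inpOk {B : ℕ} {b : Bounds} {s : Store} (h : s.Bounded b) {e : Ex}
    (he : e.InpLt B b) : e.InpOk B s := by
  induction e with
  | lit c => trivial
  | var x => trivial
  | op o d e ihd ihe => exact ⟨ihd he.1, ihe he.2⟩
  | cap d e ihd ihe => exact ⟨ihd he.1, ihe he.2⟩
  | inp e ih => exact ⟨ih he.1, (e.eval_le_ub h).trans_lt he.2⟩
  | get a e ih => exact ih he

/-- Constants and array names are small. -/
def Ex.small : Ex → Bool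
  | .lit c => c ≤ 16
  | .var _ => true
  | .op _ d e => d.small && e.small
  | .cap d e => d.small && e.small
  | .inp e => e.small
  | .get a e => decide (a < 16) && e.small

/-- An exponent: if variables and cells contain at most `U`, values are at most `U ^ deg`. -/
def Ex.deg : Ex → ℕ
  | .lit _ => 1
  | .var _ => 1
  | .op _ d e => d.deg + e.deg
  | .cap d e => d.deg + e.deg
  | .inp e => e.deg + 1
  | .get _ e => e.deg + 3

/-! ### Polynomial bounds for values and addresses. -/

theorem Ex.deg_pos (e : Ex) : 1 ≤ e.deg := by
  induction e <;> simp only [deg] <;> omega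

theorem add_le_pow_add {U x y a b : ℕ} (hU : 2 ≤ U) (ha : 1 ≤ a) (hb : 1 ≤ b) (hx : x ≤ U ^ a)
    (hy : y ≤ U ^ b) : x + y ≤ U ^ (a + b) := by
  have h1 : 2 ≤ U ^ a := hU.trans (Nat.le_self_pow (by omega) U)
  have h2 : 2 ≤ U ^ b := hU.trans (Nat.le_self_pow (by omega) U)
  rw [pow_add]
  nlinarith

theorem Ex.safe_of_le {W B U : ℕ} {s : Store} (hU : 16 ≤ U) (hB : B ≤ U) (hv : ∀ x, s.v x ≤ U)
    (ha : ∀ a i, s.arr a i ≤ U) (hl : ∀ i, s.low i ≤ U) {e : Ex} (hs : e.small = true)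
    (he : e.InpOk B s) (hW : U ^ e.deg < W) : e.Safe W B s ∧ e.eval s ≤ U ^ e.deg := by
  induction e generalizing W with
  | lit c =>
    simp only [deg, pow_one, small, decide_eq_true_eq] at *
    exact ⟨by simp only [Safe]; omega, by simp only [eval]; omega⟩
  | var x =>
    simp only [deg, pow_one] at *
    exact ⟨(hv x).trans_lt hW, hv x⟩
  | op o d e ihd ihe =>
    simp only [deg, small, Bool.and_eq_true] at *
    have hpd : U ^ d.deg ≤ U ^ (d.deg + e.deg) := Nat.pow_le_pow_right (by omega) (by omega)
    have hpe : U ^ e.deg ≤ U ^ (d.deg + e.deg) := Nat.pow_le_pow_right (by omega) (by omega)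
    obtain ⟨h1, h2⟩ := ihd (W := W) hs.1 he.1 (by omega)
    obtain ⟨h3, h4⟩ := ihe (W := W) hs.2 he.2 (by omega)
    have key : (op o d e).eval s ≤ U ^ (d.deg + e.deg) := by
      cases o with
      | add => exact add_le_pow_add (by omega) d.deg_pos e.deg_pos h2 h4
      | mul => rw [pow_add]; exact Nat.mul_le_mul h2 h4
      | sub => exact ((Nat.sub_le _ _).trans h2).trans hpd
      | div => exact ((Nat.div_le_self _ _).trans h2).trans hpd
      | mod => exact ((Nat.mod_le _ _).trans h2).trans hpd
      | lt =>
        have : 1 ≤ U ^ (d.deg + e.deg) := Nat.one_le_pow _ _ (by omega)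
        simp only [eval, Op.eval]; split <;> omega
    exact ⟨⟨h1, h3, key.trans_lt hW⟩, key⟩
  | cap d e ihd ihe =>
    simp only [deg, small, Bool.and_eq_true] at *
    have hpd : U ^ d.deg ≤ U ^ (d.deg + e.deg) := Nat.pow_le_pow_right (by omega) (by omega)
    have hpe : U ^ e.deg ≤ U ^ (d.deg + e.deg) := Nat.pow_le_pow_right (by omega) (by omega)
    obtain ⟨h1, h2⟩ := ihd (W := W) hs.1 he.1 (by omega)
    obtain ⟨h3, h4⟩ := ihe (W := W) hs.2 he.2 (by omega)
    exact ⟨⟨h1, h3⟩, (min_le_left _ _).trans (h2.trans hpd)⟩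
  | inp e ih =>
    simp only [deg, small] at *
    have hpe : U ^ e.deg ≤ U ^ (e.deg + 1) := Nat.pow_le_pow_right (by omega) (by omega)
    have hU1 : U ≤ U ^ (e.deg + 1) := Nat.le_self_pow (by omega) U
    obtain ⟨h1, h2⟩ := ih (W := W) hs he.1 (by omega)
    exact ⟨⟨h1, he.2, (hl _).trans_lt (by omega)⟩, (hl _).trans hU1⟩
  | get a e ih =>
    simp only [deg, small, Bool.and_eq_true, decide_eq_true_eq] at *
    have hpe : U ^ e.deg ≤ U ^ (e.deg + 3) := Nat.pow_le_pow_right (by omega) (by omega)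
    have hU1 : U ≤ U ^ (e.deg + 3) := Nat.le_self_pow (by omega) U
    obtain ⟨h1, h2⟩ := ih (W := W) hs.2 he (by omega)
    refine ⟨⟨hs.1, h1, ?_, (ha _ _).trans_lt (by omega)⟩, (ha _ _).trans hU1⟩
    -- In the address `B + 16 * i + a` the offset, the factor 16 and the array number are absorbed
    -- by three further factors of `U ≥ 16`.
    have h5 : 1 ≤ U ^ e.deg := Nat.one_le_pow _ _ (by omega)
    have h6 : U ^ (e.deg + 3) = U ^ e.deg * (U * U * U) := by ring
    have h7 : 16 * 16 * U ≤ U * U * U := Nat.mul_le_mul_right U (Nat.mul_le_mul hU hU)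
    have h8 : U ^ e.deg * (256 * U) ≤ U ^ e.deg * (U * U * U) := Nat.mul_le_mul_left _ (by omega)
    nlinarith [hs.1]

namespace Stm

/-- Constants and array names are small. -/
def small : Stm → Bool
  | .skip => true
  | .set _ e => e.small
  | .put a i e => decide (a < 16) && i.small && e.small
  | .out i e => i.small && e.small
  | .seq P Q => P.small && Q.small
  | .ite e P Q => e.small && P.small && Q.small
  | .loop _ e P => e.small && P.small

/-- The largest exponent of an expression or address in the statement. -/
def deg : Stm → ℕ
  | .skip => 0
  | .set _ e => e.deg
  | .put _ i e => (i.deg + 3) + e.deg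
  | .out i e => i.deg + e.deg
  | .seq P Q => P.deg + Q.deg
  | .ite e P Q => e.deg + P.deg + Q.deg
  | .loop _ e P => e.deg + P.deg

/-- Assignments respect the bounds, input cells lie below `B`, and no loop has more than `X`
iterations. -/
@[simp] def Obeys (b : Bounds) (B X : ℕ) : Stm → Prop
  | .skip => True
  | .set x e => e.InpLt B b ∧ e.ub b ≤ b.v x
  | .put a i e => i.InpLt B b ∧ e.InpLt B b ∧ e.ub b ≤ b.arr a
  | .out i e => i.InpLt B b ∧ e.InpLt B b ∧ i.ub b < B ∧ e.ub b ≤ b.low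
  | .seq P Q => P.Obeys b B X ∧ Q.Obeys b B X
  | .ite e P Q => e.InpLt B b ∧ P.Obeys b B X ∧ Q.Obeys b B X
  | .loop x e P => e.InpLt B b ∧ e.ub b ≤ X ∧ e.ub b - 1 ≤ b.v x ∧ P.Obeys b B X

/-- The bounds are an invariant: each assignment is checked once against the syntactic upper bound
of its right-hand side, whatever the control flow. Word-length safety of a concrete program thereby
becomes a finite list of inequalities between the bounds. -/
theorem Obeys.safe {W B U X : ℕ} {b : Bounds} (hU : 16 ≤ U) (hB : B ≤ U) (hv : ∀ x, b.v x ≤ U)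
    (ha : ∀ a, b.arr a ≤ U) (hl : b.low ≤ U) {P : Stm} (hs : P.small = true)
    (hP : P.Obeys b B X) (hW : U ^ P.deg < W) {s : Store} (h : s.Bounded b) :
    P.Safe W B X s ∧ (P.run s).Bounded b := by
  have hmono : ∀ {i j : ℕ}, i ≤ j → U ^ j < W → U ^ i < W := fun hij hj =>
    (Nat.pow_le_pow_right (by omega) hij).trans_lt hj
  have safe : ∀ {e : Ex} {s : Store}, s.Bounded b → e.small = true → e.InpLt B b →
      U ^ e.deg < W → e.Safe W B s := fun h hs he hW =>
    (Ex.safe_of_le hU hB (fun x => (h.v x).trans (hv x)) (fun a i => (h.arr a i).trans (ha a))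
      (fun i => (h.low i).trans hl) hs (he.inpOk h) hW).1
  induction P generalizing s with
  | skip => exact ⟨trivial, h⟩
  | set x e =>
    refine ⟨safe h hs hP.1 hW, fun y => ?_, h.arr, h.low⟩
    simp only [run, Store.setV_v]
    split
    · next hy => subst hy; exact (e.eval_le_ub h).trans hP.2
    · exact h.v y
  | put a i e =>
    simp only [small, Bool.and_eq_true, decide_eq_true_eq, deg] at hs hW
    refine ⟨⟨hs.1.1, safe h hs.1.2 hP.1 (hmono (by omega) hW),
      safe h hs.2 hP.2.1 (hmono (by omega) hW), ?_⟩, h.v, fun c j => ?_, h.low⟩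
    -- Writing to a cell needs the same address as reading from it, so the bound is borrowed from
    -- `Ex.get`.
    · have hg : (Ex.get a i).small = true := by simp [Ex.small, hs.1.1, hs.1.2]
      exact (safe (e := .get a i) h hg hP.1 (hmono (by simp only [Ex.deg]; omega) hW)).2.2.1
    · simp only [run, Store.setA_arr_apply]
      split
      · next hy => rw [hy.1]; exact (e.eval_le_ub h).trans hP.2.2
      · exact h.arr c j
  | out i e =>
    simp only [small, Bool.and_eq_true, deg] at hs hW
    refine ⟨⟨safe h hs.1 hP.1 (hmono (by omega) hW), safe h hs.2 hP.2.1 (hmono (by omega) hW),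
      (i.eval_le_ub h).trans_lt hP.2.2.1⟩, h.v, h.arr, fun j => ?_⟩
    simp only [run, Store.setL_low]
    split
    · exact (e.eval_le_ub h).trans hP.2.2.2
    · exact h.low j
  | seq P Q ihP ihQ =>
    simp only [small, Bool.and_eq_true, deg] at hs hW
    obtain ⟨h1, h2⟩ := ihP hs.1 hP.1 (hmono (by omega) hW) h
    obtain ⟨h3, h4⟩ := ihQ hs.2 hP.2 (hmono (by omega) hW) h2
    exact ⟨⟨h1, h3⟩, h4⟩
  | ite e P Q ihP ihQ =>
    simp only [small, Bool.and_eq_true, deg] at hs hW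
    obtain ⟨h1, h2⟩ := ihP hs.1.2 hP.2.1 (hmono (by omega) hW) h
    obtain ⟨h3, h4⟩ := ihQ hs.2 hP.2.2 (hmono (by omega) hW) h
    refine ⟨⟨safe h hs.1.1 hP.1 (hmono (by omega) hW), fun _ => h1, fun _ => h3⟩, ?_⟩
    simp only [run]
    split
    · exact h2
    · exact h4
  | loop x e P ih =>
    simp only [small, Bool.and_eq_true, deg] at hs hW
    obtain ⟨he, hX, hx, hP⟩ := hP
    have hub := e.eval_le_ub h
    have hset : ∀ {t : Store} {i : ℕ}, t.Bounded b → i < e.eval s → (t.setV x i).Bounded b := by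
      intro t i ht hi
      refine ⟨fun y => ?_, ht.arr, ht.low⟩
      simp only [Store.setV_v]
      split
      · next hy => subst hy; omega
      · exact ht.v y
    have key : ∀ i ≤ e.eval s, (s.iter P.run x i).Bounded b := by
      intro i
      induction i with
      | zero => exact fun _ => h
      | succ i ihi =>
        exact fun hi => (ih hs.2 hP (hmono (by omega) hW) (hset (ihi (by omega)) (by omega))).2
    exact ⟨⟨safe h hs.1 he (hmono (by omega) hW), hub.trans hX, fun i hi =>
      (ih hs.2 hP (hmono (by omega) hW) (hset (key i (by omega)) hi)).1⟩, key _ le_rfl⟩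

/-- The nesting depth of loops. -/
def depth : Stm → ℕ
  | .seq P Q => P.depth + Q.depth
  | .ite _ P Q => P.depth + Q.depth
  | .loop _ _ P => P.depth + 1
  | _ => 0

/-- A constant that bounds the number of steps up to a power of the loop bound. -/
def size (P : Stm) : ℕ :=
  match P with
  | .skip => 1
  | .set _ e => e.cost + 1
  | .put _ i e => i.cost + e.cost + 5
  | .out i e => i.cost + e.cost + 1
  | .seq P Q => P.size + Q.size
  | .ite e P Q => e.cost + (P.size + Q.size) + 1
  | .loop _ e P => e.cost + 3 + (P.size + 4)

/-- Depths of consecutive statements are added although a maximum would do; this only enlarges an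
absolute exponent. -/
theorem cost_le {X : ℕ} (hX : 1 ≤ X) (P : Stm) : P.cost X ≤ P.size * X ^ P.depth := by
  have hp : ∀ d, 1 ≤ X ^ d := fun d => Nat.one_le_pow _ _ hX
  have hm : ∀ {i j : ℕ}, i ≤ j → X ^ i ≤ X ^ j := fun h => Nat.pow_le_pow_right hX h
  induction P with
  | skip => simp [cost, size, depth]
  | set => simp [cost, size, depth]
  | put => simp [cost, size, depth]
  | out => simp [cost, size, depth]
  | seq P Q ihP ihQ =>
    simp only [cost, size, depth]
    have h1 := Nat.mul_le_mul_left P.size (hm (Nat.le_add_right P.depth Q.depth))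
    have h2 := Nat.mul_le_mul_left Q.size (hm (Nat.le_add_left Q.depth P.depth))
    rw [add_mul]
    omega
  | ite e P Q ihP ihQ =>
    simp only [cost, size, depth]
    have h1 := Nat.mul_le_mul_left P.size (hm (Nat.le_add_right P.depth Q.depth))
    have h2 := Nat.mul_le_mul_left Q.size (hm (Nat.le_add_left Q.depth P.depth))
    have h3 := Nat.mul_le_mul_left (e.cost + 1) (hp (P.depth + Q.depth))
    have : (e.cost + (P.size + Q.size) + 1) * X ^ (P.depth + Q.depth) =
      (e.cost + 1) * X ^ (P.depth + Q.depth) + P.size * X ^ (P.depth + Q.depth) +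
        Q.size * X ^ (P.depth + Q.depth) := by ring
    omega
  | loop x e P ih =>
    simp only [cost, size, depth]
    have h1 := Nat.mul_le_mul_left X (Nat.add_le_add ih (Nat.mul_le_mul_left 4 (hp P.depth)))
    rw [mul_one] at h1
    have h3 := Nat.mul_le_mul_left (e.cost + 3) (hp (P.depth + 1))
    have : (e.cost + 3 + (P.size + 4)) * X ^ (P.depth + 1) =
      (e.cost + 3) * X ^ (P.depth + 1) +
        X * (P.size * X ^ P.depth + 4 * X ^ P.depth) := by ring
    omega

end Stm

/-! ### Elimination orders from tree decompositions -/

section Tree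

variable {ι : Type} {T : SimpleGraph ι}

/-- The path from `r` to `s` in a tree. -/
noncomputable def treePath (hT : T.IsTree) (r s : ι) : T.Walk r s :=
  (hT.existsUnique_path r s).choose

theorem treePath_isPath (hT : T.IsTree) (r s : ι) : (treePath hT r s).IsPath :=
  (hT.existsUnique_path r s).choose_spec.1

theorem eq_treePath (hT : T.IsTree) {r s : ι} {p : T.Walk r s} (hp : p.IsPath) :
    p = treePath hT r s :=
  (hT.existsUnique_path r s).choose_spec.2 p hp

theorem treePath_split (hT : T.IsTree) {r s t : ι} (h : t ∈ (treePath hT r s).support) :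
    ∃ q : T.Walk t s, q.IsPath ∧ treePath hT r s = (treePath hT r t).append q := by
  obtain ⟨p, q, hp, hq, h⟩ := (treePath_isPath hT r s).mem_support_iff_exists_append.1 h
  exact ⟨q, hq, by rw [h, ← eq_treePath hT hp]⟩

theorem treePath_trans (hT : T.IsTree) {r s t t' : ι} (h : t ∈ (treePath hT r t').support)
    (h' : t' ∈ (treePath hT r s).support) : t ∈ (treePath hT r s).support := by
  obtain ⟨q, -, hq⟩ := treePath_split hT h'
  rw [hq, SimpleGraph.Walk.mem_support_append_iff]
  exact .inl h

/-- The vertices on a path from the root are linearly ordered by their depth: if `t` came after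
`t'`, its root path would extend that of `t'` and could only be as short if both coincide. -/
theorem mem_treePath_of_length_le (hT : T.IsTree) {r s t t' : ι}
    (h : t ∈ (treePath hT r s).support) (h' : t' ∈ (treePath hT r s).support)
    (hle : (treePath hT r t).length ≤ (treePath hT r t').length) :
    t ∈ (treePath hT r t').support := by
  obtain ⟨q, hq, hs⟩ := treePath_split hT h'
  rw [hs, SimpleGraph.Walk.mem_support_append_iff] at h
  rcases h with h | h
  · exact h
  · obtain ⟨a, b, ha, hb, rfl⟩ := hq.mem_support_iff_exists_append.1 h
    rw [SimpleGraph.Walk.append_assoc] at hs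
    have hp : ((treePath hT r t').append a).IsPath := by
      have := treePath_isPath hT r s
      rw [hs] at this
      exact this.of_append_left
    have hl := congrArg SimpleGraph.Walk.length (eq_treePath hT hp)
    rw [SimpleGraph.Walk.length_append] at hl
    have := SimpleGraph.Walk.eq_of_length_eq_zero (p := a) (by omega)
    subst this
    exact SimpleGraph.Walk.end_mem_support _

variable {n m : ℕ} {I : Instance n m} {bag : ι → Finset (Fin n)}

/-- All bags on the path from `t` to `s` contain `v`. By minimality of the depth of `t`, the root
path of `t` meets this path in `t` only, so their concatenation is the root path of `s`. A topmost
bag of a vertex is thus an ancestor of all its bags. -/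
theorem Instance.IsTreeDecomposition.top_mem (h : I.IsTreeDecomposition T bag) {r s t : ι}
    {v : Fin n} (ht : v ∈ bag t) (hs : v ∈ bag s)
    (hmin : ∀ t', v ∈ bag t' → (treePath h.isTree r t).length ≤ (treePath h.isTree r t').length) :
    t ∈ (treePath h.isTree r s).support := by
  have hq := treePath_isPath h.isTree t s
  set q := treePath h.isTree t s
  have hp : ((treePath h.isTree r t).append q).IsPath := by
    have hqn := hq.support_nodup
    rw [← SimpleGraph.Walk.cons_tail_support] at hqn
    rw [SimpleGraph.Walk.isPath_def, SimpleGraph.Walk.support_append, List.nodup_append']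
    refine ⟨(treePath_isPath h.isTree r t).support_nodup, (List.nodup_cons.1 hqn).2, ?_⟩
    intro x hx hxq
    have hxb : v ∈ bag x := h.mem_of_path v t s x ht hs q hq (List.mem_of_mem_tail hxq)
    obtain ⟨a, -, hxs⟩ := treePath_split h.isTree hx
    have hl := congrArg SimpleGraph.Walk.length hxs
    rw [SimpleGraph.Walk.length_append] at hl
    have := SimpleGraph.Walk.eq_of_length_eq_zero (p := a) (by have := hmin x hxb; omega)
    subst this
    exact (List.nodup_cons.1 hqn).1 hxq
  rw [← eq_treePath h.isTree hp, SimpleGraph.Walk.mem_support_append_iff]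
  exact .inl (SimpleGraph.Walk.end_mem_support _)

/-- On the root path of `s`, the node `t'` lies between `t` and `s`, so the path condition of the
decomposition applies. -/
theorem Instance.IsTreeDecomposition.mem_of_treePath (h : I.IsTreeDecomposition T bag)
    {r s t t' : ι} {v : Fin n} (ht : v ∈ bag t) (hs : v ∈ bag s)
    (h1 : t ∈ (treePath h.isTree r s).support) (h2 : t' ∈ (treePath h.isTree r s).support)
    (hle : (treePath h.isTree r t).length ≤ (treePath h.isTree r t').length) : v ∈ bag t' := by
  obtain ⟨q, -, hs'⟩ := treePath_split h.isTree h2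
  obtain ⟨q2, -, ht'⟩ :=
    treePath_split h.isTree (mem_treePath_of_length_le h.isTree h1 h2 hle)
  rw [ht', ← SimpleGraph.Walk.append_assoc] at hs'
  have hp : (q2.append q).IsPath := by
    have := treePath_isPath h.isTree r s
    rw [hs'] at this
    exact this.of_append_right
  refine h.mem_of_path v t s t' ht hs _ hp ?_
  rw [SimpleGraph.Walk.mem_support_append_iff]
  exact .inl (SimpleGraph.Walk.end_mem_support _)

/-- Vertices can be numbered so that every connected set of vertices has at most `k` neighbours
with numbers smaller than all of its own. -/
theorem Instance.TreewidthAtMost.exists_order {k : ℕ} (hI : I.TreewidthAtMost k) :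
    ∃ κ : Fin n → ℕ, Function.Injective κ ∧ ∀ (C : Set (Fin n)) (u : Fin n), u ∈ C →
      (∀ Q : Fin n → Prop, Q u → (∀ a ∈ C, ∀ b ∈ C, ∀ e, a ∈ I.bundle e → b ∈ I.bundle e →
        Q a → Q b) → ∀ z ∈ C, Q z) →
      (∀ z ∈ C, κ u ≤ κ z) → ∀ N : Finset (Fin n),
      (∀ w ∈ N, κ w < κ u ∧ ∃ e, ∃ z ∈ C, z ∈ I.bundle e ∧ w ∈ I.bundle e) → N.card ≤ k := by
  obtain ⟨ι, _, T, bag, h, hk⟩ := hI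
  obtain ⟨r⟩ : Nonempty ι := h.isTree.1.nonempty
  have htop : ∀ v, ∃ t, v ∈ bag t ∧
      ∀ t', v ∈ bag t' → (treePath h.isTree r t).length ≤ (treePath h.isTree r t').length := by
    intro v
    obtain ⟨t, ht, hmin⟩ := Set.exists_min_image {t | v ∈ bag t}
      (fun t => (treePath h.isTree r t).length) (Set.toFinite _) (h.vertex_mem v)
    exact ⟨t, ht, hmin⟩
  choose top htop hmin using htop
  let dp : ι → ℕ := fun t => (treePath h.isTree r t).length
  have hdp : ∀ {u z : Fin n}, dp (top u) * n + u ≤ dp (top z) * n + z → dp (top u) ≤ dp (top z) := by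
    intro u z huz
    by_contra hlt
    have := Nat.mul_le_mul_right n (show dp (top z) + 1 ≤ dp (top u) by omega)
    have := z.isLt
    rw [add_mul] at *
    omega
  -- Sort by the depth of the topmost bag; adding `v < n` breaks ties and makes the numbering
  -- injective.
  refine ⟨fun v => dp (top v) * n + v, fun u z huz => ?_, ?_⟩
  · have h1 := hdp (le_of_eq huz)
    have h2 := hdp (le_of_eq huz.symm)
    simp only [le_antisymm h1 h2] at huz
    exact Fin.ext (by omega)
  · intro C u hu hconn hle N hN
    -- Every bag that meets `C` lies below `top u`, by induction along the connectivity of `C`: two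
    -- adjacent vertices share a bag, whose ancestors are comparable, and `top u` is the shallower
    -- one.
    have hbelow : ∀ z ∈ C, ∀ s, z ∈ bag s → top u ∈ (treePath h.isTree r s).support := by
      refine hconn _ (fun s hs => h.top_mem (htop u) hs (hmin u)) ?_
      intro a ha b hb e hae hbe hQ s hs
      obtain ⟨s0, hs0⟩ := h.edge_subset e
      have h1 := hQ s0 (hs0 hae)
      have h2 := h.top_mem (r := r) (htop b) (hs0 hbe) (hmin b)
      have h3 := mem_treePath_of_length_le h.isTree h1 h2 (hdp (hle b hb))
      exact treePath_trans h.isTree h3 (h.top_mem (htop b) hs (hmin b))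
    -- A smaller neighbour `w` of `z` shares a bag with `z`, and this bag lies below `top u`. As
    -- `top w` is an ancestor at most as deep as `top u`, the node `top u` separates it from that
    -- bag and must contain `w`. Leaving out `u` itself gives `k`.
    have hsub : N ⊆ (bag (top u)).erase u := by
      intro w hw
      obtain ⟨hlt, e, z, hz, hze, hwe⟩ := hN w hw
      refine Finset.mem_erase.2 ⟨fun hwu => by rw [hwu] at hlt; exact lt_irrefl _ hlt, ?_⟩
      obtain ⟨s0, hs0⟩ := h.edge_subset e
      exact h.mem_of_treePath (r := r) (htop w) (hs0 hwe)
        (h.top_mem (htop w) (hs0 hwe) (hmin w)) (hbelow z hz s0 (hs0 hze)) (hdp hlt.le)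
    have := Finset.card_le_card hsub
    rw [Finset.card_erase_of_mem (htop u)] at this
    have := hk (top u)
    omega

theorem Instance.TreewidthAtMost.card_bundle_le {k : ℕ} (hI : I.TreewidthAtMost k) (e : Fin m) :
    (I.bundle e).card ≤ k + 1 := by
  obtain ⟨ι, _, T, bag, h, hk⟩ := hI
  obtain ⟨t, ht⟩ := h.edge_subset e
  exact (Finset.card_le_card ht).trans (hk t)

end Tree

/-! ### Dynamic programming over separated components -/

/-- A discretized instance: vertices `< n`, hyperedges `< m` with incidence matrix `inc`, and `K`
candidate prices `cand 0, …`; the first `m` candidates are the budgets. -/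
structure Net where
  n : ℕ
  m : ℕ
  K : ℕ
  inc : ℕ → ℕ → ℕ
  cand : ℕ → ℕ
  inc_lt : ∀ e v, inc e v ≠ 0 → e < m ∧ v < n
  inc_le : ∀ e v, inc e v ≤ 1
  K_pos : 0 < K

namespace Net

open scoped Classical

variable (H : Net)

/-- The price of the bundle `e` if vertex `w` gets the candidate price number `E w`. -/
def sum (E : ℕ → ℕ) (e : ℕ) : ℕ := ∑ w ∈ Finset.range H.n, H.inc e w * H.cand (E w)

/-- The payment of consumer `e`. -/
def rev (E : ℕ → ℕ) (e : ℕ) : ℕ := if H.sum E e ≤ H.cand e then H.sum E e else 0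

/-- The total revenue. -/
def val (E : ℕ → ℕ) : ℕ := ∑ e ∈ Finset.range H.m, H.rev E e

/-- The hyperedge `e` contains a vertex of `S`. -/
def Meets (S : ℕ → Prop) (e : ℕ) : Prop := ∃ z, S z ∧ H.inc e z ≠ 0

/-- The revenue from the hyperedges that meet `S`. -/
noncomputable def valOn (S : ℕ → Prop) (E : ℕ → ℕ) : ℕ :=
  ∑ e ∈ (Finset.range H.m).filter (H.Meets S), H.rev E e

/-- The vertices that can be reached from `v` through vertices `z` with `D z = 0`. -/
inductive Reach (D : ℕ → ℕ) (v : ℕ) : ℕ → Prop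
  | base : Reach D v v
  | step {z w e : ℕ} (h : Reach D v z) (hz : D z = 0) (h1 : H.inc e z ≠ 0) (h2 : H.inc e w ≠ 0) :
      Reach D v w

/-- The component of `v` after removing the vertices `z` with `D z ≠ 0`. -/
def Comp (D : ℕ → ℕ) (v z : ℕ) : Prop := H.Reach D v z ∧ D z = 0

variable {H}

/-! ### Components after removing the assigned vertices. -/

theorem rev_congr {E E' : ℕ → ℕ} {e : ℕ} (h : ∀ w, H.inc e w ≠ 0 → E w = E' w) :
    H.rev E e = H.rev E' e := by
  have : H.sum E e = H.sum E' e := by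
    refine Finset.sum_congr rfl fun w _ => ?_
    by_cases hw : H.inc e w = 0
    · simp [hw]
    · rw [h w hw]
  simp only [rev, this]

theorem Reach.trans {D : ℕ → ℕ} {v z w : ℕ} (h : H.Reach D v z) (h' : H.Reach D z w) :
    H.Reach D v w := by
  induction h' with
  | base => exact h
  | step _ hz h1 h2 ih => exact ih.step hz h1 h2

/-- Walks may end in an assigned vertex but not pass through one, so they can be reversed only if
they end in a free vertex. -/
theorem Reach.symm {D : ℕ → ℕ} {v z : ℕ} (h : H.Reach D v z) (hz : D z = 0) :
    H.Reach D z v := by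
  induction h with
  | base => exact .base
  | step h hz' h1 h2 ih => exact (Reach.step .base hz h2 h1).trans (ih hz')

theorem Reach.lt {D : ℕ → ℕ} {v z : ℕ} (h : H.Reach D v z) (hv : v < H.n) : z < H.n := by
  cases h with
  | base => exact hv
  | step _ _ _ h2 => exact (H.inc_lt _ _ h2).2

theorem Reach.zero {D : ℕ → ℕ} {v z : ℕ} (h : H.Reach D v z) (hz : z ≠ v) : D v = 0 := by
  induction h with
  | base => exact absurd rfl hz
  | @step z w e h hz' _ _ ih =>
    by_cases hzv : z = v
    · rw [← hzv]; exact hz'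
    · exact ih hzv

theorem Comp.reach_iff {D : ℕ → ℕ} {v z : ℕ} (h : H.Comp D v z) (w : ℕ) :
    H.Reach D z w ↔ H.Reach D v w :=
  ⟨fun h' => h.1.trans h', fun h' => (h.1.symm h.2).trans h'⟩

theorem Comp.comp_iff {D : ℕ → ℕ} {v z : ℕ} (h : H.Comp D v z) (w : ℕ) :
    H.Comp D z w ↔ H.Comp D v w := by
  rw [Comp, Comp, h.reach_iff]

/-- The search from `v` inspects `D` only at vertices that it reaches, so assignments elsewhere are
irrelevant. -/
theorem reach_congr {D D' : ℕ → ℕ} {v : ℕ} (h : ∀ w, H.Reach D v w → D' w = D w) (w : ℕ) :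
    H.Reach D' v w ↔ H.Reach D v w := by
  constructor
  · intro h'
    induction h' with
    | base => exact .base
    | step _ hz h1 h2 ih => exact ih.step (by rwa [← h _ ih]) h1 h2
  · intro h'
    induction h' with
    | base => exact .base
    | step h' hz h1 h2 ih => exact ih.step (by rwa [h _ h']) h1 h2

variable (H)

/-- A Horner scheme for the digits `f 0, …, f (i - 1)` in base `K + 2`. -/
def horner (f : ℕ → ℕ) : ℕ → ℕ
  | 0 => 0
  | i + 1 => horner f i * (H.K + 2) + f i

/-- The digits that describe the component of `v` and the assignment on its boundary. -/
noncomputable def digit (D : ℕ → ℕ) (v w : ℕ) : ℕ := if H.Reach D v w then D w + 1 else 0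

/-- A number that describes the component of `v` and the assignment on its boundary. -/
noncomputable def key (D : ℕ → ℕ) (v : ℕ) : ℕ := H.horner (H.digit D v) H.n

variable {H}

/-! ### Keys as positional numerals. -/

theorem horner_congr {f g : ℕ → ℕ} {i : ℕ} (h : ∀ w < i, f w = g w) :
    H.horner f i = H.horner g i := by
  induction i with
  | zero => rfl
  | succ i ih => rw [horner, horner, ih fun w hw => h w (by omega), h i (by omega)]

theorem horner_lt {f : ℕ → ℕ} {i : ℕ} (h : ∀ w < i, f w < H.K + 2) :
    H.horner f i < (H.K + 2) ^ i := by
  induction i with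
  | zero => simp [horner]
  | succ i ih =>
    have h1 := ih fun w hw => h w (by omega)
    have h2 := h i (by omega)
    rw [horner, pow_succ]
    calc _ < H.horner f i * (H.K + 2) + (H.K + 2) := by omega
      _ = (H.horner f i + 1) * (H.K + 2) := by ring
      _ ≤ _ := Nat.mul_le_mul_right _ h1

theorem horner_inj {f g : ℕ → ℕ} {i : ℕ} (hf : ∀ w < i, f w < H.K + 2) (hg : ∀ w < i, g w < H.K + 2)
    (h : H.horner f i = H.horner g i) : ∀ w < i, f w = g w := by
  induction i with
  | zero => intro w hw; omega
  | succ i ih =>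
    rw [horner, horner] at h
    have hpos : 0 < H.K + 2 := by omega
    have hd := congrArg (· / (H.K + 2)) h
    have hm := congrArg (· % (H.K + 2)) h
    simp only [Nat.mul_add_mod_self_right] at hm
    rw [Nat.mod_eq_of_lt (hf i (by omega)), Nat.mod_eq_of_lt (hg i (by omega))] at hm
    have hd' : H.horner f i = H.horner g i := by
      rw [hm] at h
      exact Nat.eq_of_mul_eq_mul_right hpos (by omega)
    intro w hw
    rcases Nat.lt_succ_iff_lt_or_eq.1 hw with hw | rfl
    · exact ih (fun w hw => hf w (by omega)) (fun w hw => hg w (by omega)) hd' w hw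
    · exact hm

theorem digit_lt {D : ℕ → ℕ} (hD : ∀ w, D w ≤ H.K) (v w : ℕ) : H.digit D v w < H.K + 2 := by
  have := hD w
  rw [digit]; split <;> omega

theorem key_congr {D D' : ℕ → ℕ} {v v' : ℕ} (h : ∀ w, H.Reach D' v' w ↔ H.Reach D v w)
    (h' : ∀ w, H.Reach D v w → D' w = D w) : H.key D' v' = H.key D v := by
  refine horner_congr fun w _ => ?_
  by_cases hw : H.Reach D v w
  · rw [digit, digit, if_pos hw, if_pos ((h w).2 hw), h' w hw]
  · rw [digit, digit, if_neg hw, if_neg (mt (h w).1 hw)]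

theorem Comp.key_eq {D : ℕ → ℕ} {v z : ℕ} (h : H.Comp D v z) :
    H.key D z = H.key D v :=
  key_congr h.reach_iff fun _ _ => rfl

/-- The digits are 0 for vertices not reached, 1 for free vertices and `x + 2` for boundary vertices
with candidate `x`, all below `K + 2`. The key therefore determines the component, its boundary and
the prices there, which is all that the optimality of a row depends on. -/
theorem key_inj {D D' : ℕ → ℕ} {v v' : ℕ} (hD : ∀ w, D w ≤ H.K) (hD' : ∀ w, D' w ≤ H.K)
    (hv : v < H.n) (hv' : v' < H.n) (h : H.key D v = H.key D' v') :
    (∀ w, H.Reach D v w ↔ H.Reach D' v' w) ∧ ∀ w, H.Reach D v w → D w = D' w := by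
  have key := horner_inj (fun w _ => digit_lt hD v w) (fun w _ => digit_lt hD' v' w) h
  have h1 : ∀ w, H.Reach D v w ↔ H.Reach D' v' w := by
    intro w
    by_cases hw : w < H.n
    · have := key w hw
      rw [digit, digit] at this
      split at this <;> split at this <;> simp_all
    · exact ⟨fun h => absurd (h.lt hv) hw, fun h => absurd (h.lt hv') hw⟩
  refine ⟨h1, fun w hw => ?_⟩
  have := key w (hw.lt hv)
  rw [digit, digit, if_pos hw, if_pos ((h1 w).1 hw)] at this
  omega

variable (H)

/-- The row of the table `tab` for the component of `v` is an optimal continuation of `D`. -/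
def Good (tab D : ℕ → ℕ) (v : ℕ) : Prop :=
  ∀ E : ℕ → ℕ, (∀ z < H.n, E z < H.K) → (∀ w < H.n, D w ≠ 0 → E w = D w - 1) →
    H.valOn (H.Comp D v) E ≤ H.valOn (H.Comp D v)
      fun z => if H.Comp D v z then tab (H.key D v * H.n + z) else D z - 1

variable {H}

/-- Free vertices in a common hyperedge belong to the same component, so the hyperedges that meet
`Z` are partitioned by the component they meet. Once the boundary prices are fixed, the blocks do
not interact, and the row for each block is optimal. -/
theorem valOn_le_of_good {tab D : ℕ → ℕ} {Z : ℕ → Prop} (hZ : ∀ z, Z z → D z = 0)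
    (hcl : ∀ z w, Z z → H.Comp D z w → Z w) (hgood : ∀ z, Z z → H.Good tab D z)
    {E E' : ℕ → ℕ} (hE : ∀ z, Z z → E z = tab (H.key D z * H.n + z))
    (hED : ∀ w < H.n, D w ≠ 0 → E w = D w - 1) (hK : ∀ z < H.n, E' z < H.K)
    (hED' : ∀ w < H.n, D w ≠ 0 → E' w = D w - 1) : H.valOn Z E' ≤ H.valOn Z E := by
  -- The component as a set serves as the label of a hyperedge; the sums are compared fibre by
  -- fibre.
  let lab : ℕ → Set ℕ := fun e => {w | ∃ z, Z z ∧ H.inc e z ≠ 0 ∧ H.Comp D z w}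
  have hlab : ∀ e z, Z z → H.inc e z ≠ 0 → lab e = {w | H.Comp D z w} := by
    intro e z hz he
    ext w
    constructor
    · rintro ⟨z', hz', he', hw⟩
      have : H.Comp D z z' := ⟨.step .base (hZ z hz) he he', hZ z' hz'⟩
      exact (this.comp_iff w).1 hw
    · exact fun hw => ⟨z, hz, he, hw⟩
  have hmaps : ∀ e ∈ (Finset.range H.m).filter (H.Meets Z),
      lab e ∈ ((Finset.range H.m).filter (H.Meets Z)).image lab :=
    fun e he => Finset.mem_image_of_mem _ he
  rw [valOn, valOn, ← Finset.sum_fiberwise_of_maps_to hmaps, ← Finset.sum_fiberwise_of_maps_to hmaps]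
  refine Finset.sum_le_sum fun L hL => ?_
  obtain ⟨e0, he0, rfl⟩ := Finset.mem_image.1 hL
  obtain ⟨hm0, z, hz, hez⟩ := Finset.mem_filter.1 he0
  have hfib : ((Finset.range H.m).filter (H.Meets Z)).filter (fun e => lab e = lab e0) =
      (Finset.range H.m).filter (H.Meets (H.Comp D z)) := by
    ext e
    simp only [Finset.mem_filter, hlab e0 z hz hez]
    constructor
    · rintro ⟨⟨hm, z', hz', he'⟩, hl⟩
      rw [hlab e z' hz' he'] at hl
      have : H.Comp D z' z' := ⟨.base, hZ z' hz'⟩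
      exact ⟨hm, z', (Set.ext_iff.1 hl z').1 this, he'⟩
    · rintro ⟨hm, z', hzz', he'⟩
      refine ⟨⟨hm, z', hcl z z' hz hzz', he'⟩, ?_⟩
      rw [hlab e z' (hcl z z' hz hzz') he']
      ext w
      exact hzz'.comp_iff w
  rw [hfib]
  refine (hgood z hz E' hK hED').trans (le_of_eq ?_)
  refine Finset.sum_congr rfl fun e he => rev_congr fun w hw => ?_
  obtain ⟨-, z', hzz', he'⟩ := Finset.mem_filter.1 he
  have hr : H.Reach D z w := hzz'.1.step hzz'.2 he' hw
  by_cases hDw : D w = 0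
  · have hc : H.Comp D z w := ⟨hr, hDw⟩
    rw [if_pos hc, hE w (hcl z w hz hc), hc.key_eq]
  · rw [if_neg fun hc : H.Comp D z w => hDw hc.2, hED w (H.inc_lt _ _ hw).2 hDw]

variable (H)

/-- The assignment that results from `D` if the vertices in `R` get their prices from the table. -/
noncomputable def fill (tab D : ℕ → ℕ) (R : ℕ → Prop) (z : ℕ) : ℕ :=
  if R z ∧ D z = 0 then tab (H.key D z * H.n + z) else D z - 1

variable {H}

theorem comp_update {D : ℕ → ℕ} {v u x z w : ℕ} (hz : H.Comp D v z)
    (h : H.Reach (Function.update D u (x + 1)) z w) : H.Reach D v w := by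
  induction h with
  | base => exact hz.1
  | @step z' w e _ hz' h1 h2 ih =>
    refine ih.step ?_ h1 h2
    by_cases h : z' = u
    · simp [h] at hz'
    · rwa [Function.update_of_ne h] at hz'

/-- Fixing the price of `u` leaves a union of components, where the table is optimal by
`valOn_le_of_good`. Any other hyperedge that meets the old component does so only in `u`; all its
vertices then have prescribed prices, and `E` and the filled assignment agree on it. -/
theorem valOn_le_fill {tab D : ℕ → ℕ} {v u x : ℕ} (hu : H.Comp D v u)
    (hgood : ∀ z, H.Comp D v z → z ≠ u → H.Good tab (Function.update D u (x + 1)) z)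
    {E : ℕ → ℕ} (hK : ∀ z < H.n, E z < H.K) (hE : ∀ w < H.n, D w ≠ 0 → E w = D w - 1)
    (hx : E u = x) : H.valOn (H.Comp D v) E ≤
      H.valOn (H.Comp D v) (H.fill tab (Function.update D u (x + 1)) (H.Reach D v)) := by
  set D' := Function.update D u (x + 1) with hD'
  have hD'u : D' u = x + 1 := by simp [D']
  have hD'n : ∀ z, z ≠ u → D' z = D z := fun z hz => Function.update_of_ne hz _ _
  set Z : ℕ → Prop := fun z => H.Comp D v z ∧ z ≠ u
  have hmain : H.valOn Z E ≤ H.valOn Z (H.fill tab D' (H.Reach D v)) := by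
    refine valOn_le_of_good (tab := tab) (D := D') ?_ ?_ ?_ ?_ ?_ hK ?_
    · rintro z ⟨hz, hzu⟩; rw [hD'n z hzu]; exact hz.2
    · rintro z w ⟨hz, hzu⟩ hw
      have hwu : w ≠ u := by rintro rfl; have := hw.2; omega
      exact ⟨⟨comp_update hz hw.1, by rw [← hD'n w hwu]; exact hw.2⟩, hwu⟩
    · exact fun z hz => hgood z hz.1 hz.2
    · rintro z ⟨hz, hzu⟩
      rw [fill, if_pos ⟨hz.1, by rw [hD'n z hzu]; exact hz.2⟩]
    · intro w _ hw; rw [fill, if_neg fun h => hw h.2]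
    · intro w hwn hw
      by_cases hwu : w = u
      · rw [hwu, hD'u, hx]; rfl
      · rw [hD'n w hwu] at hw ⊢; exact hE w hwn hw
  have hsub : ∀ F : ℕ → ℕ, H.valOn (H.Comp D v) F = H.valOn Z F +
      ∑ e ∈ (Finset.range H.m).filter (fun e => H.Meets (H.Comp D v) e ∧ ¬ H.Meets Z e),
        H.rev F e := by
    intro F
    rw [valOn, valOn, ← Finset.sum_filter_add_sum_filter_not _ (H.Meets Z)]
    congr 1
    · rw [Finset.filter_filter]
      refine Finset.sum_congr (Finset.filter_congr fun e _ => ?_) fun _ _ => rfl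
      exact ⟨fun h => h.2, fun h => ⟨h.imp fun z hz => ⟨hz.1.1, hz.2⟩, h⟩⟩
    · rw [Finset.filter_filter]
  rw [hsub, hsub]
  refine Nat.add_le_add hmain (le_of_eq (Finset.sum_congr rfl fun e he => rev_congr fun w hw => ?_))
  obtain ⟨-, ⟨z, hz, hez⟩, hnot⟩ := Finset.mem_filter.1 he
  have hr : H.Reach D v w := hz.1.step hz.2 hez hw
  by_cases hwu : w = u
  · rw [hwu, fill, if_neg (by omega), hD'u, hx]; rfl
  · have hDw : D w ≠ 0 := fun h => hnot ⟨w, ⟨⟨hr, h⟩, hwu⟩, hw⟩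
    rw [fill, hD'n w hwu, if_neg fun h => hDw h.2, hE w (H.inc_lt _ _ hw).2 hDw]

theorem val_eq_valOn_add (S : ℕ → Prop) (E : ℕ → ℕ) : H.val E = H.valOn S E +
    ∑ e ∈ (Finset.range H.m).filter (fun e => ¬ H.Meets S e), H.rev E e :=
  (Finset.sum_filter_add_sum_filter_not _ _ _).symm

theorem fill_of_not_comp {tab D : ℕ → ℕ} {v u x z : ℕ} (hu : H.Comp D v u)
    (hz : ¬ H.Comp D v z) :
    H.fill tab (Function.update D u (x + 1)) (H.Reach D v) z = D z - 1 := by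
  have hzu : z ≠ u := by rintro rfl; exact hz hu
  rw [fill, Function.update_of_ne hzu, if_neg (show ¬ (H.Reach D v z ∧ D z = 0) from hz)]

/-- A best continuation that takes the price of one vertex and the table rows of the remaining
components is optimal. -/
theorem good_of_best {tab tab' D F : ℕ → ℕ} {v u : ℕ} (hu : H.Comp D v u) (hv : v < H.n)
    (hgood : ∀ z x, x < H.K → H.Comp D v z → z ≠ u →
      H.Good tab (Function.update D u (x + 1)) z)
    (hF : ∃ u x, H.Comp D v u ∧
      ∀ z < H.n, F z = H.fill tab (Function.update D u (x + 1)) (H.Reach D v) z)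
    (hbest : ∀ x < H.K,
      H.val (H.fill tab (Function.update D u (x + 1)) (H.Reach D v)) ≤ H.val F)
    (hrow : ∀ z < H.n, tab' (H.key D v * H.n + z) = F z) : H.Good tab' D v := by
  intro E hK hE
  have hx : E u < H.K := hK u (hu.1.lt hv)
  refine (valOn_le_fill hu (fun z => hgood z _ hx) hK hE rfl).trans ?_
  have h1 := hbest _ hx
  rw [val_eq_valOn_add (H.Comp D v), val_eq_valOn_add (H.Comp D v) F] at h1
  obtain ⟨u', x', hu', hF⟩ := hF
  -- All tried assignments coincide off the component, whichever vertex and price produced them.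
  -- Comparing total revenues is therefore the same as comparing revenues on the hyperedges that
  -- meet the component.
  have h2 : ∑ e ∈ (Finset.range H.m).filter (fun e => ¬ H.Meets (H.Comp D v) e),
      H.rev (H.fill tab (Function.update D u (E u + 1)) (H.Reach D v)) e =
      ∑ e ∈ (Finset.range H.m).filter (fun e => ¬ H.Meets (H.Comp D v) e), H.rev F e := by
    refine Finset.sum_congr rfl fun e he => rev_congr fun w hw => ?_
    have hwc : ¬ H.Comp D v w := fun h => (Finset.mem_filter.1 he).2 ⟨w, h, hw⟩
    rw [fill_of_not_comp hu hwc, hF w (H.inc_lt _ _ hw).2, fill_of_not_comp hu' hwc]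
  have h3 : H.valOn (H.Comp D v) F = H.valOn (H.Comp D v)
      fun z => if H.Comp D v z then tab' (H.key D v * H.n + z) else D z - 1 := by
    refine Finset.sum_congr rfl fun e he => rev_congr fun w hw => ?_
    have hwn := (H.inc_lt _ _ hw).2
    split
    · rw [hrow w hwn]
    · next hwc => rw [hF w hwn, fill_of_not_comp hu' hwc]
  omega

/-- Optimality of a row involves `D` only on the component and its boundary, and the key is
unchanged as well. -/
theorem Good.congr {tab D D' : ℕ → ℕ} {v v' : ℕ} (h : H.Good tab D v) (hD : ∀ w, D w ≤ H.K)
    (hR : ∀ w, H.Reach D v w ↔ H.Reach D' v' w)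
    (hDD' : ∀ w, H.Reach D v w → D w = D' w) : H.Good tab D' v' := by
  have hC : ∀ w, H.Comp D v w ↔ H.Comp D' v' w := fun w =>
    ⟨fun h => ⟨(hR w).1 h.1, by rw [← hDD' w h.1]; exact h.2⟩,
      fun h => ⟨(hR w).2 h.1, by rw [hDD' w ((hR w).2 h.1)]; exact h.2⟩⟩
  have hC' : H.Comp D v = H.Comp D' v' := funext fun w => propext (hC w)
  have hk : H.key D v = H.key D' v' :=
    (key_congr (fun w => (hR w).symm) fun w hw => (hDD' w hw).symm).symm
  intro E hK hE
  -- `E` respects `D'` and must be made to respect `D`; changing it outside the reached set affects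
  -- no relevant hyperedge.
  have h1 := h (fun w => if H.Reach D v w then E w else D w - 1) ?_ ?_
  · rw [← hC', ← hk]
    convert h1 using 1
    · refine Finset.sum_congr rfl fun e he => rev_congr fun w hw => ?_
      obtain ⟨-, z, hz, hez⟩ := Finset.mem_filter.1 he
      rw [if_pos (hz.1.step hz.2 hez hw)]
    · refine Finset.sum_congr rfl fun e he => rev_congr fun w hw => ?_
      obtain ⟨-, z, hz, hez⟩ := Finset.mem_filter.1 he
      split
      · rfl
      · rw [hDD' w (hz.1.step hz.2 hez hw)]
  · intro z hz
    have := hD z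
    have := H.K_pos
    split
    · exact hK z hz
    · omega
  · intro w hwn hw
    split
    · next hr => rw [hE w hwn (by rwa [← hDD' w hr]), hDD' w hr]
    · rfl

variable (H)

/-- The boundary of the component of `v` precedes the component in the order `κ`. -/
structure Adm (κ D : ℕ → ℕ) (v : ℕ) : Prop where
  zero : D v = 0
  lt : v < H.n
  le : ∀ w, D w ≤ H.K
  order : ∀ z w, H.Comp D v z → H.Reach D v w → D w ≠ 0 → κ w < κ z

/-- The number of vertices in the component. -/
noncomputable def csize (D : ℕ → ℕ) (v : ℕ) : ℕ :=
  ((Finset.range H.n).filter (H.Comp D v)).card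

variable {H}

theorem Adm.congr {κ D D' : ℕ → ℕ} {v v' : ℕ} (h : H.Adm κ D v) (hD' : ∀ w, D' w ≤ H.K)
    (hv' : v' < H.n) (hR : ∀ w, H.Reach D v w ↔ H.Reach D' v' w)
    (hDD' : ∀ w, H.Reach D v w → D w = D' w) : H.Adm κ D' v' := by
  refine ⟨?_, hv', hD', fun z w hz hw hDw => ?_⟩
  · by_cases hvv' : v = v'
    · subst hvv'; rw [← hDD' v .base]; exact h.zero
    · exact ((hR v).1 .base).zero hvv'
  · have h1 := (hR z).2 hz.1
    have h2 := (hR w).2 hw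
    exact h.order z w ⟨h1, by rw [hDD' z h1]; exact hz.2⟩ h2 (by rwa [hDD' w h2])

theorem Adm.exists_min {κ D : ℕ → ℕ} {v : ℕ} (h : H.Adm κ D v) :
    ∃ u, H.Comp D v u ∧ ∀ z, H.Comp D v z → κ u ≤ κ z := by
  obtain ⟨u, hu, hmin⟩ := Finset.exists_min_image ((Finset.range H.n).filter (H.Comp D v)) κ
    ⟨v, by simp [h.lt, Comp, h.zero, Reach.base]⟩
  exact ⟨u, (Finset.mem_filter.1 hu).2, fun z hz => hmin z (by simp [hz, hz.1.lt h.lt])⟩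

/-- The boundary of a piece consists of old boundary vertices and possibly `u`. The former precede
the whole component; `u` precedes the piece because it is κ-minimal and κ is injective. The piece is
smaller since it lacks `u`. -/
theorem Adm.update {κ D : ℕ → ℕ} {v u x z : ℕ} (hκ : Set.InjOn κ {w | w < H.n})
    (h : H.Adm κ D v) (hu : H.Comp D v u) (hmin : ∀ z, H.Comp D v z → κ u ≤ κ z) (hx : x < H.K)
    (hz : H.Comp D v z) (hzu : z ≠ u) : H.Adm κ (Function.update D u (x + 1)) z ∧
      H.csize (Function.update D u (x + 1)) z < H.csize D v := by
  have hD'n : ∀ z, z ≠ u → Function.update D u (x + 1) z = D z :=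
    fun z hz => Function.update_of_ne hz _ _
  have hcomp : ∀ w, H.Comp (Function.update D u (x + 1)) z w → H.Comp D v w ∧ w ≠ u := by
    intro w hw
    have hwu : w ≠ u := by rintro rfl; have := hw.2; simp at this
    exact ⟨⟨comp_update hz hw.1, by rw [← hD'n w hwu]; exact hw.2⟩, hwu⟩
  refine ⟨⟨by rw [hD'n z hzu]; exact hz.2, hz.1.lt h.lt, fun w => ?_, fun z' w hz' hw hDw => ?_⟩, ?_⟩
  · by_cases hw : w = u
    · simp [hw]; omega
    · rw [hD'n w hw]; exact h.le w
  · obtain ⟨h1, h2⟩ := hcomp z' hz'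
    by_cases hwu : w = u
    · subst hwu
      exact lt_of_le_of_ne (hmin z' h1)
        fun he => h2 (hκ (hu.1.lt h.lt) (h1.1.lt h.lt) he).symm
    · rw [hD'n w hwu] at hDw
      exact h.order z' w h1 (comp_update hz hw) hDw
  · refine Finset.card_lt_card (Finset.ssubset_iff_of_subset (fun w hw => ?_) |>.2 ⟨u, ?_, ?_⟩)
    · simp only [Finset.mem_filter] at hw ⊢
      exact ⟨hw.1, (hcomp w hw.2).1⟩
    · simp [hu, hu.1.lt h.lt]
    · simp only [Finset.mem_filter, not_and]
      exact fun _ hc => (hcomp u hc).2 rfl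

variable (H)

/-- The rows for the admissible components with at most `i` vertices are optimal. -/
def Complete (κ : ℕ → ℕ) (i : ℕ) (tab : ℕ → ℕ) : Prop :=
  ∀ D v, H.Adm κ D v → H.csize D v ≤ i → H.Good tab D v

/-- The row `q` is optimal if it belongs to an admissible component with at most `i` vertices. -/
def RowDone (κ : ℕ → ℕ) (i : ℕ) (tab : ℕ → ℕ) (q : ℕ) : Prop :=
  ∀ D v, H.Adm κ D v → H.csize D v ≤ i → H.key D v = q → H.Good tab D v

/-- `F` is a best continuation of `D` on the component of `v`. -/
structure Best (tab D : ℕ → ℕ) (v : ℕ) (F : ℕ → ℕ) : Prop where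
  mem : ∃ u x, H.Comp D v u ∧
    ∀ z < H.n, F z = H.fill tab (Function.update D u (x + 1)) (H.Reach D v) z
  le : ∀ u x, H.Comp D v u → x < H.K →
    H.val (H.fill tab (Function.update D u (x + 1)) (H.Reach D v)) ≤ H.val F

variable {H}

theorem Good.of_row_eq {tab tab' D : ℕ → ℕ} {v : ℕ} (h : H.Good tab D v) (hv : v < H.n)
    (hrow : ∀ z < H.n, tab' (H.key D v * H.n + z) = tab (H.key D v * H.n + z)) :
    H.Good tab' D v := by
  intro E hK hE
  refine (h E hK hE).trans (le_of_eq (Finset.sum_congr rfl fun e _ => rev_congr fun w hw => ?_))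
  split
  · next hc => rw [hrow w (hc.1.lt hv)]
  · rfl

/-- The effect of recomputing one row of the table. -/
theorem Complete.step {κ tab tab' D F : ℕ → ℕ} {i v : ℕ} (hκ : Set.InjOn κ {w | w < H.n})
    (h : H.Complete κ i tab) (hD : ∀ w, D w ≤ H.K) (hv : v < H.n)
    (hF : D v = 0 → H.Best tab D v F)
    (hrow : ∀ z < H.n, tab' (H.key D v * H.n + z) = F z)
    (hrest : ∀ q ≠ H.key D v, ∀ z < H.n, tab' (q * H.n + z) = tab (q * H.n + z)) :
    H.Complete κ i tab' ∧ (∀ q, H.RowDone κ (i + 1) tab q → H.RowDone κ (i + 1) tab' q) ∧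
      H.RowDone κ (i + 1) tab' (H.key D v) := by
  have hdone : H.RowDone κ (i + 1) tab' (H.key D v) := by
    -- Another assignment with the same key describes the same component and boundary prices, so the
    -- claim is moved to the pair `D`, `v` for which the row was computed.
    intro D' v' hadm hc hk
    obtain ⟨hR, hDD'⟩ := key_inj hadm.le hD hadm.lt hv hk
    have hadm0 := hadm.congr hD hv hR hDD'
    have hR' := fun w => (hR w).symm
    have hDD'' : ∀ w, H.Reach D v w → D w = D' w := fun w hw => (hDD' w ((hR w).2 hw)).symm
    have hc0 : H.csize D v ≤ i + 1 := by
      convert hc using 1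
      refine congrArg Finset.card (Finset.filter_congr fun w _ => ?_)
      exact ⟨fun h => ⟨(hR w).2 h.1, by rw [← hDD'' w h.1]; exact h.2⟩,
        fun h => ⟨(hR w).1 h.1, by rw [← hDD' w h.1]; exact h.2⟩⟩
    refine Good.congr ?_ hD hR' hDD''
    obtain ⟨u, hu, hmin⟩ := hadm0.exists_min
    have hF := hF hadm0.zero
    -- Here the unknown order enters: the κ-minimal `u` need not be the vertex that won, but it was
    -- among the vertices tried.
    refine good_of_best hu hv (fun z x hx hz hzu => ?_) hF.mem (fun x hx => hF.le u x hu hx) hrow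
    obtain ⟨h1, h2⟩ := hadm0.update hκ hu hmin hx hz hzu
    exact h _ _ h1 (by omega)
  -- Updating in place is harmless: a row that was already optimal is recomputed from optimal
  -- smaller rows and is optimal again.
  refine ⟨fun D' v' hadm hc => ?_, fun q hq => ?_, hdone⟩
  · by_cases hk : H.key D' v' = H.key D v
    · exact hdone D' v' hadm (by omega) hk
    · exact (h D' v' hadm hc).of_row_eq hadm.lt (hrest _ hk)
  · by_cases hk : q = H.key D v
    · rw [hk]; exact hdone
    · intro D' v' hadm hc hq'
      exact (hq D' v' hadm hc hq').of_row_eq hadm.lt (by rw [hq']; exact hrest _ hk)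

/-- A complete table yields an assignment of maximum revenue. -/
theorem Complete.val_le {κ tab : ℕ → ℕ} (h : H.Complete κ H.n tab) {E : ℕ → ℕ}
    (hK : ∀ z < H.n, E z < H.K) :
    H.val E ≤ H.val fun z => tab (H.key (fun _ => 0) z * H.n + z) := by
  rw [val_eq_valOn_add (fun z => z < H.n), val_eq_valOn_add (fun z => z < H.n)
    (fun z => tab (H.key (fun _ => 0) z * H.n + z))]
  refine Nat.add_le_add (valOn_le_of_good (tab := tab) (D := fun _ => 0) (fun _ _ => rfl)
    (fun z w hz hw => hw.1.lt hz) (fun z hz => h _ _ ⟨rfl, hz, fun _ => Nat.zero_le _,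
      fun _ _ _ _ h => absurd rfl h⟩ ?_) (fun _ _ => rfl) (fun _ _ h => absurd rfl h) hK
    (fun _ _ h => absurd rfl h)) (le_of_eq (Finset.sum_congr rfl fun e he =>
      rev_congr fun w hw => ?_))
  · exact (Finset.card_filter_le _ _).trans (by simp)
  · exact absurd ⟨w, (H.inc_lt _ _ hw).2, hw⟩ (Finset.mem_filter.1 he).2

end Net

/-! ### The program

Variables: `0` the number `n` of vertices, `1` the number `m` of hyperedges, `2` the width `k`,
`3`, `4` numerator and denominator of `ε`, `5` the number of incidences, `6` the grid size `N`,
`7` the number of grid prices, `8` the number `K` of candidate prices, `9` the number of codes of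
partial assignments, `10`, `11` the largest budget, `12` a bound for the keys, `13` the base of the
codes, `14` the denominator of the output; higher numbers are local.

Arrays: `1` a partial assignment, `2` the vertices reached, `3` a copy of `2`, `4` an assignment,
`5` the best assignment, `6` the table, `7` the candidate prices, `8` the incidences, `9` the
numerators of the output. -/

namespace Alg

/-- The entry of the incidence matrix for the current hyperedge and vertex. -/
def incE : Ex :=
  .inp (.op .add (.op .add (.lit 5) (.op .mul (.lit 2) (.var 1)))
    (.op .add (.op .mul (.var 20) (.var 0)) (.var 21)))

/-- `1` if the vertex has no price yet, and `0` otherwise. -/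
def freeE (w : Ex) : Ex := .op .lt (.get 1 w) (.lit 1)

/-- Extend the set of reached vertices along one hyperedge. -/
def spread : Stm :=
  .seq (.set 22 (.lit 0))
    (.seq (.loop 21 (.var 0) (.ite (.op .mul incE (.op .mul (.get 2 (.var 21)) (freeE (.var 21))))
        (.set 22 (.lit 1)) .skip))
      (.ite (.var 22) (.loop 21 (.var 0) (.ite incE (.put 2 (.var 21) (.lit 1)) .skip)) .skip))

/-- Mark the vertices reached from the vertex in the variable `25`. -/
def reach : Stm :=
  .seq (.loop 21 (.var 0) (.put 2 (.var 21) (.lit 0)))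
    (.seq (.put 2 (.var 25) (.lit 1)) (.loop 23 (.var 0) (.loop 20 (.var 1) spread)))

/-- Compute the key of the marked component. -/
def key : Stm :=
  .seq (.set 24 (.lit 0))
    (.loop 21 (.var 0) (.set 24 (.cap (.op .add (.op .mul (.var 24) (.op .add (.var 8) (.lit 2)))
      (.op .mul (.get 2 (.var 21)) (.op .add (.get 1 (.var 21)) (.lit 1)))) (.var 12))))

/-- Complete the partial assignment on the vertices in the array `3`, using the table. -/
def fill : Stm :=
  .loop 25 (.var 0) (.ite (.op .mul (.get 3 (.var 25)) (freeE (.var 25)))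
    (.seq reach (.seq key (.put 4 (.var 25)
      (.get 6 (.op .add (.op .mul (.var 24) (.var 0)) (.var 25))))))
    (.put 4 (.var 25) (.op .sub (.get 1 (.var 25)) (.lit 1))))

/-- Compute the price of the current bundle. -/
def price : Stm :=
  .seq (.set 36 (.lit 0)) (.loop 21 (.var 0) (.ite incE (.set 36 (.cap
    (.op .add (.var 36) (.get 7 (.get 4 (.var 21)))) (.op .mul (.var 0) (.var 6)))) .skip))

/-- Compute the revenue of the assignment. -/
def revenue : Stm :=
  .seq (.set 37 (.lit 0)) (.loop 20 (.var 1) (.seq price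
    (.ite (.op .lt (.get 7 (.var 20)) (.var 36)) .skip
      (.set 37 (.cap (.op .add (.var 37) (.var 36))
        (.op .mul (.var 1) (.op .mul (.var 0) (.var 6))))))))

/-- Try the candidate price in the variable `28` for the vertex in the variable `27`. -/
def attempt : Stm :=
  .seq (.put 1 (.var 27) (.op .add (.var 28) (.lit 1))) (.seq fill (.seq revenue
    (.ite (.op .lt (.var 37) (.var 35)) .skip (.seq (.set 35 (.var 37))
      (.loop 21 (.var 0) (.put 5 (.var 21) (.get 4 (.var 21))))))))

/-- Find the best continuation on the component in the array `3`. -/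
def best : Stm :=
  .seq (.set 35 (.lit 0)) (.loop 27 (.var 0)
    (.ite (.op .mul (.get 3 (.var 27)) (freeE (.var 27)))
      (.seq (.loop 28 (.var 8) attempt) (.put 1 (.var 27) (.lit 0))) .skip))

/-- Recompute the row of the table for the component of the vertex in the variable `26`. -/
def row : Stm :=
  .seq (.set 25 (.var 26)) (.seq reach
    (.seq (.loop 21 (.var 0) (.put 3 (.var 21) (.get 2 (.var 21))))
      (.seq key (.seq (.set 34 (.var 24)) (.seq best
        (.loop 21 (.var 0) (.put 6 (.op .add (.op .mul (.var 34) (.var 0)) (.var 21))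
          (.get 5 (.var 21)))))))))

/-- Process one digit of the code of a partial assignment. -/
def decodeDigit : Stm :=
  .seq (.set 32 (.op .mod (.var 31) (.var 13))) (.seq (.set 31 (.op .div (.var 31) (.var 13)))
    (.ite (.var 32) (.put 1 (.get 8 (.op .div (.op .sub (.var 32) (.lit 1)) (.var 8)))
      (.cap (.op .add (.op .mod (.op .sub (.var 32) (.lit 1)) (.var 8)) (.lit 1)) (.var 8)))
      .skip))

def clear : Stm := .loop 21 (.var 0) (.put 1 (.var 21) (.lit 0))

/-- Decode the partial assignment with the code in the variable `29`. -/
def decode : Stm := .seq clear (.seq (.set 31 (.var 29)) (.loop 33 (.var 2) decodeDigit))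

/-- Fill the table. -/
def table : Stm := .loop 30 (.var 0) (.loop 29 (.var 9) (.seq decode (.loop 26 (.var 0) row)))

/-- Find an assignment of maximum revenue. -/
def optimum : Stm :=
  .seq table (.seq clear (.seq (.loop 21 (.var 0) (.put 3 (.var 21) (.lit 1))) fill))

/-- The statement changes neither the parameters nor the input. -/
def keeps (P : Stm) : Bool :=
  (List.range 20).all (fun x => !P.writesV x) && !P.writesA 7 && !P.writesA 8 && !P.writesL

end Alg

/-- A discretized instance with the parameters of the algorithm. -/
structure Plan extends Net where
  k : ℕ
  N : ℕ
  s : ℕ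
  vt : ℕ → ℕ
  vt_lt : ∀ q < s, vt q < n
  vt_surj : ∀ e w, inc e w ≠ 0 → ∃ q < s, vt q = w
  cand_le : ∀ j < K, cand j ≤ N

/-- The store contains the discretized instance and the parameters. -/
structure Plan.Holds (H : Plan) (s : Store) : Prop where
  n : s.v 0 = H.n
  m : s.v 1 = H.m
  k : s.v 2 = H.k
  N : s.v 6 = H.N
  K : s.v 8 = H.K
  T : s.v 9 = (H.s * H.K + 1) ^ H.k
  big : s.v 12 = (H.K + 2) ^ H.n
  base : s.v 13 = H.s * H.K + 1
  cand : s.arr 7 = H.cand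
  vt : s.arr 8 = H.vt
  inc : ∀ e < H.m, ∀ w < H.n, s.low (5 + 2 * H.m + (e * H.n + w)) = H.inc e w

/-! ### Verification of the subroutines. -/

namespace Plan

open scoped Classical

variable {H : Plan} {s t : Store}

theorem Holds.frame {P : Stm} (h : H.Holds s) (hF : P.Frame s t) (hP : Alg.keeps P = true) :
    H.Holds t := by
  simp only [Alg.keeps, Bool.and_eq_true, List.all_eq_true, List.mem_range,
    Bool.not_eq_true'] at hP
  obtain ⟨⟨⟨hv, h7⟩, h8⟩, hl⟩ := hP
  constructor
  all_goals first
    | rw [hF.v _ (hv _ (by norm_num))]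
    | rw [hF.arr _ h7]
    | rw [hF.arr _ h8]
    | rw [hF.low hl]
  all_goals first
    | exact h.n | exact h.m | exact h.k | exact h.N | exact h.K | exact h.T | exact h.big
    | exact h.base | exact h.cand | exact h.vt | exact h.inc

theorem Holds.run {P : Stm} (h : H.Holds s) (hP : Alg.keeps P = true) : H.Holds (P.run s) :=
  h.frame (P.frame_run s) hP

theorem Holds.setV (h : H.Holds s) {x : ℕ} (hx : 20 ≤ x) (a : ℕ) : H.Holds (s.setV x a) := by
  constructor
  all_goals first | rw [Store.setV_v, if_neg (by omega)] | skip
  all_goals first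
    | exact h.n | exact h.m | exact h.k | exact h.N | exact h.K | exact h.T | exact h.big
    | exact h.base | exact h.cand | exact h.vt | exact h.inc

theorem Holds.eval_incE (h : H.Holds s) {e w : ℕ} (he : s.v 20 = e) (hw : s.v 21 = w)
    (hem : e < H.m) (hwn : w < H.n) : Alg.incE.eval s = H.inc e w := by
  simp [Alg.incE, Op.eval, he, hw, h.m, h.n, h.inc e hem w hwn]

@[simp] theorem eval_freeE (w : Ex) :
    (Alg.freeE w).eval s = if s.arr 1 (w.eval s) = 0 then 1 else 0 := by
  simp [Alg.freeE, Op.eval]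

/-- A first pass finds out whether the hyperedge contains a vertex that is both marked and free;
only then does a second pass mark all of it. -/
theorem run_spread (h : H.Holds s) {e : ℕ} (he : s.v 20 = e) (hem : e < H.m) :
    ∀ w < H.n, (Alg.spread.run s).arr 2 w =
      if H.inc e w ≠ 0 ∧ ∃ z < H.n, H.inc e z ≠ 0 ∧ s.arr 2 z ≠ 0 ∧ s.arr 1 z = 0 then 1
      else s.arr 2 w := by
  set s1 := s.setV 22 0 with hs1
  have h1 : H.Holds s1 := h.setV (by norm_num) _
  set P1 : Stm := .loop 21 (.var 0) (.ite (.op .mul Alg.incE (.op .mul (.get 2 (.var 21))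
    (Alg.freeE (.var 21)))) (.set 22 (.lit 1)) .skip) with hP1
  have hflag : (P1.run s1).v 22 ≠ 0 ↔
      ∃ z < H.n, H.inc e z ≠ 0 ∧ s.arr 2 z ≠ 0 ∧ s.arr 1 z = 0 := by
    refine Stm.loop_inv (fun i t => t.v 22 ≠ 0 ↔
      ∃ z < i, H.inc e z ≠ 0 ∧ s.arr 2 z ≠ 0 ∧ s.arr 1 z = 0) (by simp [h1.n]) (by simp [s1]) ?_
    intro i t hi hF hInv
    have ht : H.Holds (t.setV 21 i) := (h1.frame hF (by decide)).setV (by norm_num) _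
    have hinc := ht.eval_incE (e := e) (w := i) (by simp [hF.v 20 (by decide), s1, he])
      (by simp) hem hi
    have h2 : t.arr 2 = s.arr 2 := hF.arr 2 (by decide)
    have h1 : t.arr 1 = s.arr 1 := hF.arr 1 (by decide)
    have hcond : (Ex.op .mul Alg.incE (.op .mul (.get 2 (.var 21)) (Alg.freeE (.var 21)))).eval
        (t.setV 21 i) ≠ 0 ↔ H.inc e i ≠ 0 ∧ s.arr 2 i ≠ 0 ∧ s.arr 1 i = 0 := by
      simp [hinc, Op.eval, h1, h2]
      tauto
    simp only [Nat.lt_succ_iff_lt_or_eq]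
    by_cases hc : H.inc e i ≠ 0 ∧ s.arr 2 i ≠ 0 ∧ s.arr 1 i = 0
    · rw [Stm.run_ite_pos (hcond.2 hc)]
      exact ⟨fun _ => ⟨i, .inr rfl, hc⟩, fun _ => by simp⟩
    · rw [Stm.run_ite_neg (mt hcond.1 hc), Stm.run, show (t.setV 21 i).v 22 = t.v 22 by simp, hInv]
      constructor
      · rintro ⟨z, hz, hz'⟩; exact ⟨z, .inl hz, hz'⟩
      · rintro ⟨z, hz | rfl, hz'⟩
        · exact ⟨z, hz, hz'⟩
        · exact absurd hz' hc
  have h2 : H.Holds (P1.run s1) := h1.run (by decide)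
  have hF1 : P1.Frame s1 (P1.run s1) := P1.frame_run s1
  have ha : (P1.run s1).arr 2 = s.arr 2 := hF1.arr 2 (by decide)
  intro w hw
  have hrun : Alg.spread.run s = (Stm.ite (.var 22) (.loop 21 (.var 0) (.ite Alg.incE
    (.put 2 (.var 21) (.lit 1)) .skip)) .skip).run (P1.run s1) := rfl
  rw [hrun]
  by_cases hf : (P1.run s1).v 22 ≠ 0
  · rw [Stm.run_ite_pos (e := .var 22) hf]
    have key : ∀ w, w < H.n → ((Stm.loop 21 (.var 0) (.ite Alg.incE (.put 2 (.var 21) (.lit 1))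
        .skip)).run (P1.run s1)).arr 2 w = if w < H.n ∧ H.inc e w ≠ 0 then 1 else s.arr 2 w := by
      refine Stm.loop_inv (N := H.n) (fun i t => ∀ w < H.n, t.arr 2 w =
        if w < i ∧ H.inc e w ≠ 0 then 1 else s.arr 2 w) (by simp [h2.n]) (by simp [ha]) ?_
      intro i t hi hF hInv w hw
      have ht : H.Holds (t.setV 21 i) := (h2.frame hF (by decide)).setV (by norm_num) _
      have hinc := ht.eval_incE (e := e) (w := i)
        (by simp [hF.v 20 (by decide), hF1.v 20 (by decide), s1, he]) (by simp) hem hi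
      by_cases h0 : H.inc e i ≠ 0
      · rw [Stm.run_ite_pos (by rwa [hinc])]
        by_cases hwi : w = i
        · subst hwi; simp [h0]
        · have : w < i + 1 ↔ w < i := by omega
          simp [hwi, hInv w hw, this]
      · rw [Stm.run_ite_neg (by rwa [hinc])]
        by_cases hwi : w = i
        · subst hwi; simp [hInv w hw]; omega
        · have : w < i + 1 ↔ w < i := by omega
          simp [hInv w hw, this]
    rw [key w hw]
    simp only [hw, true_and, hflag.1 hf, and_true]
  · rw [Stm.run_ite_neg (e := .var 22) hf, Stm.run, ha, if_neg]
    rintro ⟨-, hz⟩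
    exact hf (hflag.2 hz)

/-- A round over all hyperedges that starts from a set not yet closed marks a new vertex. There are
only `n` vertices and one is marked initially, so `n` rounds suffice. -/
theorem run_reach (h : H.Holds s) {v : ℕ} (hv : s.v 25 = v) (hvn : v < H.n) :
    ∀ w < H.n, (Alg.reach.run s).arr 2 w = if H.Reach (s.arr 1) v w then 1 else 0 := by
  set D := s.arr 1 with hD
  set P1 : Stm := .loop 21 (.var 0) (.put 2 (.var 21) (.lit 0)) with hP1
  have hF1 : P1.Frame s (P1.run s) := P1.frame_run s
  have h1 : H.Holds (P1.run s) := h.run (by decide)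
  have hz1 : ∀ w < H.n, (P1.run s).arr 2 w = 0 := by
    refine Stm.loop_inv (fun i t => ∀ w < i, t.arr 2 w = 0) (by simp [h.n]) (by simp) ?_
    intro i t hi hF hInv w hw
    simp only [Stm.run, Ex.eval, Store.setV_v, Store.setA_arr_apply, Store.setV_arr, if_true]
    split
    · rfl
    · next hne => exact hInv w (by simp at hne; omega)
  set P2 : Stm := .put 2 (.var 25) (.lit 1) with hP2
  set s2 := P2.run (P1.run s) with hs2
  have h2 : H.Holds s2 := h1.run (by decide)
  have hF2 : P2.Frame (P1.run s) s2 := P2.frame_run _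
  have hD2 : s2.arr 1 = D := (hF2.arr 1 (by decide)).trans (hF1.arr 1 (by decide))
  have ha2 : ∀ w < H.n, s2.arr 2 w = if w = v then 1 else 0 := by
    intro w hw
    simp only [s2, P2, Stm.run, Ex.eval, Store.setA_arr_apply]
    rw [hF1.v 25 (by decide), hv, hz1 w hw]
    simp
  let InvR : Store → Prop := fun t => (∀ w < H.n, t.arr 2 w ≤ 1) ∧
    (∀ w < H.n, t.arr 2 w = 1 → H.Reach D v w) ∧ t.arr 2 v = 1
  let Closed : Store → Prop := fun t => ∀ e z w, z < H.n → t.arr 2 z = 1 → D z = 0 →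
    H.inc e z ≠ 0 → H.inc e w ≠ 0 → t.arr 2 w = 1
  have hclosed : ∀ t, InvR t → Closed t → ∀ w, H.Reach D v w → t.arr 2 w = 1 := by
    intro t hI hC w hw
    induction hw with
    | base => exact hI.2.2
    | step hr hz h1 h2 ih => exact hC _ _ _ (hr.lt hvn) ih hz h1 h2
  let cnt : Store → ℕ := fun t => ((Finset.range H.n).filter (fun w => t.arr 2 w = 1)).card
  have hround : ∀ t, H.Holds t → t.arr 1 = D → InvR t →
      let t' := (Stm.loop 20 (.var 1) Alg.spread).run t
      InvR t' ∧ (∀ w < H.n, t.arr 2 w = 1 → t'.arr 2 w = 1) ∧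
        ∀ e z w, e < H.m → z < H.n → t.arr 2 z = 1 → D z = 0 → H.inc e z ≠ 0 → H.inc e w ≠ 0 →
          t'.arr 2 w = 1 := by
    intro t ht htD hI
    refine Stm.loop_inv (N := H.m) (fun i t' => InvR t' ∧
      (∀ w < H.n, t.arr 2 w = 1 → t'.arr 2 w = 1) ∧
        ∀ e z w, e < i → z < H.n → t.arr 2 z = 1 → D z = 0 → H.inc e z ≠ 0 → H.inc e w ≠ 0 →
          t'.arr 2 w = 1) (by simp [ht.m]) ⟨hI, by simp, by simp⟩ ?_
    rintro i t' hi hF ⟨⟨hI1, hI2, hI3⟩, hm, hc⟩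
    have ht' : H.Holds (t'.setV 20 i) := (ht.frame hF (by decide)).setV (by norm_num) _
    have hsp := run_spread ht' (e := i) (by simp) hi
    have hD' : t'.arr 1 = D := (hF.arr 1 (by decide)).trans htD
    simp only [Store.setV_arr, hD'] at hsp
    have hmono : ∀ w < H.n, t'.arr 2 w = 1 → (Alg.spread.run (t'.setV 20 i)).arr 2 w = 1 := by
      intro w hw h'
      rw [hsp w hw]; split
      · rfl
      · exact h'
    refine ⟨⟨fun w hw => ?_, fun w hw h' => ?_, hmono v hvn hI3⟩,
      fun w hw h' => hmono w hw (hm w hw h'), ?_⟩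
    · rw [hsp w hw]; split
      · exact le_rfl
      · exact hI1 w hw
    · rw [hsp w hw] at h'
      split at h'
      · next hex =>
        obtain ⟨hw', z, hz, hez, hz2, hDz⟩ := hex
        exact (hI2 z hz (by have := hI1 z hz; omega)).step hDz hez hw'
      · exact hI2 w hw h'
    · intro e z w he hz htz hDz hez hew
      have hw := (H.inc_lt _ _ hew).2
      rcases Nat.lt_succ_iff_lt_or_eq.1 he with he | rfl
      · exact hmono w hw (hc e z w he hz htz hDz hez hew)
      · rw [hsp w hw, if_pos ⟨hew, z, hz, hez, by rw [hm z hz htz]; exact one_ne_zero, hDz⟩]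
  have hmain := Stm.loop_inv (x := 23) (e := .var 0) (P := .loop 20 (.var 1) Alg.spread) (s := s2)
    -- After `i` rounds the marked set is closed or has at least `i + 1` elements; at the end the
    -- second alternative would exceed `n`.
    (N := H.n) (fun i t => InvR t ∧ (Closed t ∨ i + 1 ≤ cnt t)) (by simp [h2.n])
    ⟨⟨fun w hw => by rw [ha2 w hw]; split <;> omega, fun w hw h' => by
      rw [ha2 w hw] at h'
      by_cases hwv : w = v
      · rw [hwv]; exact .base
      · simp [hwv] at h', by rw [ha2 v hvn, if_pos rfl]⟩, .inr (Finset.card_pos.2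
        ⟨v, Finset.mem_filter.2 ⟨Finset.mem_range.2 hvn, by rw [ha2 v hvn, if_pos rfl]⟩⟩)⟩ ?_
  · obtain ⟨hI, hC⟩ := hmain
    have hC : Closed _ := hC.resolve_right fun hle => by
      have hle' := (Nat.lt_of_succ_le hle).trans_le (Finset.card_filter_le _ _)
      simp at hle'
    intro w hw
    have hrun : Alg.reach.run s =
      (Stm.loop 23 (.var 0) (.loop 20 (.var 1) Alg.spread)).run s2 := rfl
    rw [hrun]
    split
    · next hr => exact hclosed _ hI hC w hr
    · next hr =>
      have h1 := hI.1 w hw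
      have h2 : ¬ _ = 1 := fun h => hr (hI.2.1 w hw h)
      omega
  · intro i t hi hF hInv
    have ht : H.Holds (t.setV 23 i) := (h2.frame hF (by decide)).setV (by norm_num) _
    obtain ⟨hI, hm, hc⟩ := hround (t.setV 23 i) ht
      (by rw [Store.setV_arr]; exact (hF.arr 1 (by decide)).trans hD2) hInv.1
    refine ⟨hI, ?_⟩
    by_cases hC : Closed t
    · left
      intro e z w hz htz hDz hez hew
      have := hclosed t hInv.1 hC z (hI.2.1 z hz htz)
      exact hm w (H.inc_lt _ _ hew).2 (hC e z w hz this hDz hez hew)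
    · right
      have hcnt := hInv.2.resolve_left hC
      simp only [Closed, not_forall] at hC
      obtain ⟨e, z, w, hz, htz, hDz, hez, hew, hne⟩ := hC
      have hlt : cnt t < cnt ((Stm.loop 20 (.var 1) Alg.spread).run (t.setV 23 i)) := by
        refine Finset.card_lt_card (Finset.ssubset_iff_of_subset (fun x hx => ?_) |>.2 ⟨w, ?_, ?_⟩)
        · rw [Finset.mem_filter, Finset.mem_range] at hx ⊢
          exact ⟨hx.1, hm x hx.1 hx.2⟩
        · rw [Finset.mem_filter, Finset.mem_range]
          exact ⟨(H.inc_lt _ _ hew).2, hc e z w (H.inc_lt _ _ hew).1 hz htz hDz hez hew⟩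
        · rw [Finset.mem_filter]; exact fun h => hne h.2
      omega

/-- The cap at `(K + 2) ^ n` is there for the static bounds only; partial Horner values never exceed
it. -/
theorem run_key (h : H.Holds s) {v : ℕ} (hD : ∀ w, s.arr 1 w ≤ H.K)
    (hR : ∀ w < H.n, s.arr 2 w = if H.Reach (s.arr 1) v w then 1 else 0) :
    (Alg.key.run s).v 24 = H.key (s.arr 1) v := by
  refine Stm.loop_inv (N := H.n) (fun i t => t.v 24 = H.horner (H.digit (s.arr 1) v) i)
    (by simp [h.n]) (by simp [Net.horner]) ?_
  intro i t hi hF hInv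
  have h1 : t.arr 1 = s.arr 1 := hF.arr 1 (by decide)
  have h2 : t.arr 2 = s.arr 2 := hF.arr 2 (by decide)
  have h8 : t.v 8 = H.K := by rw [hF.v 8 (by decide)]; simp [h.K]
  have h12 : t.v 12 = (H.K + 2) ^ H.n := by rw [hF.v 12 (by decide)]; simp [h.big]
  have hd : s.arr 2 i * (s.arr 1 i + 1) = H.digit (s.arr 1) v i := by
    rw [hR i hi, Net.digit]; split <;> simp
  have hlt : H.horner (H.digit (s.arr 1) v) (i + 1) ≤ (H.K + 2) ^ H.n :=
    (Net.horner_lt fun w _ => Net.digit_lt hD v w).le.trans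
      (Nat.pow_le_pow_right (by omega) (by omega))
  rw [Net.horner] at hlt ⊢
  simp [Op.eval, hInv, h1, h2, h8, h12, hd, hlt]

end Plan

namespace Net

variable {H : Net}

theorem val_congr {E E' : ℕ → ℕ} (h : ∀ w < H.n, E w = E' w) : H.val E = H.val E' :=
  Finset.sum_congr rfl fun _ _ => rev_congr fun w hw => h w (H.inc_lt _ _ hw).2

theorem fill_lt {tab D : ℕ → ℕ} (ht : ∀ i, tab i < H.K) (hD : ∀ w, D w ≤ H.K) (R : ℕ → Prop)
    (z : ℕ) : H.fill tab D R z < H.K := by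
  have := hD z
  have := H.K_pos
  rw [fill]
  split
  · exact ht _
  · omega

theorem update_le {D : ℕ → ℕ} (hD : ∀ w, D w ≤ H.K) {x : ℕ} (hx : x < H.K) (u w : ℕ) :
    Function.update D u (x + 1) w ≤ H.K := by
  by_cases hw : w = u
  · simp [hw]; omega
  · rw [Function.update_of_ne hw]; exact hD w

end Net

namespace Plan

open scoped Classical

variable {H : Plan} {s t : Store}

theorem run_fill (h : H.Holds s) (hD : ∀ w, s.arr 1 w ≤ H.K) {R : ℕ → Prop}
    (hR : ∀ z < H.n, s.arr 3 z = if R z then 1 else 0) :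
    ∀ z < H.n, (Alg.fill.run s).arr 4 z = H.fill (s.arr 6) (s.arr 1) R z := by
  refine Stm.loop_inv (fun i t => ∀ z < i, t.arr 4 z = H.fill (s.arr 6) (s.arr 1) R z)
    (by simp [h.n]) (by simp) ?_
  intro i t hi hF hInv z hz
  have h1 : t.arr 1 = s.arr 1 := hF.arr 1 (by decide)
  have h3 : t.arr 3 = s.arr 3 := hF.arr 3 (by decide)
  have h6 : t.arr 6 = s.arr 6 := hF.arr 6 (by decide)
  have ht : H.Holds (t.setV 25 i) := (h.frame hF (by decide)).setV (by norm_num) _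
  have hcond : (Ex.op .mul (.get 3 (.var 25)) (Alg.freeE (.var 25))).eval (t.setV 25 i) ≠ 0 ↔
      R i ∧ s.arr 1 i = 0 := by
    simp [Op.eval, h1, h3, hR i hi]
    tauto
  by_cases hc : R i ∧ s.arr 1 i = 0
  · rw [Stm.run_ite_pos (hcond.2 hc), Stm.run_seq, Stm.run_seq]
    set t1 := Alg.reach.run (t.setV 25 i) with ht1
    have hF1 : Alg.reach.Frame (t.setV 25 i) t1 := Stm.frame_run _ _
    have hr := run_reach ht (v := i) (by simp) hi
    have h11 : t1.arr 1 = s.arr 1 := (hF1.arr 1 (by decide)).trans h1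
    have hk := run_key (s := t1) (v := i) (ht.run (by decide)) (by rwa [h11])
      (by rw [h11, ← h1]; exact hr)
    have hF2 : Alg.key.Frame t1 (Alg.key.run t1) := Stm.frame_run _ _
    have h4 : (Alg.key.run t1).arr 4 = t.arr 4 := (hF2.arr 4 (by decide)).trans
      (hF1.arr 4 (by decide))
    have h6' : (Alg.key.run t1).arr 6 = s.arr 6 := (hF2.arr 6 (by decide)).trans
      ((hF1.arr 6 (by decide)).trans h6)
    have h25 : (Alg.key.run t1).v 25 = i := by
      rw [hF2.v 25 (by decide), hF1.v 25 (by decide)]; simp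
    have h0 : (Alg.key.run t1).v 0 = H.n := ((ht.run (by decide)).run (by decide)).n
    simp only [Stm.run, Ex.eval, Store.setA_arr_apply, h4, h6', h25, h0, hk, h11, Op.eval,
      true_and]
    split
    · next hzi => rw [hzi, Net.fill, if_pos hc]
    · exact hInv z (by omega)
  · rw [Stm.run_ite_neg (mt hcond.1 hc)]
    simp only [Stm.run, Ex.eval, Store.setA_arr_apply, Store.setV_arr, Store.setV_v, if_true,
      Op.eval, true_and, h1]
    split
    · next hzi => rw [hzi, Net.fill, if_neg hc]
    · exact hInv z (by omega)

theorem run_price (h : H.Holds s) {e : ℕ} (he : s.v 20 = e) (hem : e < H.m)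
    (hE : ∀ w < H.n, s.arr 4 w < H.K) : (Alg.price.run s).v 36 = H.sum (s.arr 4) e := by
  have key := Stm.loop_inv (x := 21) (e := .var 0) (P := .ite Alg.incE (.set 36 (.cap
    (.op .add (.var 36) (.get 7 (.get 4 (.var 21)))) (.op .mul (.var 0) (.var 6)))) .skip)
    (s := s.setV 36 0) (N := H.n) (fun i t => t.v 36 =
      ∑ w ∈ Finset.range i, H.inc e w * H.cand (s.arr 4 w) ∧ t.v 36 ≤ i * H.N)
    (by simp [h.n]) (by simp) ?_
  · exact key.1
  · intro i t hi hF hInv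
    have ht := h.setV (x := 36) (by norm_num) 0
    have ht : H.Holds (t.setV 21 i) := (ht.frame hF (by decide)).setV (by norm_num) _
    have h4 : t.arr 4 = s.arr 4 := hF.arr 4 (by decide)
    have hinc := ht.eval_incE (e := e) (w := i) (by simp [hF.v 20 (by decide), he]) (by simp) hem hi
    have hc := H.cand_le _ (hE i hi)
    have hle : (i + 1) * H.N ≤ H.n * H.N := Nat.mul_le_mul_right _ hi
    have h0 := ht.n
    have h6 := ht.N
    have h7 := ht.cand
    simp only [Store.setV_v, Store.setV_arr] at h0 h6 h7
    rw [Finset.sum_range_succ, ← hInv.1]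
    rw [add_mul, one_mul] at hle ⊢
    by_cases h0 : H.inc e i ≠ 0
    · have h1 : H.inc e i = 1 := le_antisymm (H.inc_le _ _) (Nat.one_le_iff_ne_zero.2 h0)
      rw [Stm.run_ite_pos (by rwa [hinc]), h1]
      -- The cap is inactive: `i + 1` prices of at most `N` each do not exceed `n * N`.
      have hmin : min (t.v 36 + H.cand (s.arr 4 i)) (H.n * H.N) = t.v 36 + H.cand (s.arr 4 i) :=
        min_eq_left (by omega)
      simp_all [Op.eval]
      omega
    · rw [Stm.run_ite_neg (by rwa [hinc])]
      simp only [ne_eq, not_not] at h0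
      simp only [Stm.run, Store.setV_v, h0, zero_mul, add_zero]
      exact ⟨rfl, by have := hInv.2; simp; omega⟩

theorem sum_le {E : ℕ → ℕ} (hE : ∀ w < H.n, E w < H.K) (e : ℕ) : H.sum E e ≤ H.n * H.N := by
  refine (Finset.sum_le_card_nsmul _ _ H.N fun w hw => ?_).trans (by simp)
  have h1 := H.cand_le _ (hE w (Finset.mem_range.1 hw))
  have h2 := H.inc_le e w
  calc _ ≤ 1 * H.N := Nat.mul_le_mul h2 h1
    _ = _ := one_mul _

theorem run_revenue (h : H.Holds s) (hE : ∀ w < H.n, s.arr 4 w < H.K) :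
    (Alg.revenue.run s).v 37 = H.val (s.arr 4) := by
  refine (Stm.loop_inv (N := H.m) (fun i t => t.v 37 = ∑ e ∈ Finset.range i, H.rev (s.arr 4) e ∧
    t.v 37 ≤ i * (H.n * H.N)) (by simp [h.m]) (by simp) ?_).1
  intro i t hi hF hInv
  have ht := h.setV (x := 37) (by norm_num) 0
  have ht : H.Holds (t.setV 20 i) := (ht.frame hF (by decide)).setV (by norm_num) _
  have h4 : t.arr 4 = s.arr 4 := hF.arr 4 (by decide)
  have hp := run_price ht (e := i) (by simp) hi (by rwa [Store.setV_arr, h4])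
  rw [Store.setV_arr, h4] at hp
  rw [Stm.run_seq]
  set t1 := Alg.price.run (t.setV 20 i) with ht1
  have hF1 : Alg.price.Frame (t.setV 20 i) t1 := Stm.frame_run _ _
  have h1 : H.Holds t1 := ht.run (by decide)
  have h20 : t1.v 20 = i := by rw [hF1.v 20 (by decide)]; simp
  have h37 : t1.v 37 = t.v 37 := by rw [hF1.v 37 (by decide)]; simp
  have hs := sum_le hE i
  have hle : (i + 1) * (H.n * H.N) ≤ H.m * (H.n * H.N) := Nat.mul_le_mul_right _ hi
  have hcond : (Ex.op .lt (.get 7 (.var 20)) (.var 36)).eval t1 ≠ 0 ↔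
      H.cand i < H.sum (s.arr 4) i := by
    simp [Op.eval, h20, h1.cand, hp]
  rw [Finset.sum_range_succ, ← hInv.1]
  rw [add_mul, one_mul] at hle ⊢
  have hi2 := hInv.2
  by_cases hc : H.cand i < H.sum (s.arr 4) i
  · rw [Stm.run_ite_pos (hcond.2 hc), Stm.run, h37, Net.rev, if_neg (by omega)]
    exact ⟨rfl, by omega⟩
  · rw [Stm.run_ite_neg (mt hcond.1 hc), Net.rev, if_pos (by omega)]
    have hmin : min (t.v 37 + H.sum (s.arr 4) i) (H.m * (H.n * H.N)) =
      t.v 37 + H.sum (s.arr 4) i := min_eq_left (by omega)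
    simp only [Stm.run, Ex.eval, Op.eval, Store.setV_v, if_true, h37, hp, h1.m, h1.n, h1.N, hmin]
    exact ⟨trivial, by omega⟩

/-- Copying one array to another. -/
theorem run_copy {x a b : ℕ} (hab : a ≠ b) (h : s.v 0 = H.n) (hx : x ≠ 0) :
    ∀ z < H.n, ((Stm.loop x (.var 0) (.put a (.var x) (.get b (.var x)))).run s).arr a z =
      s.arr b z := by
  refine Stm.loop_inv (fun i t => ∀ z < i, t.arr a z = s.arr b z) (by simp [h]) (by simp) ?_
  intro i t hi hF hInv z hz
  have hb : t.arr b = s.arr b := hF.arr b (by simp; omega)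
  simp only [Stm.run, Ex.eval, Store.setA_arr_apply, Store.setV_arr, Store.setV_v, if_true, hb,
    true_and]
  split
  · next h => rw [h]
  · exact hInv z (by omega)

/-- The value `y` left at `u` by the previous attempt is overwritten. The incumbent is replaced also
in case of a tie. -/
theorem run_attempt (h : H.Holds s) {D : ℕ → ℕ} {u x y : ℕ} {R : ℕ → Prop} (hu : s.v 27 = u)
    (hx : s.v 28 = x) (hxK : x < H.K) (hD : ∀ w, D w ≤ H.K) (h1 : s.arr 1 = Function.update D u y)
    (hR : ∀ z < H.n, s.arr 3 z = if R z then 1 else 0) (htab : ∀ i, s.arr 6 i < H.K) :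
    (Alg.attempt.run s).arr 1 = Function.update D u (x + 1) ∧
      (H.val (H.fill (s.arr 6) (Function.update D u (x + 1)) R) < s.v 35 →
        (Alg.attempt.run s).v 35 = s.v 35 ∧ (Alg.attempt.run s).arr 5 = s.arr 5) ∧
      (¬ H.val (H.fill (s.arr 6) (Function.update D u (x + 1)) R) < s.v 35 →
        (Alg.attempt.run s).v 35 = H.val (H.fill (s.arr 6) (Function.update D u (x + 1)) R) ∧
          ∀ z < H.n, (Alg.attempt.run s).arr 5 z =
            H.fill (s.arr 6) (Function.update D u (x + 1)) R z) := by
  set P1 : Stm := .put 1 (.var 27) (.op .add (.var 28) (.lit 1)) with hP1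
  set s1 := P1.run s with hs1
  have hF1 : P1.Frame s s1 := P1.frame_run s
  have h11 : s1.arr 1 = Function.update D u (x + 1) := by
    funext w
    simp only [s1, P1, Stm.run, Ex.eval, Op.eval, Store.setA_arr_apply, hu, hx, h1, true_and]
    by_cases hw : w = u <;> simp [hw]
  have hs1 : H.Holds s1 := h.run (by decide)
  set s2 := Alg.fill.run s1 with hs2
  have hF2 : Alg.fill.Frame s1 s2 := Alg.fill.frame_run s1
  have h12 : s2.arr 1 = Function.update D u (x + 1) := (hF2.arr 1 (by decide)).trans h11
  have hfill := run_fill hs1 (R := R) (by rw [h11]; exact Net.update_le hD hxK u)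
    (by rw [hF1.arr 3 (by decide)]; exact hR)
  rw [h11, hF1.arr 6 (by decide)] at hfill
  set G := H.fill (s.arr 6) (Function.update D u (x + 1)) R with hG
  have hGK : ∀ z, G z < H.K := Net.fill_lt htab (Net.update_le hD hxK u) R
  have h2 : H.Holds s2 := hs1.run (by decide)
  have hrev := run_revenue h2 (fun w hw => by rw [hfill w hw]; exact hGK w)
  rw [Net.val_congr hfill] at hrev
  set s3 := Alg.revenue.run s2 with hs3
  have hF3 : Alg.revenue.Frame s2 s3 := Alg.revenue.frame_run s2
  have h3 : H.Holds s3 := h2.run (by decide)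
  have h35 : s3.v 35 = s.v 35 := by
    rw [hF3.v 35 (by decide), hF2.v 35 (by decide), hF1.v 35 (by decide)]
  have h5 : s3.arr 5 = s.arr 5 := by
    rw [hF3.arr 5 (by decide), hF2.arr 5 (by decide), hF1.arr 5 (by decide)]
  set P4 : Stm := .ite (.op .lt (.var 37) (.var 35)) .skip (.seq (.set 35 (.var 37))
      (.loop 21 (.var 0) (.put 5 (.var 21) (.get 4 (.var 21))))) with hP4
  have hrun : Alg.attempt.run s = P4.run s3 := rfl
  have hF4 : P4.Frame s3 (P4.run s3) := P4.frame_run s3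
  have hcond : (Ex.op .lt (.var 37) (.var 35)).eval s3 ≠ 0 ↔ H.val G < s.v 35 := by
    simp [Op.eval, hrev, h35]
  rw [hrun]
  refine ⟨by rw [hF4.arr 1 (by decide), hF3.arr 1 (by decide), h12], fun hc => ?_, fun hc => ?_⟩
  · rw [hP4, Stm.run_ite_pos (hcond.2 hc), Stm.run]
    exact ⟨h35, h5⟩
  · rw [hP4, Stm.run_ite_neg (mt hcond.1 hc), Stm.run_seq]
    have hcopy := run_copy (H := H) (s := (Stm.set 35 (.var 37)).run s3) (x := 21) (a := 5) (b := 4)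
      (by norm_num) (by simp [h3.n]) (by norm_num)
    constructor
    · rw [(Stm.frame_run _ _).v 35 (by decide)]
      simp [hrev]
    · intro z hz
      rw [hcopy z hz]
      simp only [Stm.run, Store.setV_arr]
      rw [hF3.arr 4 (by decide), hfill z hz]

/-- The state of the search for a best continuation after the pairs in `A` have been tried. -/
structure Search (H : Plan) (tab D : ℕ → ℕ) (v : ℕ) (A : ℕ → ℕ → Prop) (t : Store) : Prop where
  lt : ∀ z < H.n, t.arr 5 z < H.K
  le : ∀ u x, A u x →
    H.val (H.fill tab (Function.update D u (x + 1)) (H.Reach D v)) ≤ t.v 35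
  mem : (t.v 35 = 0 ∧ ∀ u x, ¬ A u x) ∨ (t.v 35 = H.val (t.arr 5) ∧ ∃ u x, H.Comp D v u ∧
    ∀ z < H.n, t.arr 5 z = H.fill tab (Function.update D u (x + 1)) (H.Reach D v) z)

theorem run_best (h : H.Holds s) {D : ℕ → ℕ} {v : ℕ} (hvn : v < H.n) (hD : ∀ w, D w ≤ H.K)
    (h1 : s.arr 1 = D) (hR : ∀ z < H.n, s.arr 3 z = if H.Reach D v z then 1 else 0)
    (htab : ∀ i, s.arr 6 i < H.K) (h5 : ∀ z < H.n, s.arr 5 z < H.K) :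
    (Alg.best.run s).arr 1 = D ∧ (∀ z < H.n, (Alg.best.run s).arr 5 z < H.K) ∧
      (D v = 0 → H.Best (s.arr 6) D v ((Alg.best.run s).arr 5)) := by
  have key := Stm.loop_inv (x := 27) (e := .var 0) (P := .ite (.op .mul (.get 3 (.var 27))
      (Alg.freeE (.var 27))) (.seq (.loop 28 (.var 8) Alg.attempt) (.put 1 (.var 27) (.lit 0)))
      .skip) (s := s.setV 35 0) (N := H.n) (fun i t => t.arr 1 = D ∧
        H.Search (s.arr 6) D v (fun u x => u < i ∧ H.Comp D v u ∧ x < H.K) t) (by simp [h.n])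
      ⟨h1, h5, by simp, .inl ⟨by simp, by simp⟩⟩ ?_
  · obtain ⟨hD1, hlt, hle, hmem⟩ := key
    refine ⟨hD1, hlt, fun hv => ?_⟩
    have hC : H.Comp D v v := ⟨.base, hv⟩
    rcases hmem with hmem | ⟨hval, hmem⟩
    · exact absurd ⟨hvn, hC, H.K_pos⟩ (hmem.2 v 0)
    · exact ⟨hmem, fun u x hu hx => (hle u x ⟨hu.1.lt hvn, hu, hx⟩).trans hval.le⟩
  · intro u t hu hF hInv
    have ht0 := h.setV (x := 35) (by norm_num) 0
    have ht : H.Holds (t.setV 27 u) := (ht0.frame hF (by decide)).setV (by norm_num) _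
    have h3 : t.arr 3 = s.arr 3 := hF.arr 3 (by decide)
    have h6 : t.arr 6 = s.arr 6 := hF.arr 6 (by decide)
    have hcond : (Ex.op .mul (.get 3 (.var 27)) (Alg.freeE (.var 27))).eval (t.setV 27 u) ≠ 0 ↔
        H.Comp D v u := by
      simp [Op.eval, h3, hInv.1, hR u hu, Net.Comp]
      tauto
    by_cases hc : H.Comp D v u
    · rw [Stm.run_ite_pos (hcond.2 hc), Stm.run_seq]
      have hloop := Stm.loop_inv (x := 28) (e := .var 8) (P := Alg.attempt) (s := t.setV 27 u)
        (N := H.K) (fun i t => (∃ y, t.arr 1 = Function.update D u y) ∧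
          H.Search (s.arr 6) D v (fun u' x => u' < u ∧ H.Comp D v u' ∧ x < H.K ∨ u' = u ∧ x < i) t)
        (by have := ht.K; simpa using this) ⟨⟨D u, by simp [hInv.1]⟩, hInv.2.lt, fun u' x hA => ?_, ?_⟩ ?_
      · obtain ⟨⟨y, hy⟩, hlt, hle, hmem⟩ := hloop
        have hFl := Stm.frame_run (.loop 28 (.var 8) Alg.attempt) (t.setV 27 u)
        set t2 := (Stm.loop 28 (.var 8) Alg.attempt).run (t.setV 27 u)
        have h27 : t2.v 27 = u := by rw [hFl.v 27 (by decide)]; simp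
        refine ⟨?_, hlt, fun u' x hA => hle u' x ?_, hmem.imp (fun hm => ⟨hm.1, ?_⟩) id⟩
        -- Resetting the entry of `u` to 0 restores `D`, because `u` was free.
        · funext w
          simp only [Stm.run, Ex.eval, Store.setA_arr_apply, h27, true_and, hy]
          by_cases hw : w = u
          · simp [hw, hc.2]
          · simp [hw]
        · obtain ⟨h1, h2⟩ := hA
          rcases Nat.lt_succ_iff_lt_or_eq.1 h1 with h1 | h1
          · exact .inl ⟨h1, h2⟩
          · exact .inr ⟨h1, h2.2⟩
        · exact fun _ _ _ => hm.2 u 0 (.inr ⟨rfl, H.K_pos⟩)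
      · rcases hA with hA | hA
        · exact hInv.2.le u' x hA
        · omega
      · refine hInv.2.mem.imp (fun hm => ⟨by simpa using hm.1, fun u' x hA => ?_⟩) (fun hm => ?_)
        · rcases hA with hA | hA
          · exact hm.2 u' x hA
          · omega
        · simpa using hm
      · intro x t' hx hF' hInv'
        obtain ⟨⟨y, hy⟩, hlt, hle, hmem⟩ := hInv'
        have ht' : H.Holds (t'.setV 28 x) := (ht.frame hF' (by decide)).setV (by norm_num) _
        have h3' : t'.arr 3 = s.arr 3 := (hF'.arr 3 (by decide)).trans h3
        have h6' : t'.arr 6 = s.arr 6 := (hF'.arr 6 (by decide)).trans h6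
        have hA := run_attempt ht' (D := D) (u := u) (x := x) (y := y) (R := H.Reach D v)
          (by simp [hF'.v 27 (by decide)]) (by simp) hx hD (by simpa using hy)
          (by simpa [h3'] using hR) (by simpa [h6'] using htab)
        have h35 : (t'.setV 28 x).v 35 = t'.v 35 := by simp
        rw [Store.setV_arr, h6', h35] at hA
        obtain ⟨hA1, hA2, hA3⟩ := hA
        refine ⟨⟨_, hA1⟩, ?_⟩
        by_cases hval : H.val (H.fill (s.arr 6) (Function.update D u (x + 1)) (H.Reach D v)) <
            t'.v 35
        · obtain ⟨hv, ha⟩ := hA2 hval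
          refine ⟨by rw [ha]; exact hlt, fun u' x' hA => ?_, ?_⟩
          · rw [hv]
            rcases hA with hA | ⟨rfl, hA⟩
            · exact hle u' x' (.inl hA)
            · rcases Nat.lt_succ_iff_lt_or_eq.1 hA with hA | rfl
              · exact hle u' x' (.inr ⟨rfl, hA⟩)
              · exact hval.le
          · rw [hv, ha]
            -- Before any attempt the record is 0, which no revenue undercuts; since ties replace
            -- the incumbent, even an attempt with revenue 0 is recorded.
            rcases hmem with hm | hm
            · omega
            · exact .inr hm
        · obtain ⟨hv, ha⟩ := hA3 hval
          refine ⟨fun z hz => ?_, fun u' x' hA => ?_, .inr ⟨?_, u, x, hc, ha⟩⟩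
          · rw [ha z hz]; exact Net.fill_lt htab (Net.update_le hD hx u) _ z
          · rw [hv]
            rcases hA with hA | ⟨rfl, hA⟩
            · exact (hle u' x' (.inl hA)).trans (not_lt.1 hval)
            · rcases Nat.lt_succ_iff_lt_or_eq.1 hA with hA | rfl
              · exact (hle u' x' (.inr ⟨rfl, hA⟩)).trans (not_lt.1 hval)
              · exact le_rfl
          · rw [hv]; exact (Net.val_congr ha).symm
    · rw [Stm.run_ite_neg (mt hcond.1 hc), Stm.run]
      refine ⟨hInv.1, hInv.2.lt, fun u' x hA => ?_, ?_⟩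
      · rw [show (t.setV 27 u).v 35 = t.v 35 by simp]
        refine hInv.2.le u' x ⟨?_, hA.2⟩
        rcases Nat.lt_succ_iff_lt_or_eq.1 hA.1 with h | h
        · exact h
        · exact absurd hA.2.1 (h ▸ hc)
      · rw [show (t.setV 27 u).v 35 = t.v 35 by simp]
        refine hInv.2.mem.imp (fun hm => ⟨hm.1, fun u' x hA => hm.2 u' x ⟨?_, hA.2⟩⟩) id
        rcases Nat.lt_succ_iff_lt_or_eq.1 hA.1 with h | h
        · exact h
        · exact absurd hA.2.1 (h ▸ hc)

end Plan

/-! ### Recomputing rows, enumerating codes and filling the table. -/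

namespace Plan

open scoped Classical

variable {H : Plan} {s t : Store}

/-- If `v` is assigned, nothing is tried and the row receives a stale assignment. This does no harm:
no admissible component has that key, and the entries are still candidate numbers. -/
theorem run_row (h : H.Holds s) {D : ℕ → ℕ} {v : ℕ} (hv : s.v 26 = v) (hvn : v < H.n)
    (hD : ∀ w, D w ≤ H.K) (h1 : s.arr 1 = D) (htab : ∀ i, s.arr 6 i < H.K)
    (h5 : ∀ z < H.n, s.arr 5 z < H.K) :
    (Alg.row.run s).arr 1 = D ∧ (∀ i, (Alg.row.run s).arr 6 i < H.K) ∧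
      (∀ z < H.n, (Alg.row.run s).arr 5 z < H.K) ∧
      (D v = 0 → H.Best (s.arr 6) D v ((Alg.row.run s).arr 5)) ∧
      (∀ z < H.n, (Alg.row.run s).arr 6 (H.key D v * H.n + z) = (Alg.row.run s).arr 5 z) ∧
      ∀ q ≠ H.key D v, ∀ z < H.n, (Alg.row.run s).arr 6 (q * H.n + z) = s.arr 6 (q * H.n + z) := by
  set s1 := (Stm.set 25 (.var 26)).run s with hs1
  have hF1 := Stm.frame_run (.set 25 (.var 26)) s
  have hH1 : H.Holds s1 := h.run (by decide)
  set s2 := Alg.reach.run s1 with hs2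
  have hF2 := Stm.frame_run Alg.reach s1
  have hH2 : H.Holds s2 := hH1.run (by decide)
  have hD1 : s1.arr 1 = D := h1
  have hD2 : s2.arr 1 = D := (hF2.arr 1 (by decide)).trans hD1
  have hr := run_reach hH1 (v := v) (by simp [s1, hv]) hvn
  rw [hD1] at hr
  set P3 : Stm := .loop 21 (.var 0) (.put 3 (.var 21) (.get 2 (.var 21)))
  set s3 := P3.run s2 with hs3
  have hF3 := Stm.frame_run P3 s2
  have hH3 : H.Holds s3 := hH2.run (by decide)
  have hD3 : s3.arr 1 = D := (hF3.arr 1 (by decide)).trans hD2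
  have hc3 : ∀ z < H.n, s3.arr 3 z = if H.Reach D v z then 1 else 0 := fun z hz => by
    rw [← hr z hz]; exact run_copy (by norm_num) hH2.n (by norm_num) z hz
  set s4 := Alg.key.run s3 with hs4
  have hF4 := Stm.frame_run Alg.key s3
  have hH4 : H.Holds s4 := hH3.run (by decide)
  have hk := run_key hH3 (v := v) (by rwa [hD3])
    (by rw [hF3.arr 2 (by decide), hD3]; exact hr)
  rw [hD3] at hk
  set s5 := (Stm.set 34 (.var 24)).run s4 with hs5
  have hF5 := Stm.frame_run (.set 34 (.var 24)) s4
  have hH5 : H.Holds s5 := hH4.run (by decide)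
  have hk5 : s5.v 34 = H.key D v := by simp [s5, s4, hk]
  have h6 : s5.arr 6 = s.arr 6 := by
    rw [hF5.arr 6 (by decide), hF4.arr 6 (by decide), hF3.arr 6 (by decide), hF2.arr 6 (by decide),
      hF1.arr 6 (by decide)]
  have h5' : s5.arr 5 = s.arr 5 := by
    rw [hF5.arr 5 (by decide), hF4.arr 5 (by decide), hF3.arr 5 (by decide), hF2.arr 5 (by decide),
      hF1.arr 5 (by decide)]
  have hb := run_best hH5 (D := D) (v := v) hvn hD
    (by rw [hF5.arr 1 (by decide), hF4.arr 1 (by decide), hD3])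
    (by rw [hF5.arr 3 (by decide), hF4.arr 3 (by decide)]; exact hc3) (by rwa [h6]) (by rwa [h5'])
  set s6 := Alg.best.run s5 with hs6
  have hF6 := Stm.frame_run Alg.best s5
  have hH6 : H.Holds s6 := hH5.run (by decide)
  set P7 : Stm := .loop 21 (.var 0) (.put 6 (.op .add (.op .mul (.var 34) (.var 0)) (.var 21))
          (.get 5 (.var 21)))
  have hF7 := Stm.frame_run P7 s6
  have hrun : Alg.row.run s = P7.run s6 := rfl
  have hcopy : (∀ z < H.n, (P7.run s6).arr 6 (H.key D v * H.n + z) = s6.arr 5 z) ∧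
      (∀ j, (∀ z < H.n, j ≠ H.key D v * H.n + z) → (P7.run s6).arr 6 j = s6.arr 6 j) := by
    refine Stm.loop_inv (N := H.n) (fun i t =>
      (∀ z < i, t.arr 6 (H.key D v * H.n + z) = s6.arr 5 z) ∧
      (∀ j, (∀ z < H.n, j ≠ H.key D v * H.n + z) → t.arr 6 j = s6.arr 6 j)) (by simp [hH6.n])
      (by simp) ?_
    rintro i t hi hF ⟨hI1, hI2⟩
    have h34 : t.v 34 = H.key D v := by rw [hF.v 34 (by decide), hF6.v 34 (by decide), hk5]
    have h5t : t.arr 5 = s6.arr 5 := hF.arr 5 (by decide)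
    have h0 : t.v 0 = H.n := by rw [hF.v 0 (by decide), hH6.n]
    constructor
    · intro z hz
      by_cases hzi : z = i
      · simp [Op.eval, h34, h5t, h0, hzi]
      · simp [Op.eval, h34, h0, hzi, hI1 z (by omega)]
    · intro j hj
      have := hj i hi
      simp [Op.eval, h34, h0, this, hI2 j hj]
  rw [hrun, hF7.arr 1 (by decide), hF7.arr 5 (by decide)]
  refine ⟨hb.1, fun j => ?_, hb.2.1, h6 ▸ hb.2.2, hcopy.1, fun q hq z hz => ?_⟩
  · by_cases hj : ∃ z < H.n, j = H.key D v * H.n + z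
    · obtain ⟨z, hz, rfl⟩ := hj
      rw [hcopy.1 z hz]; exact hb.2.1 z hz
    · rw [hcopy.2 j fun z hz h => hj ⟨z, hz, h⟩, hF6.arr 6 (by decide), h6]
      exact htab j
  -- Rows are blocks of `n` consecutive cells, so division by `n` recovers the key from the index.
  · rw [hcopy.2 _ fun z' hz' h => hq ?_, hF6.arr 6 (by decide), h6]
    have hd := congrArg (· / H.n) h
    have hn : 0 < H.n := by omega
    simpa [Nat.add_comm (_ * H.n), Nat.add_mul_div_right _ _ hn, Nat.div_eq_of_lt hz,
      Nat.div_eq_of_lt hz'] using hd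

variable (H)

/-- The partial assignment with the code `c`. -/
def dec : ℕ → ℕ → (ℕ → ℕ) → ℕ → ℕ
  | 0, _, D => D
  | k + 1, c, D => dec k (c / (H.s * H.K + 1))
      (if c % (H.s * H.K + 1) = 0 then D else
        Function.update D (H.vt ((c % (H.s * H.K + 1) - 1) / H.K))
          ((c % (H.s * H.K + 1) - 1) % H.K + 1))

variable {H}

theorem vt_digit_lt {d : ℕ} (hd : d < H.s * H.K + 1) (h0 : d ≠ 0) :
    H.vt ((d - 1) / H.K) < H.n :=
  H.vt_lt _ ((Nat.div_lt_iff_lt_mul H.K_pos).2 (by omega))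

/-- Vanishing beyond `n` is recorded because `clear` resets only the first `n` entries before the
next code is decoded. -/
theorem dec_spec {k c : ℕ} {D : ℕ → ℕ} (hD : ∀ w, D w ≤ H.K) (h0 : ∀ w, H.n ≤ w → D w = 0) :
    (∀ w, H.dec k c D w ≤ H.K) ∧ ∀ w, H.n ≤ w → H.dec k c D w = 0 := by
  induction k generalizing c D with
  | zero => exact ⟨hD, h0⟩
  | succ k ih =>
    rw [dec]
    split
    · exact ih hD h0
    · next hc =>
      have h1 := vt_digit_lt (H := H) (Nat.mod_lt c (by omega)) hc
      exact ih (Net.update_le hD (Nat.mod_lt _ H.K_pos) _) fun w hw => by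
        rw [Function.update_of_ne (by omega)]; exact h0 w hw

/-- Each vertex of the support lies in a hyperedge, so an incidence names it, and one digit in base
`s * K + 1` encodes incidence and price; digit 0 means no assignment. Naming vertices by incidences
keeps `n` out of the base. The arbitrary `D'` below the decoded values is needed for the induction.
-/
theorem exists_dec {k : ℕ} {D : ℕ → ℕ} (hD : ∀ w, D w ≤ H.K)
    (hinc : ∀ w, D w ≠ 0 → ∃ e, H.inc e w ≠ 0) (S : Finset ℕ) (hS : ∀ w, D w ≠ 0 → w ∈ S)
    (hk : S.card ≤ k) : ∃ c < (H.s * H.K + 1) ^ k, ∀ D' : ℕ → ℕ,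
      H.dec k c D' = fun w => if D w ≠ 0 then D w else D' w := by
  induction k generalizing D S with
  | zero =>
    have hS0 : S = ∅ := Finset.card_eq_zero.1 (by omega)
    have h0 : ∀ w, D w = 0 := fun w => by
      by_contra h
      simpa [hS0] using hS w h
    exact ⟨0, by simp, fun D' => by simp [dec, h0]⟩
  | succ k ih =>
    by_cases h0 : ∃ w, D w ≠ 0
    · obtain ⟨w, hw⟩ := h0
      obtain ⟨c, hc, hdec⟩ := ih (D := Function.update D w 0) (S := S.erase w)
        (fun w' => by
          by_cases h : w' = w
          · simp [h]
          · rw [Function.update_of_ne h]; exact hD w')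
        (fun w' hw' => by
          by_cases h : w' = w
          · simp [h] at hw'
          · rw [Function.update_of_ne h] at hw'; exact hinc w' hw')
        (fun w' hw' => by
          by_cases h : w' = w
          · simp [h] at hw'
          · rw [Function.update_of_ne h] at hw'; exact Finset.mem_erase.2 ⟨h, hS w' hw'⟩)
        (by rw [Finset.card_erase_of_mem (hS w hw)]; omega)
      obtain ⟨e, he⟩ := hinc w hw
      obtain ⟨q, hq, hqw⟩ := H.vt_surj e w he
      have hDw := hD w
      set b := H.s * H.K + 1
      have hd : q * H.K + (D w - 1) + 1 < b := by
        have := Nat.mul_le_mul_right H.K (Nat.succ_le_of_lt hq)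
        rw [Nat.succ_mul] at this
        omega
      -- The vertex `w` takes the lowest digit; the remaining support, encoded by `c`, is decoded
      -- afterwards and leaves `w` alone.
      refine ⟨b * c + (q * H.K + (D w - 1) + 1), ?_, fun D' => ?_⟩
      · rw [pow_succ]
        calc _ < b * c + b := by omega
          _ = (c + 1) * b := by ring
          _ ≤ _ := Nat.mul_le_mul_right _ hc
      · rw [dec, Nat.mul_add_mod, Nat.mod_eq_of_lt hd, if_neg (by omega),
          Nat.mul_add_div (by omega), Nat.div_eq_of_lt hd, add_zero, hdec]
        have h1 : (q * H.K + (D w - 1) + 1 - 1) / H.K = q := by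
          rw [Nat.add_sub_cancel, Nat.add_comm, Nat.add_mul_div_right _ _ H.K_pos,
            Nat.div_eq_of_lt (by omega), zero_add]
        have h2 : (q * H.K + (D w - 1) + 1 - 1) % H.K = D w - 1 := by
          rw [Nat.add_sub_cancel, Nat.add_comm, Nat.add_mul_mod_self_right,
            Nat.mod_eq_of_lt (by omega)]
        rw [h1, h2, hqw]
        funext w'
        by_cases h : w' = w
        · subst h
          simp [hw]
          omega
        · simp [h]
    · push Not at h0
      obtain ⟨c, hc, hdec⟩ := ih (D := D) (S := ∅) hD hinc (fun w hw => absurd (h0 w) hw) (by simp)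
      refine ⟨0, by positivity, fun D' => ?_⟩
      have hz : ∀ k, H.dec k 0 D' = D' := by
        intro k
        induction k with
        | zero => rfl
        | succ k ih => rw [dec]; simpa using ih
      rw [hz]
      simp [h0]

theorem run_clear (h : s.v 0 = H.n) (h0 : ∀ w, H.n ≤ w → s.arr 1 w = 0) :
    (Alg.clear.run s).arr 1 = fun _ => 0 := by
  have key : ∀ w, (w < H.n ∨ s.arr 1 w = 0) → (Alg.clear.run s).arr 1 w = 0 := by
    refine Stm.loop_inv (N := H.n) (fun i t => ∀ w, (w < i ∨ s.arr 1 w = 0) → t.arr 1 w = 0)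
      (by simp [h]) (by simp) ?_
    intro i t hi hF hInv w hw
    simp only [Stm.run, Ex.eval, Store.setA_arr_apply, Store.setV_arr, Store.setV_v, if_true,
      true_and]
    split
    · rfl
    · exact hInv w (hw.imp_left (by omega))
  funext w
  exact key w (by have := h0 w; omega)

theorem run_decode (h : H.Holds s) {c : ℕ} (hc : s.v 29 = c) (h0 : ∀ w, H.n ≤ w → s.arr 1 w = 0) :
    (Alg.decode.run s).arr 1 = H.dec H.k c (fun _ => 0) := by
  set s1 := Alg.clear.run s with hs1
  have hF1 := Stm.frame_run Alg.clear s
  have h1 : H.Holds s1 := h.run (by decide)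
  have hz := run_clear h.n h0
  set s2 := (Stm.set 31 (.var 29)).run s1 with hs2
  have h2 : H.Holds s2 := h1.run (by decide)
  have key := Stm.loop_inv (x := 33) (e := .var 2) (P := Alg.decodeDigit) (s := s2) (N := H.k)
    -- What the remaining digits would make of the current array never changes.
    (fun i t => H.dec (H.k - i) (t.v 31) (t.arr 1) = H.dec H.k c (fun _ => 0)) (by simp [h2.k]) ?_ ?_
  · rw [Nat.sub_self] at key
    exact key
  · simp only [Nat.sub_zero, s2, Stm.run, Ex.eval, Store.setV_v, if_true, Store.setV_arr]
    rw [hz, hF1.v 29 (by decide), hc]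
  · intro i t hi hF hInv
    have ht : H.Holds (t.setV 33 i) := (h2.frame hF (by decide)).setV (by norm_num) _
    have h13 := ht.base
    have h8 := ht.K
    have hvt := ht.vt
    simp only [Store.setV_v, Store.setV_arr] at h13 h8 hvt
    norm_num at h13 h8
    rw [← hInv]
    have hk : H.k - i = (H.k - (i + 1)) + 1 := by omega
    rw [hk, dec]
    have hlt := Nat.mod_lt (t.v 31 % (H.s * H.K + 1) - 1) H.K_pos
    have hmin : min ((t.v 31 % (H.s * H.K + 1) - 1) % H.K + 1) H.K =
      (t.v 31 % (H.s * H.K + 1) - 1) % H.K + 1 := min_eq_left hlt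
    by_cases hd : t.v 31 % (H.s * H.K + 1) = 0
    · simp [Alg.decodeDigit, Op.eval, h13, hd]
    · rw [if_neg hd]
      have harr : (Alg.decodeDigit.run (t.setV 33 i)).arr 1 =
          Function.update (t.arr 1) (H.vt ((t.v 31 % (H.s * H.K + 1) - 1) / H.K))
            ((t.v 31 % (H.s * H.K + 1) - 1) % H.K + 1) := by
        funext w
        simp [Alg.decodeDigit, Op.eval, h13, hd, h8, hvt, hmin, Function.update_apply]
      have hv : (Alg.decodeDigit.run (t.setV 33 i)).v 31 = t.v 31 / (H.s * H.K + 1) := by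
        simp [Alg.decodeDigit, Op.eval, h13, hd]
      rw [harr, hv]

/-- The invariant of the computation of the table. -/
structure TableInv (H : Plan) (κ : ℕ → ℕ) (i : ℕ) (t : Store) : Prop where
  zero : ∀ w, H.n ≤ w → t.arr 1 w = 0
  tab : ∀ j, t.arr 6 j < H.K
  best : ∀ z < H.n, t.arr 5 z < H.K
  complete : H.Complete κ i (t.arr 6)

theorem run_rows {κ : ℕ → ℕ} (hκ : Set.InjOn κ {w | w < H.n}) {i : ℕ} (h : H.Holds s) {D : ℕ → ℕ}
    (hD : ∀ w, D w ≤ H.K) (hD1 : s.arr 1 = D) (hI : H.TableInv κ i s) :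
    H.TableInv κ i ((Stm.loop 26 (.var 0) Alg.row).run s) ∧
      (∀ q, H.RowDone κ (i + 1) (s.arr 6) q →
        H.RowDone κ (i + 1) (((Stm.loop 26 (.var 0) Alg.row).run s).arr 6) q) ∧
      ∀ v < H.n, H.RowDone κ (i + 1) (((Stm.loop 26 (.var 0) Alg.row).run s).arr 6) (H.key D v) := by
  have key := Stm.loop_inv (x := 26) (e := .var 0) (P := Alg.row) (s := s) (N := H.n)
    (fun j t => t.arr 1 = D ∧ H.TableInv κ i t ∧
      (∀ q, H.RowDone κ (i + 1) (s.arr 6) q → H.RowDone κ (i + 1) (t.arr 6) q) ∧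
      ∀ v < j, H.RowDone κ (i + 1) (t.arr 6) (H.key D v)) (by simp [h.n])
      ⟨hD1, hI, fun _ => id, by simp⟩ ?_
  · exact key.2
  · rintro j t hj hF ⟨h1, hIt, hq, hv⟩
    have ht : H.Holds (t.setV 26 j) := (h.frame hF (by decide)).setV (by norm_num) _
    obtain ⟨r1, r2, r3, r4, r5, r6⟩ := run_row ht (D := D) (v := j) (by simp) hj hD h1 hIt.tab hIt.best
    obtain ⟨c1, c2, c3⟩ := hIt.complete.step hκ hD hj r4 r5 r6
    refine ⟨r1, ⟨by rw [r1, ← h1]; exact hIt.zero, r2, r3, c1⟩, fun q h => c2 q (hq q h),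
      fun v hv' => ?_⟩
    rcases Nat.lt_succ_iff_lt_or_eq.1 hv' with h | rfl
    · exact c2 _ (hv v h)
    · exact c3

/-- Round `i` raises the size of the components with correct rows from `i` to `i + 1`. Every
admissible boundary has at most `k` vertices, so its prices occur among the codes. -/
theorem run_table {κ : ℕ → ℕ} (hκ : Set.InjOn κ {w | w < H.n})
    (hk : ∀ D v, H.Adm κ D v →
      ((Finset.range H.n).filter fun w => H.Reach D v w ∧ D w ≠ 0).card ≤ H.k)
    (h : H.Holds s) (h0 : H.TableInv κ 0 s) : H.TableInv κ H.n (Alg.table.run s) := by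
  refine Stm.loop_inv (N := H.n) (fun i t => H.TableInv κ i t) (by simp [h.n]) h0 ?_
  intro i t hi hF hI
  have ht : H.Holds (t.setV 30 i) := (h.frame hF (by decide)).setV (by norm_num) _
  have key := Stm.loop_inv (x := 29) (e := .var 9)
    (P := .seq Alg.decode (.loop 26 (.var 0) Alg.row)) (s := t.setV 30 i)
    (N := (H.s * H.K + 1) ^ H.k) (fun j t => H.TableInv κ i t ∧
      ∀ c < j, ∀ v < H.n, H.RowDone κ (i + 1) (t.arr 6) (H.key (H.dec H.k c fun _ => 0) v))
    (by have := ht.T; simpa using this) ⟨⟨hI.zero, hI.tab, hI.best, hI.complete⟩, by simp⟩ ?_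
  · refine ⟨key.1.zero, key.1.tab, key.1.best, fun D v hadm hc => ?_⟩
    -- `D` may assign vertices away from the component. Forgetting these changes neither component
    -- nor key and leaves at most `k` assigned vertices.
    have hR : ∀ w, H.Reach (fun w => if H.Reach D v w then D w else 0) v w ↔ H.Reach D v w :=
      Net.reach_congr fun w hw => if_pos hw
    have hkey : H.key (fun w => if H.Reach D v w then D w else 0) v = H.key D v :=
      Net.key_congr hR fun w hw => if_pos hw
    obtain ⟨c, hc', hdec⟩ := exists_dec (H := H) (k := H.k)
      (D := fun w => if H.Reach D v w then D w else 0)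
      (fun w => by
        have := hadm.le w
        split <;> omega)
      (fun w hw => by
        by_cases hr : H.Reach D v w
        · cases hr with
          | base => simp [hadm.zero] at hw
          | step _ _ _ h2 => exact ⟨_, h2⟩
        · simp [hr] at hw)
      ((Finset.range H.n).filter fun w => H.Reach D v w ∧ D w ≠ 0)
      (fun w hw => by
        by_cases hr : H.Reach D v w
        · simp only [hr, if_true] at hw
          simp [hr, hw, hr.lt hadm.lt]
        · simp [hr] at hw)
      (hk D v hadm)
    refine key.2 c hc' v hadm.lt D v hadm hc ?_
    rw [← hkey, hdec]
    congr 1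
    funext w
    simp
  · rintro c t' hc hF' ⟨hI', hdone⟩
    have ht' : H.Holds (t'.setV 29 c) := (ht.frame hF' (by decide)).setV (by norm_num) _
    have hdec := run_decode ht' (c := c) (by simp) hI'.zero
    rw [Stm.run_seq]
    have hFd := Stm.frame_run Alg.decode (t'.setV 29 c)
    set t1 := Alg.decode.run (t'.setV 29 c) with ht1
    obtain ⟨hs1, hs2⟩ := dec_spec (H := H) (k := H.k) (c := c) (D := fun _ => 0)
      (fun _ => Nat.zero_le _) fun _ _ => rfl
    have h6 : t1.arr 6 = t'.arr 6 := hFd.arr 6 (by decide)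
    have h5 : t1.arr 5 = t'.arr 5 := hFd.arr 5 (by decide)
    have hr := run_rows hκ (s := t1) (i := i) (ht'.run (by decide)) hs1 hdec
      ⟨by rw [hdec]; exact hs2, by rw [h6]; exact hI'.tab, by rw [h5]; exact hI'.best,
        by rw [h6]; exact hI'.complete⟩
    refine ⟨hr.1, fun c' hc' v hv => ?_⟩
    rcases Nat.lt_succ_iff_lt_or_eq.1 hc' with h | rfl
    · exact hr.2.1 _ (by rw [h6]; exact hdone c' h v hv)
    · exact hr.2.2 v hv

/-- The program finds an assignment of maximum revenue. -/
theorem run_optimum {κ : ℕ → ℕ} (hκ : Set.InjOn κ {w | w < H.n})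
    (hk : ∀ D v, H.Adm κ D v →
      ((Finset.range H.n).filter fun w => H.Reach D v w ∧ D w ≠ 0).card ≤ H.k)
    (h : H.Holds s) (h1 : s.arr 1 = fun _ => 0) (h5 : s.arr 5 = fun _ => 0)
    (h6 : s.arr 6 = fun _ => 0) :
    (∀ z < H.n, (Alg.optimum.run s).arr 4 z < H.K) ∧
      ∀ E : ℕ → ℕ, (∀ z < H.n, E z < H.K) → H.val E ≤ H.val ((Alg.optimum.run s).arr 4) := by
  have h0 : H.TableInv κ 0 s := by
    refine ⟨by simp [h1], by simp [h6, H.K_pos], by simp [h5, H.K_pos], fun D v hadm hc => ?_⟩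
    -- Initially there is nothing to show: an admissible component contains its own vertex and is
    -- not empty.
    have : v ∈ (Finset.range H.n).filter (H.Comp D v) := by
      simp [hadm.lt, Net.Comp, hadm.zero, Net.Reach.base]
    rw [Net.csize, Nat.le_zero, Finset.card_eq_zero] at hc
    simp [hc] at this
  have hT := run_table hκ hk h h0
  have hH : H.Holds (Alg.table.run s) := h.run (by decide)
  set s1 := Alg.table.run s
  have hz := run_clear hH.n hT.zero
  have hF2 := Stm.frame_run Alg.clear s1
  have hH2 : H.Holds (Alg.clear.run s1) := hH.run (by decide)
  set s2 := Alg.clear.run s1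
  set P3 : Stm := .loop 21 (.var 0) (.put 3 (.var 21) (.lit 1))
  have hF3 := Stm.frame_run P3 s2
  have hH3 : H.Holds (P3.run s2) := hH2.run (by decide)
  have h3 : ∀ z < H.n, (P3.run s2).arr 3 z = 1 := by
    refine Stm.loop_inv (fun i t => ∀ z < i, t.arr 3 z = 1) (by simp [hH2.n]) (by simp) ?_
    intro i t hi hF hInv z hz
    simp only [Stm.run, Ex.eval, Store.setA_arr_apply, Store.setV_arr, Store.setV_v, if_true,
      true_and]
    split
    · rfl
    · exact hInv z (by omega)
  have hD : (P3.run s2).arr 1 = fun _ => 0 := (hF3.arr 1 (by decide)).trans hz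
  have h6 : (P3.run s2).arr 6 = s1.arr 6 :=
    (hF3.arr 6 (by decide)).trans (hF2.arr 6 (by decide))
  have hfill := run_fill hH3 (R := fun _ => True) (by simp [hD]) (by simpa using h3)
  rw [hD, h6] at hfill
  have hrun : Alg.optimum.run s = Alg.fill.run (P3.run s2) := rfl
  rw [hrun]
  have hfill' : ∀ z < H.n, (Alg.fill.run (P3.run s2)).arr 4 z =
      s1.arr 6 (H.key (fun _ => 0) z * H.n + z) := fun z hz => by
    rw [hfill z hz, Net.fill, if_pos ⟨trivial, rfl⟩]
  refine ⟨fun z hz => ?_, fun E hE => ?_⟩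
  · rw [hfill' z hz]; exact hT.tab _
  · rw [Net.val_congr hfill']
    exact hT.complete.val_le hE

end Plan

/-! ### Rounding -/

section Rounding

variable {n m : ℕ}

/-- The incidence matrix. -/
def Instance.incid (I : Instance n m) (e v : ℕ) : ℕ :=
  if h : e < m ∧ v < n then (if ⟨v, h.2⟩ ∈ I.bundle ⟨e, h.1⟩ then 1 else 0) else 0

/-- The discretized instance for given candidate prices. -/
def Instance.net (I : Instance n m) (K : ℕ) (hK : 0 < K) (cand : ℕ → ℕ) : Net where
  n := n
  m := m
  K := K
  inc := I.incid
  cand := cand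
  inc_lt e v h := by
    by_contra hc
    simp [Instance.incid, hc] at h
  inc_le e v := by
    rw [Instance.incid]
    split
    · split <;> simp
    · simp
  K_pos := hK

variable {I : Instance n m} {K : ℕ} {hK : 0 < K} {cand : ℕ → ℕ}

@[simp] theorem Instance.incid_coe (e : Fin m) (v : Fin n) :
    I.incid e v = if v ∈ I.bundle e then 1 else 0 := by
  simp [Instance.incid]

theorem Instance.net_sum (E : ℕ → ℕ) (e : Fin m) :
    (I.net K hK cand).sum E e = ∑ v ∈ I.bundle e, cand (E v) := by
  show ∑ w ∈ Finset.range n, I.incid e w * cand (E w) = _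
  rw [← Fin.sum_univ_eq_sum_range (fun w => I.incid e w * cand (E w)) n]
  simp only [Instance.incid_coe, ite_mul, one_mul, zero_mul]
  rw [Finset.sum_ite_mem, Finset.univ_inter]

theorem Instance.net_val (E : ℕ → ℕ) : (I.net K hK cand).val E =
    ∑ e : Fin m, if ∑ v ∈ I.bundle e, cand (E v) ≤ cand e then ∑ v ∈ I.bundle e, cand (E v)
      else 0 := by
  show ∑ e ∈ Finset.range m, (I.net K hK cand).rev E e = _
  rw [← Fin.sum_univ_eq_sum_range ((I.net K hK cand).rev E) m]
  refine Finset.sum_congr rfl fun e _ => ?_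
  rw [Net.rev, Instance.net_sum]
  rfl

/-- `a / b` is the largest budget of a consumer with a nonempty bundle (or zero). -/
structure Instance.IsMaxBudget (I : Instance n m) (a b : ℕ) : Prop where
  pos : 0 < b
  le : ∀ e, (I.bundle e).Nonempty → (I.budget e).num * b ≤ a * (I.budget e).den
  mem : a = 0 ∨ ∃ e, (I.bundle e).Nonempty ∧ a = (I.budget e).num ∧ b = (I.budget e).den

/-- The candidate prices are the rounded budgets, followed by `0, …, g - 1`. -/
structure Instance.IsCand (I : Instance n m) (N a b g : ℕ) (cand : ℕ → ℕ) : Prop where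
  budget : ∀ e : Fin m, cand e =
    min (N * (I.budget e).num * b / ((I.budget e).den * a)) N
  grid : ∀ j < g, cand (m + j) = j
  size : g = N + 1 ∨ (g = 1 ∧ ∀ e, (I.bundle e).card ≤ 1)

theorem budget_eq (q : ℚ≥0) : (q : ℝ) = (q.num : ℝ) / (q.den : ℝ) := by
  rw [NNRat.cast_def]

theorem Instance.revenue_nonneg {p : Fin n → ℝ} (hp : ∀ v, 0 ≤ p v) : 0 ≤ I.revenue p :=
  Finset.sum_nonneg fun e _ => by
    split
    · exact Finset.sum_nonneg fun v _ => hp v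
    · exact le_rfl

/-- A consumer with a nonempty bundle can afford a number of grid units iff it does not exceed her
rounded budget. -/
theorem Instance.IsCand.le_iff {N a b g : ℕ} (hc : I.IsCand N a b g cand)
    (hmax : I.IsMaxBudget a b) (ha : 0 < a) (hN : 0 < N) {e : Fin m}
    (he : (I.bundle e).Nonempty) (x : ℕ) :
    x ≤ cand e ↔ (x : ℝ) * ((a : ℝ) / (N * b)) ≤ (I.budget e : ℝ) := by
  have hd : 0 < (I.budget e).den := (I.budget e).den_pos
  have hb := hmax.pos
  have hle : N * (I.budget e).num * b / ((I.budget e).den * a) ≤ N := by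
    refine Nat.div_le_of_le_mul ?_
    have := Nat.mul_le_mul_left N (hmax.le e he)
    calc _ = N * ((I.budget e).num * b) := by ring
      _ ≤ _ := this
      _ = _ := by ring
  rw [hc.budget, min_eq_left hle, Nat.le_div_iff_mul_le (by positivity), budget_eq,
    ← mul_div_assoc, div_le_div_iff₀ (by positivity) (by positivity)]
  rw [show (x : ℝ) * a * ((I.budget e).den : ℝ) = ((x * ((I.budget e).den * a) : ℕ) : ℝ) by
      push_cast; ring,
    show ((I.budget e).num : ℝ) * (N * b) = ((N * (I.budget e).num * b : ℕ) : ℝ) by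
      push_cast; ring]
  exact Nat.cast_le.symm

/-- Rounding down preserves affordability and costs less than one unit per product. The cutoff at
`N` affects only prices above the largest budget, and products with such prices occur in no bundle
that is sold. -/
theorem Instance.IsCand.exists_rounding {N a b g : ℕ} (hc : I.IsCand N a b g cand)
    (hmax : I.IsMaxBudget a b) (ha : 0 < a) (hN : 0 < N) {q : Fin n → ℝ} (hq : ∀ v, 0 ≤ q v) :
    ∃ E : ℕ → ℕ, (∀ z, E z < m + g) ∧ ∀ e, ∑ v ∈ I.bundle e, q v ≤ (I.budget e : ℝ) →
      ∑ v ∈ I.bundle e, cand (E v) ≤ cand e ∧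
      ∑ v ∈ I.bundle e, q v ≤ (a : ℝ) / (N * b) *
        ((∑ v ∈ I.bundle e, cand (E v) : ℕ) + (I.bundle e).card) := by
  have hb := hmax.pos
  set c : ℝ := (a : ℝ) / (N * b) with hcdef
  have hcpos : 0 < c := by positivity
  set p : Fin n → ℕ := fun v => min ⌊q v / c⌋₊ N
  have hpq : ∀ v, (p v : ℝ) * c ≤ q v := by
    intro v
    have h1 : (p v : ℝ) ≤ q v / c :=
      (Nat.cast_le.2 (min_le_left _ _)).trans (Nat.floor_le (div_nonneg (hq v) hcpos.le))
    rwa [le_div_iff₀ hcpos] at h1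
  have hsum : ∀ e, (I.bundle e).Nonempty → ∑ v ∈ I.bundle e, q v ≤ (I.budget e : ℝ) →
      ∑ v ∈ I.bundle e, p v ≤ cand e := by
    intro e he h
    rw [hc.le_iff hmax ha hN he]
    push_cast
    rw [Finset.sum_mul]
    exact (Finset.sum_le_sum fun v _ => hpq v).trans h
  have hqp : ∀ e, ∑ v ∈ I.bundle e, q v ≤ (I.budget e : ℝ) → ∀ v ∈ I.bundle e,
      q v ≤ c * (p v + 1) := by
    intro e h v hv
    have h1 : q v ≤ (I.budget e : ℝ) :=
      (Finset.single_le_sum (fun v _ => hq v) hv).trans h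
    have h2 : (I.budget e : ℝ) ≤ c * N := by
      have := hmax.le e ⟨v, hv⟩
      have hd : 0 < (I.budget e).den := (I.budget e).den_pos
      rw [budget_eq, hcdef, div_mul_eq_mul_div, div_le_div_iff₀ (by positivity) (by positivity)]
      have h3 : (((I.budget e).num * b : ℕ) : ℝ) ≤ ((a * (I.budget e).den : ℕ) : ℝ) :=
        Nat.cast_le.2 this
      push_cast at h3
      nlinarith [(Nat.cast_pos (α := ℝ)).2 hN]
    have h3 : q v / c ≤ N := by
      rw [div_le_iff₀ hcpos]; linarith
    have h4 : p v = ⌊q v / c⌋₊ := min_eq_left (Nat.floor_le_of_le h3)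
    have h5 := (Nat.lt_floor_add_one (q v / c)).le
    rw [div_le_iff₀ hcpos] at h5
    rw [h4]; linarith
  -- Both kinds of candidate sets reduce to this: it suffices that candidate prices are at least the
  -- rounded ones and that sold bundles stay affordable.
  have main : ∀ E : ℕ → ℕ, (∀ e, ∑ v ∈ I.bundle e, q v ≤ (I.budget e : ℝ) →
      (I.bundle e).Nonempty → ∑ v ∈ I.bundle e, cand (E v) ≤ cand e ∧
      ∀ v ∈ I.bundle e, p v ≤ cand (E v)) →
      ∀ e, ∑ v ∈ I.bundle e, q v ≤ (I.budget e : ℝ) →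
      ∑ v ∈ I.bundle e, cand (E v) ≤ cand e ∧
      ∑ v ∈ I.bundle e, q v ≤ c *
        ((∑ v ∈ I.bundle e, cand (E v) : ℕ) + (I.bundle e).card) := by
    intro E hE e h
    rcases (I.bundle e).eq_empty_or_nonempty with he | he
    · simp [he]
    · obtain ⟨h1, h2⟩ := hE e h he
      refine ⟨h1, ?_⟩
      calc ∑ v ∈ I.bundle e, q v ≤ ∑ v ∈ I.bundle e, c * ((cand (E v) : ℝ) + 1) := by
            refine Finset.sum_le_sum fun v hv => (hqp e h v hv).trans ?_
            have : (p v : ℝ) ≤ cand (E v) := Nat.cast_le.2 (h2 v hv)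
            gcongr
        _ = _ := by
            rw [← Finset.mul_sum, Finset.sum_add_distrib]
            simp
  rcases hc.size with hg | ⟨hg, hcard⟩
  · have hcE : ∀ v : Fin n, cand (m + p v) = p v := fun v =>
      hc.grid _ (by have : p v ≤ N := min_le_right _ _; omega)
    refine ⟨fun z => if h : z < n then m + p ⟨z, h⟩ else m, fun z => ?_,
      main (fun z => if h : z < n then m + p ⟨z, h⟩ else m) fun e h he => ?_⟩
    · dsimp only
      split
      · have : ∀ v, p v ≤ N := fun v => min_le_right _ _
        have := this ⟨z, by assumption⟩
        omega
      · omega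
    · simp only [Fin.is_lt, dite_true, Fin.eta, hcE]
      exact ⟨hsum e he h, fun _ _ => le_rfl⟩
  -- With singleton bundles, raise the rounded price of `v` to the smallest rounded budget above it
  -- among the consumers of `v`; everyone who could afford `v` still can.
  · have hch : ∀ v : Fin n, ∃ j < m + g, ∀ e, v ∈ I.bundle e → p v ≤ cand e →
        p v ≤ cand j ∧ cand j ≤ cand e := by
      intro v
      by_cases hex : ∃ e, v ∈ I.bundle e ∧ p v ≤ cand e
      · obtain ⟨j, hj, hmin⟩ := Finset.exists_min_image
          (Finset.univ.filter fun e : Fin m => v ∈ I.bundle e ∧ p v ≤ cand e) (fun e => cand e)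
          (by obtain ⟨e, he⟩ := hex; exact ⟨e, by simpa using he⟩)
        simp only [Finset.mem_filter, Finset.mem_univ, true_and] at hj hmin
        exact ⟨j, by omega, fun e h1 h2 => ⟨hj.2, hmin e ⟨h1, h2⟩⟩⟩
      · push Not at hex
        exact ⟨m, by omega, fun e h1 h2 => absurd h2 (by have := hex e h1; omega)⟩
    choose J hJ hJ' using hch
    refine ⟨fun z => if h : z < n then J ⟨z, h⟩ else m, fun z => ?_,
      main (fun z => if h : z < n then J ⟨z, h⟩ else m) fun e h he => ?_⟩
    · dsimp only
      split
      · exact hJ _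
      · omega
    · obtain ⟨v, hv⟩ := Finset.card_eq_one.1 (le_antisymm (hcard e) he.card_pos)
      have h1 := hsum e he h
      rw [hv, Finset.sum_singleton] at h1
      have h2 := hJ' v e (by simp [hv]) h1
      rw [hv]
      simp [h2]

/-- An optimal assignment of candidate prices is an approximate solution. -/
theorem Instance.IsCand.isApproxSolution {N a b g : ℕ} {ε : ℚ≥0} (hc : I.IsCand N a b g cand)
    (hmax : I.IsMaxBudget a b) (hN : 0 < N) (hs : (∑ e, (I.bundle e).card : ℕ) ≤ (ε : ℝ) * N)
    (hKg : K = m + g) {E : ℕ → ℕ}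
    (hopt : ∀ E' : ℕ → ℕ, (∀ z < n, E' z < K) →
      (I.net K hK cand).val E' ≤ (I.net K hK cand).val E) :
    I.IsApproxSolution (1 + (ε : ℝ)) fun v => ((cand (E v) * a : ℕ) : ℝ) / ((N * b : ℕ) : ℝ) := by
  have hε : (0 : ℝ) ≤ (ε : ℝ) := NNRat.cast_nonneg ε
  refine ⟨fun v => by positivity, fun q hq => ?_⟩
  rcases Nat.eq_zero_or_pos a with ha | ha
  -- If the largest budget is 0, no nonnegative prices earn anything.
  · have h0 : I.revenue q ≤ 0 := by
      refine Finset.sum_nonpos fun e _ => ?_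
      split
      · next h =>
        rcases (I.bundle e).eq_empty_or_nonempty with he | he
        · simp [he]
        · have := hmax.le e he
          have hb := hmax.pos
          have hnum : (I.budget e).num = 0 := by
            rw [ha, zero_mul] at this
            rcases Nat.mul_eq_zero.1 (Nat.le_zero.1 this) with h | h <;> omega
          rwa [budget_eq, hnum, Nat.cast_zero, zero_div] at h
      · exact le_rfl
    exact h0.trans (mul_nonneg (by linarith) (I.revenue_nonneg fun v => by positivity))
  · have hb := hmax.pos
    set c : ℝ := (a : ℝ) / (N * b) with hcdef
    have hcpos : 0 < c := by positivity
    have hprice : ∀ v : Fin n, ((cand (E v) * a : ℕ) : ℝ) / ((N * b : ℕ) : ℝ) = cand (E v) * c := by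
      intro v; push_cast; rw [hcdef]; ring
    have hrev : I.revenue (fun v => ((cand (E v) * a : ℕ) : ℝ) / ((N * b : ℕ) : ℝ)) =
        c * ((I.net K hK cand).val E : ℕ) := by
      rw [Instance.net_val, Instance.revenue]
      push_cast
      rw [Finset.mul_sum]
      refine Finset.sum_congr rfl fun e _ => ?_
      have h1 : ∑ v ∈ I.bundle e, (cand (E v) : ℝ) * a / (N * b) =
          ((∑ v ∈ I.bundle e, cand (E v) : ℕ) : ℝ) * c := by
        push_cast
        rw [Finset.sum_mul]
        exact Finset.sum_congr rfl fun v _ => by rw [hcdef]; ring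
      rw [h1]
      rcases (I.bundle e).eq_empty_or_nonempty with he | he
      · simp [he]
      · have h2 := hc.le_iff hmax ha hN he (∑ v ∈ I.bundle e, cand (E v))
        by_cases h3 : ∑ v ∈ I.bundle e, cand (E v) ≤ cand e
        · rw [if_pos h3, if_pos (h2.1 h3)]; push_cast; ring
        · rw [if_neg h3, if_neg (mt h2.2 h3)]; simp
    -- The consumer `e0` with the largest budget has rounded budget exactly `N`. Charge her budget
    -- for `v0`, and candidate number `m`, which is the grid price 0, for everything else.
    have hbig : N ≤ (I.net K hK cand).val E := by
      obtain ⟨e0, ⟨v0, hv0⟩, hea, heb⟩ := hmax.mem.resolve_left (by omega)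
      have hce : cand e0 = N := by
        have : N * (I.budget e0).num * b / ((I.budget e0).den * a) = N := by
          rw [← hea, ← heb, mul_assoc, mul_comm b a]
          exact Nat.mul_div_cancel _ (by positivity)
        rw [hc.budget, this, min_self]
      have hg : 0 < g := by rcases hc.size with h | h <;> omega
      have hcm : cand m = 0 := hc.grid 0 hg
      refine le_trans ?_ (hopt (fun z => if z = v0 then e0 else m) fun z _ => ?_)
      · rw [Instance.net_val]
        have hsum : ∑ v ∈ I.bundle e0, cand (if (v : ℕ) = v0 then (e0 : ℕ) else m) = N := by
          rw [Finset.sum_eq_single v0]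
          · simp [hce]
          · intro v _ hv
            rw [if_neg fun h => hv (Fin.ext h), hcm]
          · exact fun h => absurd hv0 h
        refine le_trans (le_of_eq ?_) (Finset.single_le_sum
          (fun e _ => Nat.zero_le _) (Finset.mem_univ e0))
        simp only [hsum, hce, le_refl, if_true]
      · split <;> omega
    obtain ⟨E', hE', hround⟩ := hc.exists_rounding hmax ha hN hq
    have hle := hopt E' fun z _ => by rw [hKg]; exact hE' z
    have hq' : I.revenue q ≤ c * ((I.net K hK cand).val E' + (∑ e, (I.bundle e).card : ℕ)) := by
      rw [Instance.net_val, Instance.revenue]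
      push_cast
      rw [← Finset.sum_add_distrib, Finset.mul_sum]
      refine Finset.sum_le_sum fun e _ => ?_
      split
      · next h =>
        obtain ⟨h1, h2⟩ := hround e h
        rw [if_pos h1]
        push_cast at h2
        exact h2
      · positivity
    rw [hrev]
    have h1 : (N : ℝ) ≤ ((I.net K hK cand).val E : ℕ) := Nat.cast_le.2 hbig
    have h2 : ((I.net K hK cand).val E' : ℝ) ≤ ((I.net K hK cand).val E : ℕ) := Nat.cast_le.2 hle
    calc I.revenue q ≤ _ := hq'
      -- The rounding loss is at most `ε * N` units, and `N` is at most the optimal revenue in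
      -- units.
      _ ≤ c * (((I.net K hK cand).val E : ℕ) + ε * ((I.net K hK cand).val E : ℕ)) := by
        refine mul_le_mul_of_nonneg_left ?_ hcpos.le
        nlinarith
      _ = _ := by ring

end Rounding

/-! ### The complete program: input, rounding parameters, powers and output. -/

namespace Alg

/-- Read the size of the instance. -/
def init : Stm := .seq (.set 0 (.inp (.lit 0))) (.seq (.set 1 (.inp (.lit 1))) (.set 14 (.lit 1)))

/-- Read the parameters. -/
def params : Stm :=
  .seq (.set 2 (.cap (.inp (.lit 2)) (.var 0))) (.seq (.set 3 (.inp (.lit 3)))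
    (.seq (.set 4 (.inp (.lit 4))) (.seq (.set 5 (.lit 0))
      (.seq (.set 10 (.lit 0)) (.set 11 (.lit 1))))))

/-- The numerator of the current budget. -/
def numE : Ex := .inp (.op .add (.lit 5) (.op .mul (.lit 2) (.var 20)))

/-- The denominator of the current budget. -/
def denE : Ex := .inp (.op .add (.lit 6) (.op .mul (.lit 2) (.var 20)))

/-- List the vertices of the current bundle. -/
def incidences : Stm :=
  .loop 21 (.var 0) (.ite incE (.seq (.put 8 (.var 5) (.var 21))
    (.seq (.set 5 (.cap (.op .add (.var 5) (.lit 1)) (.op .mul (.var 0) (.var 1))))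
      (.set 22 (.lit 1)))) .skip)

/-- List the incidences and find the largest budget. -/
def scan : Stm :=
  .loop 20 (.var 1) (.seq (.set 22 (.lit 0)) (.seq incidences
    (.ite (.op .mul (.var 22) (.op .lt (.op .mul (.var 10) denE) (.op .mul numE (.var 11))))
      (.seq (.set 10 numE) (.set 11 denE)) .skip)))

/-- Compute the size of the grid and the number of candidate prices. -/
def sizes : Stm :=
  .seq (.set 6 (.op .add (.op .div (.op .mul (.var 5) (.var 4)) (.var 3)) (.lit 1)))
    (.seq (.ite (.var 2) (.set 7 (.op .add (.var 6) (.lit 1))) (.set 7 (.lit 1)))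
      (.seq (.set 8 (.op .add (.var 1) (.var 7)))
        (.seq (.set 13 (.op .add (.op .mul (.var 5) (.var 8)) (.lit 1)))
          (.seq (.set 15 (.op .add (.var 8) (.lit 2)))
            (.seq (.set 9 (.lit 1)) (.set 12 (.lit 1)))))))

/-- Multiply the variable `x` by the power of `z` with exponent `y`. -/
def power (x y z : ℕ) : Stm := .loop 23 (.var y) (.set x (.op .mul (.var x) (.var z)))

/-- Compute the candidate prices. -/
def prices : Stm :=
  .seq (.loop 20 (.var 1) (.put 7 (.var 20) (.cap (.op .div
      (.op .mul (.op .mul (.var 6) numE) (.var 11)) (.op .mul denE (.var 10))) (.var 6))))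
    (.loop 28 (.var 7) (.put 7 (.op .add (.var 1) (.var 28)) (.var 28)))

/-- Compute the numerators and the denominator of the prices. -/
def finish : Stm :=
  .seq (.loop 21 (.var 0) (.put 9 (.var 21) (.op .mul (.get 7 (.get 4 (.var 21))) (.var 10))))
    (.set 14 (.op .mul (.var 6) (.var 11)))

/-- Write the output. -/
def output : Stm :=
  .loop 21 (.var 0) (.seq (.out (.op .mul (.lit 2) (.var 21)) (.get 9 (.var 21)))
    (.out (.op .add (.op .mul (.lit 2) (.var 21)) (.lit 1)) (.var 14)))

/-- The preparations for the dynamic program. -/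
def prepare : Stm := .seq params (.seq scan sizes)

/-- The algorithm for instances with at least one consumer. -/
def main : Stm :=
  .seq prepare (.seq (.seq (power 9 2 13) (power 12 0 15)) (.seq prices (.seq optimum finish)))

/-- The algorithm. -/
def program : Stm := .seq init (.seq (.ite (.var 1) main .skip) output)

end Alg

/-- The input cells contain an instance. -/
structure Store.Holds (s : Store) (n m k num den : ℕ) (inc : ℕ → ℕ → ℕ) (a b : ℕ → ℕ) : Prop where
  eq_n : s.low 0 = n
  eq_m : s.low 1 = m
  eq_k : s.low 2 = k
  eq_num : s.low 3 = num
  eq_den : s.low 4 = den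
  eq_a : ∀ e < m, s.low (5 + 2 * e) = a e
  eq_b : ∀ e < m, s.low (6 + 2 * e) = b e
  eq_inc : ∀ e < m, ∀ w < n, s.low (5 + 2 * m + (e * n + w)) = inc e w

theorem Store.Holds.congr {s t : Store} {n m k num den : ℕ} {inc : ℕ → ℕ → ℕ} {a b : ℕ → ℕ}
    (h : s.Holds n m k num den inc a b) (ht : t.low = s.low) : t.Holds n m k num den inc a b := by
  constructor <;> rw [ht]
  exacts [h.eq_n, h.eq_m, h.eq_k, h.eq_num, h.eq_den, h.eq_a, h.eq_b, h.eq_inc]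

namespace Alg

section

variable {s : Store} {n m k num den : ℕ} {inc : ℕ → ℕ → ℕ} {a b : ℕ → ℕ}

theorem eval_incE (h : s.Holds n m k num den inc a b) {e w : ℕ} (h0 : s.v 0 = n) (h1 : s.v 1 = m)
    (he : s.v 20 = e) (hw : s.v 21 = w) (hem : e < m) (hwn : w < n) : incE.eval s = inc e w := by
  simp [incE, Op.eval, he, hw, h0, h1, h.eq_inc e hem w hwn]

theorem eval_numE (h : s.Holds n m k num den inc a b) {e : ℕ} (he : s.v 20 = e) (hem : e < m) :
    numE.eval s = a e := by
  simp [numE, Op.eval, he, h.eq_a e hem]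

theorem eval_denE (h : s.Holds n m k num den inc a b) {e : ℕ} (he : s.v 20 = e) (hem : e < m) :
    denE.eval s = b e := by
  simp [denE, Op.eval, he, h.eq_b e hem]

/-- The number of incidences with the first `e` hyperedges. -/
def degSum (inc : ℕ → ℕ → ℕ) (n e : ℕ) : ℕ :=
  ∑ e' ∈ Finset.range e, ∑ w ∈ Finset.range n, if inc e' w ≠ 0 then 1 else 0

theorem degSum_le (inc : ℕ → ℕ → ℕ) (n e : ℕ) : degSum inc n e ≤ e * n := by
  refine (Finset.sum_le_card_nsmul _ _ n fun e' _ => ?_).trans (by simp)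
  refine (Finset.sum_le_card_nsmul _ _ 1 fun w _ => ?_).trans (by simp)
  split <;> omega

theorem run_incidences (h : s.Holds n m k num den inc a b) (h0 : s.v 0 = n) (h1 : s.v 1 = m)
    {e : ℕ} (he : s.v 20 = e) (hem : e < m) (h22 : s.v 22 = 0) (h5 : s.v 5 = degSum inc n e) :
    let t := incidences.run s
    t.v 5 = degSum inc n (e + 1) ∧ (∀ q < s.v 5, t.arr 8 q = s.arr 8 q) ∧
      (∀ q, s.v 5 ≤ q → q < t.v 5 → t.arr 8 q < n) ∧
      (∀ w < n, inc e w ≠ 0 → ∃ q < t.v 5, t.arr 8 q = w) ∧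
      (t.v 22 ≠ 0 ↔ ∃ w < n, inc e w ≠ 0) := by
  have key := Stm.loop_inv (x := 21) (e := .var 0) (P := .ite incE (.seq (.put 8 (.var 5) (.var 21))
    (.seq (.set 5 (.cap (.op .add (.var 5) (.lit 1)) (.op .mul (.var 0) (.var 1))))
      (.set 22 (.lit 1)))) .skip) (s := s) (N := n)
    (fun i t => t.v 5 = degSum inc n e +
        (∑ w ∈ Finset.range i, if inc e w ≠ 0 then 1 else 0) ∧
      (∀ q < s.v 5, t.arr 8 q = s.arr 8 q) ∧
      (∀ q, s.v 5 ≤ q → q < t.v 5 → t.arr 8 q < n) ∧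
      (∀ w < i, inc e w ≠ 0 → ∃ q < t.v 5, t.arr 8 q = w) ∧
      (t.v 22 ≠ 0 ↔ ∃ w < i, inc e w ≠ 0)) (by simp [h0])
    ⟨by simp [h5], fun _ _ => rfl, fun q h1 h2 => by omega, by simp, by simp [h22]⟩ ?_
  · obtain ⟨g1, g2, g3, g4, g5⟩ := key
    exact ⟨by rw [degSum, Finset.sum_range_succ]; exact g1, g2, g3, g4, g5⟩
  · rintro i t hi hF ⟨g1, g2, g3, g4, g5⟩
    have ht : (t.setV 21 i).Holds n m k num den inc a b :=
      h.congr (by rw [Store.setV_low]; exact hF.low (by decide))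
    have e0 : t.v 0 = n := by rw [hF.v 0 (by decide), h0]
    have e1 : t.v 1 = m := by rw [hF.v 1 (by decide), h1]
    have hinc := eval_incE ht (e := e) (w := i) (by simp [e0]) (by simp [e1])
      (by simp [hF.v 20 (by decide), he]) (by simp) hem hi
    rw [Finset.sum_range_succ]
    by_cases hc : inc e i ≠ 0
    · rw [Stm.run_ite_pos (by rwa [hinc])]
      have hle : (∑ w ∈ Finset.range i, if inc e w ≠ 0 then 1 else 0) ≤ i := by
        refine (Finset.sum_le_card_nsmul _ _ 1 fun w _ => ?_).trans (by simp)
        split <;> omega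
      have hmin : min (t.v 5 + 1) (n * m) = t.v 5 + 1 := by
        have h1 := degSum_le inc n e
        have h2 : (e + 1) * n ≤ m * n := Nat.mul_le_mul_right _ hem
        rw [add_mul, one_mul] at h2
        rw [min_eq_left]
        rw [g1, mul_comm n m]; omega
      set t' := Stm.run (.seq (.put 8 (.var 5) (.var 21))
        (.seq (.set 5 (.cap (.op .add (.var 5) (.lit 1)) (.op .mul (.var 0) (.var 1))))
          (.set 22 (.lit 1)))) (t.setV 21 i) with ht'
      have w5 : t'.v 5 = t.v 5 + 1 := by rw [← hmin]; simp [t', Op.eval, e0, e1]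
      have w22 : t'.v 22 = 1 := by simp [t']
      have w8 : ∀ q, t'.arr 8 q = if q = t.v 5 then i else t.arr 8 q := by
        intro q; simp [t']
      simp only [w5, w8, w22]
      refine ⟨by rw [g1, if_pos hc, add_assoc], fun q hq => ?_, fun q hq1 hq2 => ?_, fun w hw hcw => ?_,
        ⟨fun _ => ⟨i, by omega, hc⟩, fun _ => one_ne_zero⟩⟩
      · rw [if_neg (by omega)]; exact g2 q hq
      · split
        · exact hi
        · exact g3 q hq1 (by omega)
      · rcases Nat.lt_succ_iff_lt_or_eq.1 hw with hw | rfl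
        · obtain ⟨q, hq, hq'⟩ := g4 w hw hcw
          exact ⟨q, by omega, by rw [if_neg (by omega), hq']⟩
        · exact ⟨t.v 5, by omega, by simp⟩
    · rw [Stm.run_ite_neg (by rwa [hinc])]
      have w5 : (t.setV 21 i).v 5 = t.v 5 := by simp
      have w22 : (t.setV 21 i).v 22 = t.v 22 := by simp
      simp only [Stm.run, w5, w22, Store.setV_arr, if_neg hc, add_zero]
      refine ⟨g1, g2, g3, fun w hw hcw => ?_, ?_⟩
      · rcases Nat.lt_succ_iff_lt_or_eq.1 hw with hw | rfl
        · exact g4 w hw hcw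
        · exact absurd hcw hc
      · rw [g5]
        constructor
        · rintro ⟨w, hw, hcw⟩; exact ⟨w, by omega, hcw⟩
        · rintro ⟨w, hw, hcw⟩
          rcases Nat.lt_succ_iff_lt_or_eq.1 hw with hw | rfl
          · exact ⟨w, hw, hcw⟩
          · exact absurd hcw hc

/-- The result of scanning the first `e` hyperedges. -/
structure Scanned (n : ℕ) (inc : ℕ → ℕ → ℕ) (a b : ℕ → ℕ) (e : ℕ) (t : Store) : Prop where
  s : t.v 5 = degSum inc n e
  vt_lt : ∀ q < t.v 5, t.arr 8 q < n
  vt_surj : ∀ e' < e, ∀ w < n, inc e' w ≠ 0 → ∃ q < t.v 5, t.arr 8 q = w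
  pos : 0 < t.v 11
  le : ∀ e' < e, (∃ w < n, inc e' w ≠ 0) → a e' * t.v 11 ≤ t.v 10 * b e'
  mem : t.v 10 = 0 ∨ ∃ e' < e, (∃ w < n, inc e' w ≠ 0) ∧ t.v 10 = a e' ∧ t.v 11 = b e'

theorem run_scan (h : s.Holds n m k num den inc a b) (h0 : s.v 0 = n) (h1 : s.v 1 = m)
    (h5 : s.v 5 = 0) (h10 : s.v 10 = 0) (h11 : s.v 11 = 1) (hb : ∀ e < m, 0 < b e) :
    Scanned n inc a b m (scan.run s) := by
  refine Stm.loop_inv (N := m) (fun i t => Scanned n inc a b i t) (by simp [h1])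
    ⟨by simp [h5, degSum], by simp [h5], by simp, by simp [h11], by simp, .inl h10⟩ ?_
  intro e t he hF hI
  have ht : ((t.setV 20 e).setV 22 0).Holds n m k num den inc a b :=
    h.congr (by simp only [Store.setV_low]; exact hF.low (by decide))
  have e0 : t.v 0 = n := by rw [hF.v 0 (by decide), h0]
  have e1 : t.v 1 = m := by rw [hF.v 1 (by decide), h1]
  have hrun := run_incidences ht (e := e) (by simp [e0]) (by simp [e1]) (by simp) he (by simp)
    (by simp [hI.s])
  have hF1 := Stm.frame_run incidences ((t.setV 20 e).setV 22 0)
  rw [Stm.run_seq, Stm.run_seq, show (Stm.set 22 (.lit 0)).run (t.setV 20 e) =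
    (t.setV 20 e).setV 22 0 from rfl]
  set t1 := incidences.run ((t.setV 20 e).setV 22 0)
  obtain ⟨g1, g2, g3, g4, g5⟩ := hrun
  have ht1 : t1.Holds n m k num den inc a b := ht.congr (hF1.low (by decide))
  have v10 : t1.v 10 = t.v 10 := by rw [hF1.v 10 (by decide)]; simp
  have v11 : t1.v 11 = t.v 11 := by rw [hF1.v 11 (by decide)]; simp
  have v20 : t1.v 20 = e := by rw [hF1.v 20 (by decide)]; simp
  have ha := eval_numE ht1 v20 he
  have hbe := eval_denE ht1 v20 he
  simp only [Store.setV_v, Store.setV_arr] at g2 g3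
  norm_num at g2 g3
  have hle : t.v 5 ≤ t1.v 5 := by
    rw [g1, hI.s, degSum, degSum, Finset.sum_range_succ]; omega
  have f1 : ∀ q < t1.v 5, t1.arr 8 q < n := fun q hq => by
    rcases lt_or_ge q (t.v 5) with h | h
    · rw [g2 q h]; exact hI.vt_lt q h
    · exact g3 q h hq
  have f2 : ∀ e' < e + 1, ∀ w < n, inc e' w ≠ 0 → ∃ q < t1.v 5, t1.arr 8 q = w := by
    intro e' he' w hw hc
    rcases Nat.lt_succ_iff_lt_or_eq.1 he' with he' | rfl
    · obtain ⟨q, hq, hq'⟩ := hI.vt_surj e' he' w hw hc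
      exact ⟨q, by omega, by rw [g2 q hq, hq']⟩
    · exact g4 w hw hc
  have hcond : (Ex.op .mul (.var 22) (.op .lt (.op .mul (.var 10) denE)
      (.op .mul numE (.var 11)))).eval t1 ≠ 0 ↔
      (∃ w < n, inc e w ≠ 0) ∧ t.v 10 * b e < a e * t.v 11 := by
    rw [← g5]
    simp [Op.eval, ha, hbe, v10, v11, and_comm]
  by_cases hc : (∃ w < n, inc e w ≠ 0) ∧ t.v 10 * b e < a e * t.v 11
  · rw [Stm.run_ite_pos (hcond.2 hc)]
    have hd : denE.eval (t1.setV 10 (a e)) = b e :=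
      eval_denE (ht1.congr rfl) (by simp [v20]) he
    have w5 : ((Stm.seq (.set 10 numE) (.set 11 denE)).run t1).v 5 = t1.v 5 := by simp
    have w8 : ((Stm.seq (.set 10 numE) (.set 11 denE)).run t1).arr 8 = t1.arr 8 := by simp
    have w10 : ((Stm.seq (.set 10 numE) (.set 11 denE)).run t1).v 10 = a e := by simp [ha]
    have w11 : ((Stm.seq (.set 10 numE) (.set 11 denE)).run t1).v 11 = b e := by simp [ha, hd]
    refine ⟨by rw [w5, g1], by rwa [w5, w8], by rwa [w5, w8], by rw [w11]; exact hb e he, ?_,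
      by rw [w10, w11]; exact .inr ⟨e, by omega, hc.1, rfl, rfl⟩⟩
    rw [w10, w11]
    intro e' he' hex
    rcases Nat.lt_succ_iff_lt_or_eq.1 he' with he' | rfl
    · have h1 := hI.le e' he' hex
      -- Transitivity for fractions compared by cross-multiplication; the denominator of the old
      -- maximum cancels.
      refine Nat.le_of_mul_le_mul_right (c := t.v 11) ?_ hI.pos
      calc a e' * b e * t.v 11 = a e' * t.v 11 * b e := by ring
        _ ≤ t.v 10 * b e' * b e := Nat.mul_le_mul_right _ h1
        _ = t.v 10 * b e * b e' := by ring
        _ ≤ a e * t.v 11 * b e' := Nat.mul_le_mul_right _ hc.2.le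
        _ = _ := by ring
    · exact le_rfl
  · rw [Stm.run_ite_neg (mt hcond.1 hc), Stm.run]
    refine ⟨g1, f1, f2, by rw [v11]; exact hI.pos, fun e' he' hex => ?_, ?_⟩
    · rw [v10, v11]
      rcases Nat.lt_succ_iff_lt_or_eq.1 he' with he' | rfl
      · exact hI.le e' he' hex
      · push Not at hc; exact hc hex
    · rw [v10, v11]
      refine hI.mem.imp_right ?_
      rintro ⟨e', he', h⟩; exact ⟨e', by omega, h⟩

theorem iter_power {x y z : ℕ} (hxz : z ≠ x) (hx : x ≠ 23) (hz : z ≠ 23) (h1 : s.v x = 1)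
    {i : ℕ} (hi : i ≤ s.v y) :
    let t := s.iter (Stm.run (.set x (.op .mul (.var x) (.var z)))) 23 i
    t.v x = s.v z ^ i ∧ t.v z = s.v z ∧ t.v 23 ≤ s.v 23 + i := by
  obtain ⟨hF, hI, hI'⟩ := Stm.iter_inv (x := 23) (P := .set x (.op .mul (.var x) (.var z))) (s := s)
    (N := s.v y) (fun i t => t.v x = s.v z ^ i ∧ t.v 23 ≤ s.v 23 + i) (by simp [h1]) (by
      intro i t hi hF hInv
      have : t.v z = s.v z := hF.v z (by simp [Stm.writesV, hz, hxz])
      simp [Op.eval, hx, hx.symm, hz, hInv.1, this, pow_succ]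
      omega) i hi
  exact ⟨hI, hF.v z (by simp [Stm.writesV, hz, hxz]), hI'⟩

theorem run_power {x y z : ℕ} (hxz : z ≠ x) (hx : x ≠ 23) (hz : z ≠ 23) (h1 : s.v x = 1) :
    ((power x y z).run s).v x = s.v z ^ s.v y :=
  (iter_power hxz hx hz h1 le_rfl).1

theorem run_power_counter {x y z : ℕ} (hxz : z ≠ x) (hx : x ≠ 23) (hz : z ≠ 23)
    (h1 : s.v x = 1) : ((power x y z).run s).v 23 ≤ s.v 23 + s.v y :=
  (iter_power hxz hx hz h1 le_rfl).2.2

/-- A repeated product has no syntactic bound of the kind used elsewhere, so the powers are checked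
by hand: each partial power is at most the final one. -/
theorem safe_power {W X : ℕ} {x y z : ℕ} (hxz : z ≠ x) (hx : x ≠ 23) (hz : z ≠ 23)
    (h1 : s.v x = 1) (hz0 : 0 < s.v z) (hy : s.v y < W) (hzW : s.v z < W) (hX : s.v y ≤ X)
    (hW : s.v z ^ s.v y < W) (B : ℕ) : (power x y z).Safe W B X s := by
  refine ⟨hy, hX, fun i hi => ?_⟩
  simp only [Ex.eval] at hi
  obtain ⟨hI, hF, -⟩ := iter_power (y := y) hxz hx hz h1 hi.le
  have hlt : s.v z ^ i * s.v z < W := by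
    rw [← pow_succ]
    exact (Nat.pow_le_pow_right hz0 hi).trans_lt hW
  simp only [Stm.Safe, Ex.Safe, Ex.eval, Op.eval, Store.setV_v, if_neg hx, if_neg hz, hI, hF]
  exact ⟨lt_of_le_of_lt (Nat.le_mul_of_pos_right _ hz0) hlt, hzW, hlt⟩

theorem run_prices (h : s.Holds n m k num den inc a b) (h1 : s.v 1 = m) :
    (∀ e < m, (prices.run s).arr 7 e = min (s.v 6 * a e * s.v 11 / (b e * s.v 10)) (s.v 6)) ∧
      ∀ j < s.v 7, (prices.run s).arr 7 (m + j) = j := by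
  set P1 : Stm := .loop 20 (.var 1) (.put 7 (.var 20) (.cap (.op .div
      (.op .mul (.op .mul (.var 6) numE) (.var 11)) (.op .mul denE (.var 10))) (.var 6))) with hP1
  have hF1 := P1.frame_run s
  have g1 : ∀ e < m, (P1.run s).arr 7 e =
      min (s.v 6 * a e * s.v 11 / (b e * s.v 10)) (s.v 6) := by
    refine Stm.loop_inv (fun i t => ∀ e < i, t.arr 7 e =
      min (s.v 6 * a e * s.v 11 / (b e * s.v 10)) (s.v 6)) (by simp [h1]) (by simp) ?_
    intro i t hi hF hI e he
    have ht : (t.setV 20 i).Holds n m k num den inc a b :=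
      h.congr (by rw [Store.setV_low]; exact hF.low (by decide))
    have v6 : t.v 6 = s.v 6 := hF.v 6 (by decide)
    have v10 : t.v 10 = s.v 10 := hF.v 10 (by decide)
    have v11 : t.v 11 = s.v 11 := hF.v 11 (by decide)
    simp only [Stm.run, Ex.eval, Op.eval, eval_numE ht (e := i) (by simp) hi,
      eval_denE ht (e := i) (by simp) hi, Store.setA_arr_apply, Store.setV_v, Store.setV_arr,
      v6, v10, v11]
    norm_num
    split
    · next hei => rw [hei]
    · exact hI e (by omega)
  have v1 : (P1.run s).v 1 = m := by rw [hF1.v 1 (by decide), h1]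
  have v7 : (P1.run s).v 7 = s.v 7 := hF1.v 7 (by decide)
  have key := Stm.loop_inv (x := 28) (e := .var 7)
    (P := .put 7 (.op .add (.var 1) (.var 28)) (.var 28)) (s := P1.run s) (N := s.v 7)
    (fun i t => (∀ e < m, t.arr 7 e = (P1.run s).arr 7 e) ∧ ∀ j < i, t.arr 7 (m + j) = j)
    (by simp [v7]) ⟨fun _ _ => rfl, by simp⟩ (by
      rintro i t hi hF ⟨hI1, hI2⟩
      have v1' : t.v 1 = m := by rw [hF.v 1 (by decide), v1]
      simp only [Stm.run, Ex.eval, Op.eval, Store.setA_arr_apply, Store.setV_v, Store.setV_arr]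
      norm_num
      rw [v1']
      refine ⟨fun e he => ?_, fun j hj => ?_⟩
      · rw [if_neg (by omega)]; exact hI1 e he
      · split
        · omega
        · exact hI2 j (by omega))
  exact ⟨fun e he => (key.1 e he).trans (g1 e he), key.2⟩

theorem run_finish (h0 : s.v 0 = n) :
    (∀ w < n, (finish.run s).arr 9 w = s.arr 7 (s.arr 4 w) * s.v 10) ∧
      (finish.run s).v 14 = s.v 6 * s.v 11 := by
  set P1 : Stm := .loop 21 (.var 0)
    (.put 9 (.var 21) (.op .mul (.get 7 (.get 4 (.var 21))) (.var 10))) with hP1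
  have hF1 := P1.frame_run s
  have g1 : ∀ w < n, (P1.run s).arr 9 w = s.arr 7 (s.arr 4 w) * s.v 10 := by
    refine Stm.loop_inv (fun i t => ∀ w < i, t.arr 9 w = s.arr 7 (s.arr 4 w) * s.v 10)
      (by simp [h0]) (by simp) ?_
    intro i t hi hF hI w hw
    have v10 : t.v 10 = s.v 10 := hF.v 10 (by decide)
    have a4 : t.arr 4 = s.arr 4 := hF.arr 4 (by decide)
    have a7 : t.arr 7 = s.arr 7 := hF.arr 7 (by decide)
    simp only [Stm.run, Ex.eval, Op.eval, Store.setA_arr_apply, Store.setV_v, Store.setV_arr, a4,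
      a7]
    norm_num
    split
    · next hwi => rw [hwi, v10]
    · exact hI w (by omega)
  refine ⟨g1, ?_⟩
  have : (finish.run s).v 14 = (P1.run s).v 6 * (P1.run s).v 11 := by
    simp [finish, ← hP1, Op.eval]
  rw [this, hF1.v 6 (by decide), hF1.v 11 (by decide)]

theorem run_output (h0 : s.v 0 = n) :
    ∀ w < n, (output.run s).low (2 * w) = s.arr 9 w ∧ (output.run s).low (2 * w + 1) = s.v 14 := by
  refine Stm.loop_inv (fun i t => ∀ w < i, t.low (2 * w) = s.arr 9 w ∧
    t.low (2 * w + 1) = s.v 14) (by simp [h0]) (by simp) ?_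
  intro i t hi hF hI w hw
  have v14 : t.v 14 = s.v 14 := hF.v 14 (by decide)
  have a9 : t.arr 9 = s.arr 9 := hF.arr 9 (by decide)
  simp only [Stm.run, Ex.eval, Op.eval, Store.setL_low, Store.setL_v, Store.setV_v,
    Store.setV_arr, Store.setV_low, a9]
  norm_num
  rw [v14]
  rcases Nat.lt_succ_iff_lt_or_eq.1 hw with hw | rfl
  · have := hI w hw
    rw [if_neg (by omega), if_neg (by omega), if_neg (by omega), if_neg (by omega)]
    exact this
  · simp

end

end Alg

/-! ### Correctness of the program. -/

section Correctness

variable {n m : ℕ} {I : Instance n m} {k : ℕ} {ε : ℚ≥0}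

theorem Instance.incid_ne_zero {e v : ℕ} : I.incid e v ≠ 0 ↔
    ∃ (he : e < m) (hv : v < n), (⟨v, hv⟩ : Fin n) ∈ I.bundle ⟨e, he⟩ := by
  rw [Instance.incid]
  split
  · next h => simp [h.1, h.2]
  · next h =>
    simp only [ne_eq, not_true_eq_false, false_iff]
    rintro ⟨he, hv, -⟩
    exact h ⟨he, hv⟩

open scoped Classical in
/-- An order of the vertices in which the admissible components have small boundaries. -/
theorem Instance.TreewidthAtMost.exists_adm (hI : I.TreewidthAtMost k) :
    ∃ κ : ℕ → ℕ, Set.InjOn κ {w | w < n} ∧ ∀ (K : ℕ) (hK : 0 < K) (cand D : ℕ → ℕ) (v : ℕ),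
      (I.net K hK cand).Adm κ D v →
      ((Finset.range n).filter fun w => (I.net K hK cand).Reach D v w ∧ D w ≠ 0).card ≤ k := by
  obtain ⟨κ, hκ, h⟩ := hI.exists_order
  refine ⟨fun w => if hw : w < n then κ ⟨w, hw⟩ else 0, ?_, ?_⟩
  · intro a ha b hb hab
    simp only [Set.mem_ofPred_eq] at ha hb
    simp only [ha, hb, dite_true] at hab
    exact congrArg Fin.val (hκ hab)
  · intro K hK cand D v hadm
    obtain ⟨u, hu, hmin⟩ := hadm.exists_min
    have hlt : ∀ {z}, (I.net K hK cand).Reach D v z → z < n := fun hz => hz.lt hadm.lt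
    have hun := hlt hu.1
    -- The component is the connected set and the assigned vertices reached are its neighbours;
    -- admissibility says that they precede its first vertex `u`.
    refine le_trans (le_of_eq ?_) (h {z | (I.net K hK cand).Comp D v z} ⟨u, hun⟩ hu ?_ ?_
      (Finset.univ.filter fun w : Fin n => (I.net K hK cand).Reach D v w ∧ D w ≠ 0) ?_)
    · refine (Finset.card_bij (fun (a : Fin n) _ => (a : ℕ)) ?_ ?_ ?_).symm
      · intro a ha
        rw [Finset.mem_filter] at ha ⊢
        exact ⟨Finset.mem_range.2 a.2, ha.2⟩
      · intro a _ b _ hab; exact Fin.ext hab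
      · intro b hb
        rw [Finset.mem_filter, Finset.mem_range] at hb
        exact ⟨⟨b, hb.1⟩, by simpa using hb.2, rfl⟩
    · intro Q hQ hstep z hz
      have key : ∀ w, (I.net K hK cand).Reach D u w → ∀ hw : w < n, D w = 0 → Q ⟨w, hw⟩ := by
        intro w hw
        induction hw with
        | base => exact fun _ _ => hQ
        | @step z w e hz hz0 h1 h2 ih =>
          intro hwn hw0
          obtain ⟨he, hzn, hez⟩ := Instance.incid_ne_zero.1 h1
          obtain ⟨_, _, hew⟩ := Instance.incid_ne_zero.1 h2
          have hvz := hu.1.trans hz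
          exact hstep ⟨z, hzn⟩ ⟨hvz, hz0⟩ ⟨w, hwn⟩ ⟨hvz.step hz0 h1 h2, hw0⟩ ⟨e, he⟩ hez hew
            (ih hzn hz0)
      exact key z ((hu.1.symm hu.2).trans hz.1) z.2 hz.2
    · intro z hz
      have := hmin z hz
      simpa [hun] using this
    · intro w hw
      simp only [Finset.mem_filter, Finset.mem_univ, true_and] at hw
      refine ⟨?_, ?_⟩
      · have := hadm.order u w hu hw.1 hw.2
        simpa [hun] using this
      · obtain ⟨hr, hw0⟩ := hw
        generalize hw' : (w : ℕ) = w' at hr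
        cases hr with
        | base => exact absurd hadm.zero (by rwa [← hw'])
        | @step z _ e hz hz0 h1 h2 =>
          obtain ⟨he, hzn, hez⟩ := Instance.incid_ne_zero.1 h1
          obtain ⟨_, hwn, hew⟩ := Instance.incid_ne_zero.1 h2
          refine ⟨⟨e, he⟩, ⟨z, hzn⟩, ⟨hz, hz0⟩, hez, ?_⟩
          rwa [show w = ⟨w', hwn⟩ from Fin.ext hw']

/-- The initial store. -/
def Instance.store (I : Instance n m) (k : ℕ) (ε : ℚ≥0) : Store where
  v _ := 0
  arr _ _ := 0
  low i := (I.encode k ε).getD i 0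

/-- The numerators of the budgets. -/
def Instance.nums (I : Instance n m) (e : ℕ) : ℕ := if h : e < m then (I.budget ⟨e, h⟩).num else 0

/-- The denominators of the budgets. -/
def Instance.dens (I : Instance n m) (e : ℕ) : ℕ := if h : e < m then (I.budget ⟨e, h⟩).den else 0

theorem length_flatMap_const {α β : Type*} {f : α → List β} {l : ℕ}
    (hf : ∀ e, (f e).length = l) (L : List α) : (L.flatMap f).length = L.length * l := by
  induction L with
  | nil => simp
  | cons a L ih => simp [hf, ih]; ring

theorem getD_flatMap {f : Fin m → List ℕ} {l : ℕ} (hf : ∀ e, (f e).length = l) (e : Fin m)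
    {i : ℕ} (hi : i < l) :
    ((List.finRange m).flatMap f).getD (e * l + i) 0 = (f e).getD i 0 := by
  have key : ∀ (L : List (Fin m)) (j : ℕ) (hj : j < L.length),
      (L.flatMap f).getD (j * l + i) 0 = (f L[j]).getD i 0 := by
    intro L
    induction L with
    | nil => simp
    | cons a L ih =>
      intro j hj
      rw [List.flatMap_cons]
      cases j with
      | zero =>
        rw [List.getD_append _ _ _ _ (by rw [hf]; omega)]
        simp
      | succ j =>
        have : (j + 1) * l + i - l = j * l + i := by
          rw [add_mul, one_mul]; omega
        rw [List.getD_append_right _ _ _ _ (by rw [hf, add_mul]; omega), hf, this,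
          ih j (by simpa using hj)]
        simp
  have := key (List.finRange m) e (by simp)
  simpa using this

theorem Instance.length_encode : (I.encode k ε).length = 5 + 2 * m + m * n := by
  simp only [Instance.encode, List.length_append]
  rw [length_flatMap_const (l := 2) (by simp), length_flatMap_const (l := n) (by simp)]
  simp
  ring

theorem Instance.store_holds : (I.store k ε).Holds n m k ε.num ε.den I.incid I.nums I.dens where
  eq_n := rfl
  eq_m := rfl
  eq_k := rfl
  eq_num := rfl
  eq_den := rfl
  eq_a e he := by
    simp only [Instance.store, Instance.encode]
    rw [List.getD_append _ _ _ _ (by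
        simp only [List.length_append]
        rw [length_flatMap_const (l := 2) (by simp)]; simp; omega),
      List.getD_append_right _ _ _ _ (by simp),
      show 5 + 2 * e - [n, m, k, ε.num, ε.den].length = (⟨e, he⟩ : Fin m) * 2 + 0 by
        simp; omega, getD_flatMap (by simp) _ (by omega)]
    simp [Instance.nums, he]
  eq_b e he := by
    simp only [Instance.store, Instance.encode]
    rw [List.getD_append _ _ _ _ (by
        simp only [List.length_append]
        rw [length_flatMap_const (l := 2) (by simp)]; simp; omega),
      List.getD_append_right _ _ _ _ (by simp; omega),
      show 6 + 2 * e - [n, m, k, ε.num, ε.den].length = (⟨e, he⟩ : Fin m) * 2 + 1 by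
        simp; omega, getD_flatMap (by simp) _ (by omega)]
    simp [Instance.dens, he]
  eq_inc e he w hw := by
    simp only [Instance.store, Instance.encode]
    have hlen : ([n, m, k, ε.num, ε.den] ++ (List.finRange m).flatMap
        (fun e => [(I.budget e).num, (I.budget e).den])).length = 5 + 2 * m := by
      rw [List.length_append, length_flatMap_const (l := 2) (by simp)]
      simp; omega
    rw [List.getD_append_right _ _ _ _ (by omega), hlen,
      show 5 + 2 * m + (e * n + w) - (5 + 2 * m) = (⟨e, he⟩ : Fin m) * n + w by simp,
      getD_flatMap (by simp) _ hw]
    simp [Instance.incid, he, hw, List.getD_eq_getElem?_getD]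

theorem Instance.degSum_incid (I : Instance n m) :
    Alg.degSum I.incid n m = ∑ e, (I.bundle e).card := by
  rw [Alg.degSum, ← Fin.sum_univ_eq_sum_range
    (fun e' => ∑ w ∈ Finset.range n, if I.incid e' w ≠ 0 then 1 else 0) m]
  refine Finset.sum_congr rfl fun e _ => ?_
  rw [← Fin.sum_univ_eq_sum_range (fun w => if I.incid e w ≠ 0 then 1 else 0) n]
  simp

/-- The store before the dynamic program is set up. -/
structure Instance.Prepared (I : Instance n m) (k : ℕ) (ε : ℚ≥0) (s : Store) : Prop where
  holds : s.Holds n m k ε.num ε.den I.incid I.nums I.dens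
  scanned : Alg.Scanned n I.incid I.nums I.dens m s
  eq_n : s.v 0 = n
  eq_m : s.v 1 = m
  eq_k : s.v 2 = min k n
  eq_N : s.v 6 = s.v 5 * ε.den / ε.num + 1
  eq_g : s.v 7 = if s.v 2 ≠ 0 then s.v 6 + 1 else 1
  eq_K : s.v 8 = s.v 1 + s.v 7
  eq_base : s.v 13 = s.v 5 * s.v 8 + 1
  eq_digit : s.v 15 = s.v 8 + 2
  eq_T : s.v 9 = 1
  eq_big : s.v 12 = 1
  arr1 : s.arr 1 = fun _ => 0
  arr5 : s.arr 5 = fun _ => 0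
  arr6 : s.arr 6 = fun _ => 0

theorem Instance.run_prepare : I.Prepared k ε (Alg.prepare.run (Alg.init.run (I.store k ε))) := by
  have h : (I.store k ε).Holds n m k ε.num ε.den I.incid I.nums I.dens := I.store_holds
  set s0 := Alg.init.run (I.store k ε) with hs0
  have hF0 := Stm.frame_run Alg.init (I.store k ε)
  set s1 := Alg.params.run s0 with hs1
  have hF1 := Stm.frame_run Alg.params s0
  set s2 := Alg.scan.run s1 with hs2
  have hF2 := Stm.frame_run Alg.scan s1
  have hF3 := Stm.frame_run Alg.sizes s2
  have hrun : Alg.prepare.run s0 = Alg.sizes.run s2 := rfl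
  rw [hrun]
  set s3 := Alg.sizes.run s2 with hs3
  have h0 : s0.Holds n m k ε.num ε.den I.incid I.nums I.dens := h.congr (hF0.low (by decide))
  have h1 : s1.Holds n m k ε.num ε.den I.incid I.nums I.dens := h0.congr (hF1.low (by decide))
  have h2 : s2.Holds n m k ε.num ε.den I.incid I.nums I.dens := h1.congr (hF2.low (by decide))
  have h3 := h2.congr (hF3.low (by decide))
  have a0 : s0.v 0 = n := by simp [s0, Alg.init, h.eq_n]
  have a1 : s0.v 1 = m := by simp [s0, Alg.init, h.eq_m]
  have b0 : s1.v 0 = n := by rw [hF1.v 0 (by decide), a0]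
  have b1 : s1.v 1 = m := by rw [hF1.v 1 (by decide), a1]
  have b2 : s1.v 2 = min k n := by simp [s1, Alg.params, h0.eq_k, a0]
  have b3 : s1.v 3 = ε.num := by simp [s1, Alg.params, h0.eq_num]
  have b4 : s1.v 4 = ε.den := by simp [s1, Alg.params, h0.eq_den]
  have hsc : Alg.Scanned n I.incid I.nums I.dens m s2 :=
    Alg.run_scan h1 b0 b1 (by simp [s1, Alg.params]) (by simp [s1, Alg.params])
      (by simp [s1, Alg.params]) fun e he => by simp [Instance.dens, he]
  have c3 : s2.v 3 = ε.num := by rw [hF2.v 3 (by decide), b3]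
  have c4 : s2.v 4 = ε.den := by rw [hF2.v 4 (by decide), b4]
  have d5 : s3.v 5 = s2.v 5 := hF3.v 5 (by decide)
  have d10 : s3.v 10 = s2.v 10 := hF3.v 10 (by decide)
  have d11 : s3.v 11 = s2.v 11 := hF3.v 11 (by decide)
  have d8 : s3.arr 8 = s2.arr 8 := hF3.arr 8 (by decide)
  have harr : ∀ a ∈ [1, 5, 6], s3.arr a = fun _ => 0 := by
    intro a ha
    have : Alg.sizes.writesA a = false ∧ Alg.scan.writesA a = false ∧
        Alg.params.writesA a = false ∧ Alg.init.writesA a = false := by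
      simp only [List.mem_cons, List.not_mem_nil, or_false] at ha
      rcases ha with rfl | rfl | rfl <;> decide
    rw [hF3.arr a this.1, hF2.arr a this.2.1, hF1.arr a this.2.2.1, hF0.arr a this.2.2.2]
    rfl
  refine ⟨h3, ?_, ?_, ?_, ?_, ?_, ?_, ?_, ?_, ?_, ?_, ?_, harr 1 (by simp), harr 5 (by simp),
    harr 6 (by simp)⟩
  · constructor
    · rw [d5]; exact hsc.s
    · rw [d5, d8]; exact hsc.vt_lt
    · rw [d5, d8]; exact hsc.vt_surj
    · rw [d11]; exact hsc.pos
    · rw [d10, d11]; exact hsc.le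
    · rw [d10, d11]; exact hsc.mem
  · rw [hF3.v 0 (by decide), hF2.v 0 (by decide), b0]
  · rw [hF3.v 1 (by decide), hF2.v 1 (by decide), b1]
  · rw [hF3.v 2 (by decide), hF2.v 2 (by decide), b2]
  all_goals
    by_cases hc : s2.v 2 = 0 <;> simp [s3, Alg.sizes, Op.eval, hc, c3, c4]

/-- The budget in the variables `10` and `11` is the largest one. -/
theorem Instance.Prepared.isMaxBudget {s : Store} (h : I.Prepared k ε s) :
    I.IsMaxBudget (s.v 10) (s.v 11) where
  pos := h.scanned.pos
  le e he := by
    obtain ⟨v, hv⟩ := he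
    have := h.scanned.le e e.2 ⟨v, v.2, by simp [hv]⟩
    simpa [Instance.nums, Instance.dens] using this
  mem := by
    refine h.scanned.mem.imp_right ?_
    rintro ⟨e, he, ⟨w, hw, hc⟩, h1, h2⟩
    obtain ⟨_, _, hm⟩ := Instance.incid_ne_zero.1 hc
    exact ⟨⟨e, he⟩, ⟨_, hm⟩, by simpa [Instance.nums, he] using h1,
      by simpa [Instance.dens, he] using h2⟩

open scoped Classical in
/-- The store after the dynamic program has been set up. -/
theorem Instance.Prepared.run_main {s : Store} (h : I.Prepared k ε s) (hI : I.TreewidthAtMost k)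
    (hε : 0 < ε) :
    let t := (Stm.seq (.seq (Alg.power 9 2 13) (Alg.power 12 0 15))
      (.seq Alg.prices (.seq Alg.optimum Alg.finish))).run s
    t.v 14 ≠ 0 ∧ I.IsApproxSolution (1 + (ε : ℝ)) fun w => (t.arr 9 w : ℝ) / (t.v 14 : ℝ) := by
  set P1 : Stm := .seq (Alg.power 9 2 13) (Alg.power 12 0 15) with hP1
  set s1 := P1.run s with hs1
  have hF1 := P1.frame_run s
  set s2 := Alg.prices.run s1 with hs2
  have hF2 := Stm.frame_run Alg.prices s1
  set s3 := Alg.optimum.run s2 with hs3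
  have hF3 := Stm.frame_run Alg.optimum s2
  have e9 : s1.v 9 = s.v 13 ^ s.v 2 := by
    have hF := Stm.frame_run (Alg.power 12 0 15) ((Alg.power 9 2 13).run s)
    have : s1 = (Alg.power 12 0 15).run ((Alg.power 9 2 13).run s) := rfl
    rw [this, hF.v 9 (by decide)]
    exact Alg.run_power (by decide) (by decide) (by decide) h.eq_T
  have e12 : s1.v 12 = s.v 15 ^ s.v 0 := by
    have hF := Stm.frame_run (Alg.power 9 2 13) s
    have := Alg.run_power (s := (Alg.power 9 2 13).run s) (x := 12) (y := 0) (z := 15)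
      (by decide) (by decide) (by decide) (by rw [hF.v 12 (by decide), h.eq_big])
    rw [hF.v 15 (by decide), hF.v 0 (by decide)] at this
    exact this
  have hv1 : ∀ x ∈ [0, 1, 2, 5, 6, 7, 8, 10, 11, 13], s1.v x = s.v x := by
    intro x hx
    refine hF1.v x ?_
    revert x; decide
  have hv2 : ∀ x ∈ [0, 1, 2, 5, 6, 7, 8, 9, 10, 11, 12, 13], s2.v x = s1.v x := by
    intro x hx
    refine hF2.v x ?_
    revert x; decide
  have hv3 : ∀ x ∈ [0, 6, 10, 11], s3.v x = s2.v x := by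
    intro x hx
    refine hF3.v x ?_
    revert x; decide
  have hv : ∀ x ∈ [0, 1, 2, 5, 6, 7, 8, 10, 11, 13], s2.v x = s.v x := by
    intro x hx
    rw [hv2 x (by revert x; decide), hv1 x hx]
  have hh1 : s1.Holds n m k ε.num ε.den I.incid I.nums I.dens :=
    h.holds.congr (hF1.low (by decide))
  have hh2 := hh1.congr (hF2.low (by decide))
  obtain ⟨hc1, hc2⟩ := Alg.run_prices hh1 ((hv1 1 (by decide)).trans h.eq_m)
  rw [hv1 6 (by decide), hv1 10 (by decide), hv1 11 (by decide)] at hc1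
  rw [hv1 7 (by decide)] at hc2
  have hmax := h.isMaxBudget
  have hK : 0 < s.v 8 := by rw [h.eq_K, h.eq_g]; split <;> omega
  have hN : 0 < s.v 6 := by rw [h.eq_N]; exact Nat.succ_pos _
  have hcand : I.IsCand (s.v 6) (s.v 10) (s.v 11) (s.v 7) (s2.arr 7) := by
    refine ⟨fun e => ?_, hc2, ?_⟩
    · rw [hc1 e e.2]; simp [Instance.nums, Instance.dens]
    · rw [h.eq_g]
      split
      · exact .inl rfl
      · next h2 =>
        -- The program tests `min k n = 0`; since a bundle has at most `k + 1` and at most `n`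
        -- products, all bundles then have at most one.
        refine .inr ⟨rfl, fun e => ?_⟩
        rw [h.eq_k] at h2
        have h3 := hI.card_bundle_le e
        have h4 : (I.bundle e).card ≤ n := (Finset.card_le_univ _).trans (by simp)
        omega
  have hK7 : s.v 8 = m + s.v 7 := by rw [h.eq_K, h.eq_m]
  have g7 : s.v 7 ≤ s.v 6 + 1 := by rw [h.eq_g]; split <;> omega
  have hcand_le : ∀ j < s.v 8, s2.arr 7 j ≤ s.v 6 := by
    intro j hj
    rcases lt_or_ge j m with hjm | hjm
    · rw [hc1 j hjm]; exact min_le_right _ _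
    · obtain ⟨i, rfl⟩ := Nat.exists_eq_add_of_le hjm
      rw [hc2 i (by omega)]; omega
  have w8 : s2.arr 8 = s.arr 8 := by rw [hF2.arr 8 (by decide), hF1.arr 8 (by decide)]
  obtain ⟨κ, hκ, hk⟩ := hI.exists_adm
  let H : Plan :=
    { I.net (s.v 8) hK (s2.arr 7) with
      k := min k n
      N := s.v 6
      s := s.v 5
      vt := s.arr 8
      vt_lt := h.scanned.vt_lt
      vt_surj := fun e w hew => by
        obtain ⟨he, hw, -⟩ := Instance.incid_ne_zero.1 hew
        exact h.scanned.vt_surj e he w hw hew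
      cand_le := hcand_le }
  have hH : H.Holds s2 :=
    { n := (hv 0 (by decide)).trans h.eq_n
      m := (hv 1 (by decide)).trans h.eq_m
      k := (hv 2 (by decide)).trans h.eq_k
      N := hv 6 (by decide)
      K := hv 8 (by decide)
      T := by rw [hv2 9 (by decide), e9, h.eq_base, h.eq_k]; rfl
      big := by rw [hv2 12 (by decide), e12, h.eq_digit, h.eq_n]; rfl
      base := (hv 13 (by decide)).trans h.eq_base
      cand := rfl
      vt := w8
      inc := hh2.eq_inc }
  obtain ⟨hlt, hopt⟩ := H.run_optimum hκ
    (fun D v hadm => le_min (hk _ hK _ D v hadm)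
      ((Finset.card_filter_le _ _).trans (by simp [H, Instance.net]))) hH
    (by rw [hF2.arr 1 (by decide), hF1.arr 1 (by decide), h.arr1])
    (by rw [hF2.arr 5 (by decide), hF1.arr 5 (by decide), h.arr5])
    (by rw [hF2.arr 6 (by decide), hF1.arr 6 (by decide), h.arr6])
  -- The `+ 1` in the grid size makes up for the truncated division.
  have hs : ((∑ e, (I.bundle e).card : ℕ) : ℝ) ≤ (ε : ℝ) * (s.v 6 : ℕ) := by
    rw [← I.degSum_incid, ← h.scanned.s, h.eq_N, budget_eq]
    have hnum : 0 < ε.num := NNRat.num_pos.2 hε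
    have hden : 0 < ε.den := ε.den_pos
    have := Nat.lt_mul_div_succ (s.v 5 * ε.den) hnum
    rw [div_mul_eq_mul_div, le_div_iff₀ (by exact_mod_cast hden)]
    exact_mod_cast this.le
  have happ := hcand.isApproxSolution hmax hN hs hK7 (hK := hK) (E := s3.arr 4) hopt
  have hfin := Alg.run_finish (s := s3) (n := n)
    (by rw [hv3 0 (by decide), hv 0 (by decide), h.eq_n])
  have hw7 : s3.arr 7 = s2.arr 7 := hF3.arr 7 (by decide)
  rw [hw7, hv3 10 (by decide), hv3 6 (by decide), hv3 11 (by decide), hv 10 (by decide),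
    hv 6 (by decide), hv 11 (by decide)] at hfin
  have hrun : (Stm.seq P1 (.seq Alg.prices (.seq Alg.optimum Alg.finish))).run s =
    Alg.finish.run s3 := rfl
  intro t
  have ht : t = Alg.finish.run s3 := hrun
  rw [ht, hfin.2]
  refine ⟨(Nat.mul_pos hN hmax.pos).ne', ?_⟩
  convert happ using 3 with w
  rw [hfin.1 w w.2]

/-- The program solves the problem. -/
theorem Instance.run_program (hI : I.TreewidthAtMost k) (hε : 0 < ε) :
    let t := Alg.program.run (I.store k ε)
    (∀ w : Fin n, t.low (2 * w + 1) ≠ 0) ∧ I.IsApproxSolution (1 + (ε : ℝ))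
      fun w => (t.low (2 * w) : ℝ) / (t.low (2 * w + 1) : ℝ) := by
  have h : (I.store k ε).Holds n m k ε.num ε.den I.incid I.nums I.dens := I.store_holds
  set s0 := Alg.init.run (I.store k ε) with hs0
  have a0 : s0.v 0 = n := by simp [s0, Alg.init, h.eq_n]
  have a1 : s0.v 1 = m := by simp [s0, Alg.init, h.eq_m]
  have hfin : ∀ s : Store, s.v 0 = n → s.v 14 ≠ 0 →
      (I.IsApproxSolution (1 + (ε : ℝ)) fun w => (s.arr 9 w : ℝ) / (s.v 14 : ℝ)) →
      (∀ w : Fin n, (Alg.output.run s).low (2 * w + 1) ≠ 0) ∧ I.IsApproxSolution (1 + (ε : ℝ))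
        fun w => ((Alg.output.run s).low (2 * w) : ℝ) /
          ((Alg.output.run s).low (2 * w + 1) : ℝ) := by
    intro s h0 h14 happ
    have ho := Alg.run_output h0
    refine ⟨fun w => by rw [(ho w w.2).2]; exact h14, ?_⟩
    convert happ using 3 with w
    · rw [(ho w w.2).1]
    · rw [(ho w w.2).2]
  have hrun : Alg.program.run (I.store k ε) =
      Alg.output.run ((Stm.ite (.var 1) Alg.main .skip).run s0) := rfl
  intro t
  have ht : t = Alg.output.run ((Stm.ite (.var 1) Alg.main .skip).run s0) := hrun
  rw [ht]
  -- Without consumers all prices are `0 / 1`; variable `14` was set to 1 for this case.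
  by_cases hm : m = 0
  · rw [Stm.run_ite_neg (by simp [a1, hm])]
    refine hfin _ (by simpa using a0) (by simp [s0, Alg.init]) ⟨fun v => by positivity, ?_⟩
    intro q _
    subst hm
    simp [Instance.revenue]
  · rw [Stm.run_ite_pos (by simpa [a1] using hm)]
    have hrun' : Alg.main.run s0 = (Stm.seq (.seq (Alg.power 9 2 13) (Alg.power 12 0 15))
      (.seq Alg.prices (.seq Alg.optimum Alg.finish))).run (Alg.prepare.run s0) := by
      rw [Alg.main, Stm.run_seq]
    have h0 : (Alg.main.run s0).v 0 = n := by
      rw [(Stm.frame_run Alg.main s0).v 0 (by decide), a0]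
    have hmain := I.run_prepare.run_main hI hε
    rw [← hs0, ← hrun'] at hmain
    exact hfin _ h0 hmain.1 hmain.2

end Correctness

/-! ### Bounds for the numbers in the computation -/

theorem Store.Bounded.mono {b b' : Bounds} {s : Store} (h : s.Bounded b)
    (hv : ∀ x, b.v x ≤ b'.v x) (ha : ∀ a, b.arr a ≤ b'.arr a) (hl : b.low ≤ b'.low) :
    s.Bounded b' where
  v x := (h.v x).trans (hv x)
  arr a i := (h.arr a i).trans (ha a)
  low i := (h.low i).trans hl

namespace Alg

/-- Bounds for the preparations. -/
def prepBounds (n m l : ℕ) : Bounds where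
  v x := [n, m, n, l, l, n * m, n * m * l + 1, n * m * l + 2, m + (n * m * l + 2), 1, l, l, 1,
    n * m * (m + (n * m * l + 2)) + 1, 1, m + (n * m * l + 2) + 2, 0, 0, 0, 0, m - 1, n - 1,
    1].getD x 0
  arr a := if a = 8 then n - 1 else 0
  low := l

/-- Bounds for the dynamic program. -/
def mainBounds (n m l N g K T big base U : ℕ) : Bounds where
  v x := [n, m, n, U, U, U, N, g, K, T, l, l, big, base, N * l + 1, U, U, U, U, U, m - 1, n - 1, 1,
    2 * n, big, n - 1, n - 1, n - 1, K - 1, T - 1, n - 1, T, T, n - 1, big, m * (n * N), n * N,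
    m * (n * N)].getD x U
  arr a := [U, K, 1, 1, K, K, K, N + K, n - 1, (N + K) * l].getD a U
  low := l

/-- Bounds for the output. -/
def outBounds (n U : ℕ) : Bounds where
  v x := if x = 0 then n else if x = 21 then n - 1 else U
  arr _ := U
  low := U

/-- The largest input address read is that of the last incidence, which is the left-hand side of
`hB`. -/
theorem obeys_prepare {n m l B X : ℕ} (hB : 5 + 2 * m + ((m - 1) * n + (n - 1)) < B)
    (hm : 0 < m) (hl : 0 < l) (hn : n ≤ X) (hmX : m ≤ X) :
    prepare.Obeys (prepBounds n m l) B X := by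
  simp [prepare, params, scan, incidences, sizes, incE, numE, denE, prepBounds]
  omega

/-- The caps in the program are placed so that this check succeeds. `T` and `big` enter as given
numbers, because the powers are computed beforehand. -/
theorem obeys_main {n m l N g K T big base U B X : ℕ}
    (hB : 5 + 2 * m + ((m - 1) * n + (n - 1)) < B) (hm : 0 < m) (hK : 0 < K) (hg : g ≤ K)
    (hn : n ≤ X) (hmX : m ≤ X) (hKX : K ≤ X) (hT : T ≤ X) :
    (Stm.seq prices (.seq optimum finish)).Obeys (mainBounds n m l N g K T big base U) B X := by
  simp [prices, optimum, finish, table, clear, decode, decodeDigit, row, best, attempt, revenue,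
    price, fill, key, reach, spread, freeE, incE, numE, denE, mainBounds]
  omega

theorem obeys_output {n U B X : ℕ} (hB : 2 * n + 1 < B) (hn : n ≤ X) :
    output.Obeys (outBounds n U) B X := by
  simp [output, outBounds]
  omega

end Alg

/-- All intermediate bounds are at most `U`. -/
structure Room (n m l B U : ℕ) : Prop where
  le_U : 16 ≤ U
  B_le : B ≤ U
  l_le : l ≤ U
  base_le : n * m * (m + (n * m * l + 2)) + 1 ≤ U
  K_le : m + (n * m * l + 2) + 2 ≤ U
  T_le : (n * m * (m + (n * m * l + 2)) + 1) ^ n ≤ U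
  big_le : (m + (n * m * l + 2) + 2) ^ n ≤ U
  sum_le : m * (n * (n * m * l + 1)) ≤ U
  price_le : (n * m * l + 1 + (m + (n * m * l + 2))) * l + 1 ≤ U

section Safety

variable {n m : ℕ} {I : Instance n m} {k : ℕ} {ε : ℚ≥0}

theorem Alg.outBounds_mono {b : Bounds} {n U : ℕ} {s : Store} (h : s.Bounded b) (h0 : b.v 0 ≤ n)
    (h21 : b.v 21 ≤ n - 1) (hv : ∀ x, b.v x ≤ U) (ha : ∀ a, b.arr a ≤ U) (hl : b.low ≤ U) :
    s.Bounded (Alg.outBounds n U) := by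
  refine h.mono (fun x => ?_) ha hl
  simp only [Alg.outBounds]
  split
  · next hx => rw [hx]; exact h0
  · split
    · next hx => rw [hx]; exact h21
    · exact hv x

theorem Alg.prepBounds_le {n m l B U : ℕ} (hU : Room n m l B U) (hB : 2 * n + m + n * m ≤ B) :
    (∀ x, (Alg.prepBounds n m l).v x ≤ U) ∧ ∀ a, (Alg.prepBounds n m l).arr a ≤ U := by
  obtain ⟨h1, h2, h3, h4, h5, -, -, -, -⟩ := hU
  constructor
  · intro x
    simp only [Alg.prepBounds]
    rcases lt_or_ge x 23 with hx | hx
    · interval_cases x <;> simp <;> omega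
    · rw [List.getD_eq_default _ _ (by simpa using hx)]; omega
  · intro a
    simp only [Alg.prepBounds]
    split <;> omega

theorem Alg.mainBounds_le {n m l N g K T big base B U : ℕ} (hU : Room n m l B U)
    (hm : 0 < m) (hl : 0 < l) (hB : 2 * n + m + n * m ≤ B) (hN : N ≤ n * m * l + 1) (hg : g ≤ K)
    (hK : K ≤ m + (n * m * l + 2)) (hT : T ≤ U) (hbig : big ≤ U) (hbase : base ≤ U) :
    (∀ x, (Alg.mainBounds n m l N g K T big base U).v x ≤ U) ∧
      ∀ a, (Alg.mainBounds n m l N g K T big base U).arr a ≤ U := by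
  obtain ⟨h1, h2, h3, h4, h5, -, -, h6, h7⟩ := hU
  have h8 : (N + K) * l + 1 ≤ U :=
    le_trans (Nat.add_le_add_right (Nat.mul_le_mul_right _ (Nat.add_le_add hN hK)) 1) h7
  have h9 : N * l ≤ (N + K) * l := Nat.mul_le_mul_right _ (Nat.le_add_right _ _)
  have h12 : N + K ≤ (N + K) * l := Nat.le_mul_of_pos_right _ hl
  have h10 : m * (n * N) ≤ U := (Nat.mul_le_mul_left _ (Nat.mul_le_mul_left _ hN)).trans h6
  constructor
  · intro x
    simp only [Alg.mainBounds]
    rcases lt_or_ge x 38 with hx | hx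
    · have h11 : n * N ≤ m * (n * N) := Nat.le_mul_of_pos_left _ hm
      interval_cases x <;> simp <;> omega
    · rw [List.getD_eq_default _ _ (by simpa using hx)]
  · intro a
    simp only [Alg.mainBounds]
    rcases lt_or_ge a 10 with ha | ha
    · interval_cases a <;> simp <;> omega
    · rw [List.getD_eq_default _ _ (by simpa using ha)]

theorem Alg.le_mainBounds {l T big U : ℕ} {s t : Store}
    (hv : ∀ x, s.v x ≤ (Alg.prepBounds n m l).v x) (hU : ∀ x, (Alg.prepBounds n m l).v x ≤ U)
    (g9 : t.v 9 ≤ T) (g12 : t.v 12 ≤ big) (g23 : t.v 23 ≤ 2 * n)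
    (gv : ∀ x, x ≠ 9 → x ≠ 12 → x ≠ 23 → t.v x = s.v x) (x : ℕ) :
    t.v x ≤ (Alg.mainBounds n m l (s.v 6) (s.v 7) (s.v 8) T big (s.v 13) U).v x := by
  by_cases h9 : x = 9
  · rw [h9]; exact g9
  by_cases h12 : x = 12
  · rw [h12]; exact g12
  by_cases h23 : x = 23
  · rw [h23]; exact g23
  rw [gv x h9 h12 h23]
  have hx := hv x
  have hx' := hU x
  rcases lt_or_ge x 38 with h | h
  · interval_cases x
    all_goals first
      | exact absurd rfl h9 | exact absurd rfl h12 | exact absurd rfl h23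
      | exact le_rfl | exact hx | exact hx.trans hx' | exact hx.trans (Nat.zero_le _)
      | exact hx.trans (Nat.le_add_left 1 _)
  · simp only [Alg.mainBounds]
    rw [List.getD_eq_default _ _ (by simpa using h)]; omega

/-- Three regimes: the preparations and the dynamic program follow static bounds, while the two
powers between them are treated directly. The bounds of the second regime use the actual parameters,
so that loop lengths are bounded by `X` and not merely by `U`. -/
theorem Instance.safe_main {l U X B W : ℕ} {s0 : Store} (hU : Room n m l B U) (hm : 0 < m)
    (hB : 6 + 2 * m + m * n + 2 * n ≤ B) (hs0 : s0 = Alg.init.run (I.store k ε))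
    (hlow : ∀ i, (I.store k ε).low i ≤ l) (hl : 0 < l) (hW : U ^ Alg.program.deg < W)
    (hn : n ≤ X) (hmX : m ≤ X) (hKX : (Alg.prepare.run s0).v 8 ≤ X)
    (hT : (Alg.prepare.run s0).v 13 ^ (Alg.prepare.run s0).v 2 ≤ X) :
    Alg.main.Safe W B X s0 ∧ (Alg.main.run s0).Bounded (Alg.outBounds n U) := by
  have hdeg : ∀ {d : ℕ}, d ≤ Alg.program.deg → U ^ d < W := fun hd =>
    (Nat.pow_le_pow_right (by have := hU.le_U; omega) hd).trans_lt hW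
  have hUW : U < W := by have := hdeg (d := 1) (by decide); rwa [pow_one] at this
  have hprep := I.run_prepare (k := k) (ε := ε)
  have hinc : 5 + 2 * m + ((m - 1) * n + (n - 1)) < B := by
    obtain ⟨m', rfl⟩ := Nat.exists_eq_add_of_lt hm
    simp only [zero_add, Nat.add_sub_cancel] at *
    have : (m' + 1) * n = m' * n + n := by ring
    omega
  have hBn : 2 * n + m + n * m ≤ B := by rw [mul_comm n m]; omega
  have hstore : (I.store k ε).Holds n m k ε.num ε.den I.incid I.nums I.dens := I.store_holds
  have hb0 : s0.Bounded (Alg.prepBounds n m l) := by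
    have hF := Stm.frame_run Alg.init (I.store k ε)
    rw [← hs0] at hF
    refine ⟨fun x => ?_, fun a i => ?_, fun i => ?_⟩
    · by_cases hx : Alg.init.writesV x = true
      · have : x = 0 ∨ x = 1 ∨ x = 14 := by
          simpa [Alg.init, Stm.writesV] using hx
        rcases this with rfl | rfl | rfl <;>
          simp [hs0, Alg.init, Alg.prepBounds, hstore.eq_n, hstore.eq_m]
      · rw [hF.v x (by simpa using hx)]
        exact Nat.zero_le _
    · rw [hF.arr a (by simp [Alg.init, Stm.writesA])]
      exact Nat.zero_le _
    · rw [hF.low (by decide)]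
      exact hlow i
  obtain ⟨hpv, hpa⟩ := Alg.prepBounds_le hU hBn
  obtain ⟨hsafe1, hb1⟩ := (Alg.obeys_prepare (X := X) hinc hm hl hn hmX).safe hU.le_U hU.B_le hpv
    hpa hU.l_le (by decide) (hdeg (by decide)) hb0
  rw [← hs0] at hprep
  set s := Alg.prepare.run s0 with hs
  have hv := hb1.v
  have v0 : s.v 0 = n := hprep.eq_n
  have v2 : s.v 2 ≤ n := hprep.eq_k ▸ min_le_right _ _
  have v6 : s.v 6 ≤ n * m * l + 1 := hv 6
  have v8 : s.v 8 ≤ m + (n * m * l + 2) := hv 8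
  have v13 : s.v 13 ≤ n * m * (m + (n * m * l + 2)) + 1 := hv 13
  have v15 : s.v 15 ≤ m + (n * m * l + 2) + 2 := hv 15
  have v23 : s.v 23 = 0 := Nat.le_zero.1 (hv 23)
  have p13 : 0 < s.v 13 := by rw [hprep.eq_base]; omega
  have p15 : 0 < s.v 15 := by rw [hprep.eq_digit]; omega
  have hTU : s.v 13 ^ s.v 2 ≤ U :=
    ((Nat.pow_le_pow_right p13 v2).trans (Nat.pow_le_pow_left v13 _)).trans hU.T_le
  have hbigU : s.v 15 ^ n ≤ U := (Nat.pow_le_pow_left v15 _).trans hU.big_le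
  have hnU : n ≤ U := by have := hU.B_le; omega
  have hsafe2 : (Alg.power 9 2 13).Safe W B X s :=
    Alg.safe_power (by decide) (by decide) (by decide) hprep.eq_T p13 (by omega)
      (by have := hU.base_le; omega) (by omega) (by omega) B
  set s1 := (Alg.power 9 2 13).run s with hs1
  have hF1 : (Alg.power 9 2 13).Frame s s1 := Stm.frame_run _ _
  have e12 : s1.v 12 = 1 := by rw [hF1.v 12 (by decide), hprep.eq_big]
  have e15 : s1.v 15 = s.v 15 := hF1.v 15 (by decide)
  have e0 : s1.v 0 = n := by rw [hF1.v 0 (by decide), v0]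
  have e9 : s1.v 9 = s.v 13 ^ s.v 2 :=
    Alg.run_power (by decide) (by decide) (by decide) hprep.eq_T
  have e23 : s1.v 23 ≤ n := by
    have := Alg.run_power_counter (x := 9) (y := 2) (z := 13) (by decide) (by decide)
      (by decide) hprep.eq_T
    rw [v23] at this
    exact this.trans (by omega)
  have hsafe3 : (Alg.power 12 0 15).Safe W B X s1 :=
    Alg.safe_power (by decide) (by decide) (by decide) e12 (by rw [e15]; exact p15)
      (by rw [e0]; omega) (by have := hU.K_le; rw [e15]; omega) (by rw [e0]; exact hn)
      (by rw [e15, e0]; omega) B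
  set s2 := (Alg.power 12 0 15).run s1 with hs2
  have hF2 : (Alg.power 12 0 15).Frame s1 s2 := Stm.frame_run _ _
  have g9 : s2.v 9 = s.v 13 ^ s.v 2 := by rw [hF2.v 9 (by decide), e9]
  have g12 : s2.v 12 = s.v 15 ^ n := by
    have := Alg.run_power (s := s1) (x := 12) (y := 0) (z := 15) (by decide) (by decide)
      (by decide) e12
    rwa [e15, e0] at this
  have g23 : s2.v 23 ≤ 2 * n := by
    have := Alg.run_power_counter (s := s1) (x := 12) (y := 0) (z := 15) (by decide) (by decide)
      (by decide) e12
    rw [e0] at this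
    exact this.trans (by omega)
  have gv : ∀ x, x ≠ 9 → x ≠ 12 → x ≠ 23 → s2.v x = s.v x := by
    intro x h9 h12 h23
    rw [hF2.v x (by simp [Alg.power, Stm.writesV, h12, h23]),
      hF1.v x (by simp [Alg.power, Stm.writesV, h9, h23])]
  have hb2 : s2.Bounded (Alg.mainBounds n m l (s.v 6) (s.v 7) (s.v 8) (s.v 13 ^ s.v 2)
      (s.v 15 ^ n) (s.v 13) U) := by
    refine ⟨Alg.le_mainBounds hb1.v hpv g9.le g12.le g23 gv, fun a i => ?_, fun i => ?_⟩
    · rw [hF2.arr a (by simp [Alg.power, Stm.writesA]), hF1.arr a (by simp [Alg.power, Stm.writesA])]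
      have ha := hb1.arr a i
      simp only [Alg.prepBounds] at ha
      simp only [Alg.mainBounds]
      split at ha
      · next h => subst h; exact ha
      · exact (Nat.le_zero.1 ha) ▸ Nat.zero_le _
    · rw [hF2.low (by decide), hF1.low (by decide)]
      exact hb1.low i
  have hg : s.v 7 ≤ s.v 8 := by rw [hprep.eq_K]; omega
  have p7 : 0 < s.v 7 := by rw [hprep.eq_g]; split <;> omega
  have p8 : 0 < s.v 8 := by omega
  obtain ⟨hmv, hma⟩ := Alg.mainBounds_le (N := s.v 6) (g := s.v 7) (K := s.v 8)
    (T := s.v 13 ^ s.v 2) (big := s.v 15 ^ n) (base := s.v 13) hU hm hl hBn v6 hg v8 hTU hbigU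
    (v13.trans hU.base_le)
  obtain ⟨hsafe4, hb4⟩ := (Alg.obeys_main (X := X) hinc hm p8 hg hn hmX hKX hT).safe hU.le_U
    hU.B_le hmv hma hU.l_le (by decide) (hdeg (by decide)) hb2
  exact ⟨⟨hsafe1, ⟨hsafe2, hsafe3⟩, hsafe4⟩,
    Alg.outBounds_mono hb4 le_rfl le_rfl hmv hma hU.l_le⟩

/-- The numbers in the computation stay below `W`. -/
theorem Instance.safe_program {l U X B W : ℕ} (hU : 0 < m → Room n m l B U)
    (hU0 : 16 ≤ U ∧ B ≤ U ∧ l ≤ U)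
    (hB : 6 + 2 * m + m * n + 2 * n ≤ B)
    (hlow : ∀ i, (I.store k ε).low i ≤ l) (hl : 0 < l) (hW : U ^ Alg.program.deg < W)
    (hn : n ≤ X) (hmX : m ≤ X)
    (hX : 0 < m → (Alg.prepare.run (Alg.init.run (I.store k ε))).v 8 ≤ X ∧
      (Alg.prepare.run (Alg.init.run (I.store k ε))).v 13 ^
        (Alg.prepare.run (Alg.init.run (I.store k ε))).v 2 ≤ X) :
    Alg.program.Safe W B X (I.store k ε) := by
  have hdeg : ∀ {d : ℕ}, d ≤ Alg.program.deg → U ^ d < W := fun hd =>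
    (Nat.pow_le_pow_right (by omega) hd).trans_lt hW
  have hUW : U < W := by have := hdeg (d := 1) (by decide); rwa [pow_one] at this
  have h : (I.store k ε).Holds n m k ε.num ε.den I.incid I.nums I.dens := I.store_holds
  set s0 := Alg.init.run (I.store k ε) with hs0
  have hF0 := Stm.frame_run Alg.init (I.store k ε)
  have a0 : s0.v 0 = n := by simp [s0, Alg.init, h.eq_n]
  have a1 : s0.v 1 = m := by simp [s0, Alg.init, h.eq_m]
  have a14 : s0.v 14 = 1 := by simp [s0, Alg.init]
  have hinit : Alg.init.Safe W B X (I.store k ε) := by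
    simp [Alg.init, h.eq_n, h.eq_m]
    omega
  have hout : ∀ s : Store, s.Bounded (Alg.outBounds n U) → Alg.output.Safe W B X s := fun s hs =>
    ((Alg.obeys_output (X := X) (by omega) hn).safe hU0.1 hU0.2.1
      (fun x => by simp only [Alg.outBounds]; split <;> [skip; split] <;> omega)
      (fun _ => le_rfl) le_rfl (by decide) (hdeg (by decide)) hs).1
  have hv1 : (Ex.var 1).Safe W B s0 := by simp only [Ex.Safe, a1]; omega
  rcases Nat.eq_zero_or_pos m with hm | hm
  · refine ⟨hinit, ⟨hv1, fun hc => absurd (a1.trans hm) hc, fun _ => trivial⟩, ?_⟩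
    rw [Stm.run_ite_neg (by simp [← hs0, a1, hm])]
    refine hout _ ⟨fun x => ?_, fun a i => ?_, fun i => ?_⟩
    · simp only [Stm.run, Alg.outBounds, ← hs0]
      by_cases hx : Alg.init.writesV x = true
      · have : x = 0 ∨ x = 1 ∨ x = 14 := by
          simpa [Alg.init, Stm.writesV] using hx
        rcases this with rfl | rfl | rfl
        · simp [a0]
        · simp [a1, hm]
        · simp [a14]; omega
      · rw [hF0.v x (by simpa using hx)]
        exact Nat.zero_le _
    · simp only [Stm.run, ← hs0]
      rw [hF0.arr a (by simp [Alg.init, Stm.writesA])]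
      exact Nat.zero_le _
    · simp only [Stm.run, ← hs0]
      rw [hF0.low (by decide)]
      exact (hlow i).trans hU0.2.2
  · obtain ⟨h1, h2⟩ := Instance.safe_main (X := X) (hU hm) hm hB hs0 hlow hl hW hn hmX (hX hm).1
      (hX hm).2
    refine ⟨hinit, ⟨hv1, fun _ => h1, fun hc => absurd (a1.symm.trans hc) hm.ne'⟩, ?_⟩
    rw [Stm.run_ite_pos (by simpa [← hs0, a1] using hm.ne')]
    exact hout _ h2

end Safety

/-! ### The machine program and its word length. -/

section Machine

variable {n m : ℕ} {I : Instance n m} {k : ℕ} {ε : ℚ≥0}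

theorem length_le_sum_size (l : List ℕ) : l.length ≤ (l.map fun x => x.size + 1).sum := by
  induction l with
  | nil => simp
  | cons a l ih => simp only [List.length_cons, List.map_cons, List.sum_cons]; omega

theorem getD_lt_two_pow (l : List ℕ) (i : ℕ) :
    l.getD i 0 < 2 ^ (l.map fun x => x.size + 1).sum := by
  induction l generalizing i with
  | nil => simp
  | cons a l ih =>
    simp only [List.map_cons, List.sum_cons]
    cases i with
    | zero =>
      exact (Nat.lt_size_self a).trans_le (Nat.pow_le_pow_right (by norm_num) (by omega))
    | succ i =>
      rw [List.getD_cons_succ]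
      exact (ih i).trans_le (Nat.pow_le_pow_right (by norm_num) (by omega))

theorem Instance.le_inputSize : 5 + 2 * m + m * n ≤ I.inputSize k ε :=
  (Instance.length_encode (I := I)).symm.trans_le (length_le_sum_size _)

theorem Instance.low_lt (i : ℕ) : (I.store k ε).low i < 2 ^ I.inputSize k ε :=
  getD_lt_two_pow _ _

/-- Every parameter is at most a fixed power of `l = 2 ^ L`, and the two powers with exponent `n`
are at most `(l ^ 3) ^ L`. This leaves numbers of `O(L ^ 2)` bits. -/
theorem room {n m L : ℕ} (h : 5 + 2 * m + m * n ≤ L) (hm : 0 < m) (hn : n < 2 ^ L) :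
    Room n m (2 ^ L) (6 + 2 * m + m * n + 2 * n) ((2 ^ L) ^ (3 * L)) := by
  set l := 2 ^ L with hl
  have hLl : L < l := Nat.lt_two_pow_self
  have hl1 : 0 < l := by omega
  have hnL : n ≤ L := by
    have : 1 * n ≤ m * n := Nat.mul_le_mul_right _ hm
    omega
  have hpow : ∀ {j}, j ≤ 3 * L → l ^ j ≤ l ^ (3 * L) := fun hj => Nat.pow_le_pow_right hl1 hj
  have hq : n * m + 5 + 2 * m ≤ l := by rw [mul_comm]; omega
  have h2 : m + (n * m * l + 2) + 2 ≤ l ^ 2 := by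
    calc m + (n * m * l + 2) + 2 ≤ n * m * l + (m + 4) * l := by nlinarith
      _ = (n * m + m + 4) * l := by ring
      _ ≤ l * l := Nat.mul_le_mul_right _ (by omega)
      _ = _ := by ring
  have h3 : n * m * (m + (n * m * l + 2)) + 1 ≤ l ^ 3 := by
    calc n * m * (m + (n * m * l + 2)) + 1 ≤ n * m * l ^ 2 + l ^ 2 :=
          Nat.add_le_add (Nat.mul_le_mul_left _ (by omega)) (Nat.one_le_pow _ _ hl1)
      _ = (n * m + 1) * l ^ 2 := by ring
      _ ≤ l * l ^ 2 := Nat.mul_le_mul_right _ (by omega)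
      _ = _ := by ring
  have h16 : 16 ≤ l := by
    have : 2 ^ 4 ≤ l := Nat.pow_le_pow_right (by norm_num) (by omega)
    omega
  have hll : ∀ {j : ℕ}, j * l ≤ l ^ 2 ↔ j ≤ l := fun {j} => by
    rw [sq]; exact Nat.mul_le_mul_right_iff hl1
  constructor
  · exact h16.trans ((Nat.pow_one l).symm.le.trans (hpow (by omega)))
  · have : 6 + 2 * m + m * n + 2 * n ≤ 16 * l := by omega
    exact this.trans ((hll.2 h16).trans (hpow (by omega)))
  · exact (Nat.pow_one l).symm.le.trans (hpow (by omega))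
  · exact h3.trans (hpow (by omega))
  · exact h2.trans (hpow (by omega))
  · refine (Nat.pow_le_pow_left h3 n).trans ?_
    rw [← pow_mul]
    exact hpow (Nat.mul_le_mul_left _ hnL)
  · refine (Nat.pow_le_pow_left h2 n).trans ?_
    rw [← pow_mul]
    exact hpow (Nat.mul_le_mul (by norm_num) hnL)
  · refine le_trans ?_ (hpow (j := 3) (by omega))
    calc m * (n * (n * m * l + 1)) = n * m * (n * m * l + 1) := by ring
      _ ≤ l * l ^ 2 := Nat.mul_le_mul (by omega) (by omega)
      _ = _ := by ring
  · refine le_trans ?_ (hpow (j := 4) (by omega))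
    calc (n * m * l + 1 + (m + (n * m * l + 2))) * l + 1 ≤ (2 * l ^ 2) * l + l ^ 3 :=
          Nat.add_le_add (Nat.mul_le_mul_right _ (by omega)) (Nat.one_le_pow _ _ hl1)
      _ = 3 * l ^ 3 := by ring
      _ ≤ l * l ^ 3 := Nat.mul_le_mul_right _ (by omega)
      _ = _ := by ring

/-- Set up the registers with constant contents. -/
def preamble : Prog :=
  .seq (.load 5 0) (.seq (.const 1 1) (.seq (.load 9 1) (.seq (.const 3 16) (.seq (.const 13 2)
    (.seq (.arith .mul 17 5 9) (.seq (.arith .mul 9 9 13) (.seq (.arith .mul 5 5 13)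
      (.seq (.arith .add 17 17 9) (.seq (.arith .add 17 17 5) (.seq (.const 13 6)
        (.arith .add 2 17 13)))))))))))

/-- The cells below `6 + 2m + mn + 2n` have room for the input as well as for the output; beyond
them memory is zero and hosts the arrays. -/
theorem Instance.exec_preamble {w : ℕ} (hw : 16 < 2 ^ w)
    (hB : 6 + 2 * m + m * n + 2 * n < 2 ^ w) :
    ∃ c, Exec w preamble (I.initState k ε) 12 c ∧
      Represents (6 + 2 * m + m * n + 2 * n) (I.store k ε) c := by
  have h0 : (I.initState k ε).mem 0 = n := rfl
  have h1 : (I.initState k ε).mem 1 = m := rfl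
  have hmn := mul_comm n m
  set c : State := I.initState k ε with hc
  have hreg : c.reg = fun _ => 0 := rfl
  refine ⟨((((((((((((c.setReg 5 n).setReg 1 1).setReg 9 m).setReg 3 16).setReg 13 2).setReg 17
    (n * m)).setReg 9 (m * 2)).setReg 5 (n * 2)).setReg 17 (n * m + m * 2)).setReg 17
    (n * m + m * 2 + n * 2)).setReg 13 6).setReg 2 (n * m + m * 2 + n * 2 + 6)), ?_, ?_⟩
  · refine .seq (t := 1) (t' := 11) (.load' _ _ _ n (by simp [hreg, h0]) (by omega)) ?_
    refine .seq (t := 1) (t' := 10) (.const _ _ _ (by omega)) ?_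
    refine .seq (t := 1) (t' := 9) (.load' _ _ _ m (by simp [h1]) (by omega)) ?_
    refine .seq (t := 1) (t' := 8) (.const _ _ _ (by omega)) ?_
    refine .seq (t := 1) (t' := 7) (.const _ _ _ (by omega)) ?_
    refine .seq (t := 1) (t' := 6) (.arith' _ _ _ _ _ (n * m) (by simp [Op.eval]) (by omega)) ?_
    refine .seq (t := 1) (t' := 5) (.arith' _ _ _ _ _ (m * 2) (by simp [Op.eval]) (by omega)) ?_
    refine .seq (t := 1) (t' := 4) (.arith' _ _ _ _ _ (n * 2) (by simp [Op.eval]) (by omega)) ?_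
    refine .seq (t := 1) (t' := 3) (.arith' _ _ _ _ _ (n * m + m * 2) (by simp [Op.eval]) (by omega)) ?_
    refine .seq (t := 1) (t' := 2) (.arith' _ _ _ _ _ (n * m + m * 2 + n * 2) (by simp [Op.eval]) (by omega)) ?_
    refine .seq (t := 1) (t' := 1) (.const _ _ _ (by omega)) ?_
    exact .arith' _ _ _ _ _ (n * m + m * 2 + n * 2 + 6) (by simp [Op.eval]) (by omega)
  · constructor
    · intro x
      simp only [State.setReg_reg, hreg]
      rw [if_neg (by omega), if_neg (by omega), if_neg (by omega), if_neg (by omega),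
        if_neg (by omega), if_neg (by omega), if_neg (by omega), if_neg (by omega),
        if_neg (by omega), if_neg (by omega), if_neg (by omega), if_neg (by omega)]
      rfl
    · intro a _ i
      exact List.getD_eq_default _ _ (by rw [Instance.length_encode]; omega)
    · exact fun i _ => rfl
    · simp [hreg]
    · simp
    · simp; omega
    · simp

/-- The algorithm as a program of the machine. -/
def machineProgram : Prog := .seq preamble (Alg.program.comp 0)

theorem Instance.exec_machineProgram (hI : I.TreewidthAtMost k) (hε : 0 < ε) {X w : ℕ}
    (hw : 3 * I.inputSize k ε ^ 2 * Alg.program.deg < w)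
    (hn : n ≤ X) (hmX : m ≤ X)
    (hX : 0 < m → (Alg.prepare.run (Alg.init.run (I.store k ε))).v 8 ≤ X ∧
      (Alg.prepare.run (Alg.init.run (I.store k ε))).v 13 ^
        (Alg.prepare.run (Alg.init.run (I.store k ε))).v 2 ≤ X) :
    ∃ t s, Exec w machineProgram (I.initState k ε) t s ∧ t ≤ 12 + Alg.program.cost X ∧
      (∀ v : Fin n, s.mem (2 * v + 1) ≠ 0) ∧ I.IsApproxSolution (1 + (ε : ℝ)) s.price := by
  set L := I.inputSize k ε with hL
  have hLle : 5 + 2 * m + m * n ≤ L := I.le_inputSize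
  have hlow : ∀ i, (I.store k ε).low i < 2 ^ L := I.low_lt
  have hn2 : n < 2 ^ L := hlow 0
  have hLl : L < 2 ^ L := Nat.lt_two_pow_self
  have h32 : 2 ^ 5 ≤ 2 ^ L := Nat.pow_le_pow_right (by norm_num) (by omega)
  have hsq : (2 ^ L) ^ 2 ≤ (2 ^ L) ^ (3 * L) := Nat.pow_le_pow_right (by omega) (by omega)
  have hB : 6 + 2 * m + m * n + 2 * n ≤ (2 ^ L) ^ 2 := by nlinarith
  have hl2 : 2 ^ L ≤ (2 ^ L) ^ 2 := Nat.le_self_pow (by norm_num) _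
  -- Expressions multiply exponents by at most the degree of the program, an absolute constant.
  have hW : ((2 ^ L) ^ (3 * L)) ^ Alg.program.deg < 2 ^ w := by
    rw [← pow_mul, ← pow_mul]
    refine Nat.pow_lt_pow_right (by norm_num) (lt_of_le_of_lt (le_of_eq ?_) hw)
    ring
  have hUW : (2 ^ L) ^ (3 * L) < 2 ^ w :=
    (Nat.le_self_pow (by decide) _).trans_lt hW
  obtain ⟨c, hc, hrep⟩ := I.exec_preamble (k := k) (ε := ε) (w := w) (by omega) (by omega)
  have hsafe := I.safe_program (k := k) (ε := ε) (l := 2 ^ L) (U := (2 ^ L) ^ (3 * L)) (X := X)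
    (fun hm => room hLle hm hn2) (by omega) le_rfl (fun i => (hlow i).le) (by omega) hW hn hmX hX
  obtain ⟨t, s, hs, ht, hrep', -⟩ := Stm.exec_comp Alg.program _ 0 c hrep hsafe
  obtain ⟨h1, h2⟩ := I.run_program hI hε
  have hmem : ∀ i < 6 + 2 * m + m * n + 2 * n,
      s.mem i = (Alg.program.run (I.store k ε)).low i := hrep'.low
  refine ⟨12 + t, s, .seq hc hs, by omega, fun v => ?_, ?_⟩
  · have := v.2
    rw [hmem _ (by omega)]; exact h1 v
  · convert h2 using 1
    funext v
    have := v.2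
    rw [State.price, hmem _ (by omega), hmem _ (by omega)]

end Machine

/-! ### Running time. -/

section Time

variable {n m : ℕ} {I : Instance n m} {k : ℕ} {ε : ℚ≥0}

/-- The number of iterations of the loops is bounded. -/
theorem Instance.Prepared.iterations_le {s : Store} (h : I.Prepared k ε s) (hε : 0 < ε)
    (hε1 : ε ≤ 1) (hk : 1 ≤ k) {y : ℝ} (hy : 1 ≤ y) (hm : (m : ℝ) ≤ y)
    (hS : (s.v 5 : ℝ) ≤ 2 * y) :
    ((n + m + s.v 8 + s.v 13 ^ s.v 2 : ℕ) : ℝ) ≤ (n + (11 * y / ε) ^ k + 1) ^ 2 := by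
  have hε' : (0 : ℝ) < ε := NNRat.cast_pos.2 hε
  have hε1' : (ε : ℝ) ≤ 1 := by exact_mod_cast hε1
  set r : ℝ := y / ε with hr
  have hyr : y ≤ r := by rw [hr, le_div_iff₀ hε']; nlinarith
  have hN : (s.v 6 : ℝ) ≤ 2 * r + 1 := by
    rw [h.eq_N]
    push_cast
    have h1 : ((s.v 5 * ε.den / ε.num : ℕ) : ℝ) ≤ ((s.v 5 * ε.den : ℕ) : ℝ) / (ε.num : ℝ) :=
      Nat.cast_div_le
    have hnum : (0 : ℝ) < ε.num := by exact_mod_cast NNRat.num_pos.2 hε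
    have hden : (0 : ℝ) < ε.den := by exact_mod_cast ε.den_pos
    have h2 : ((s.v 5 * ε.den : ℕ) : ℝ) / (ε.num : ℝ) = (s.v 5 : ℝ) / ε := by
      rw [budget_eq ε]; push_cast; field_simp
    have h3 : (s.v 5 : ℝ) / ε ≤ 2 * r := by
      rw [hr, ← mul_div_assoc]; gcongr
    linarith
  have hg : (s.v 7 : ℝ) ≤ 2 * r + 2 := by
    have : s.v 7 ≤ s.v 6 + 1 := by rw [h.eq_g]; split <;> omega
    have : (s.v 7 : ℝ) ≤ s.v 6 + 1 := by exact_mod_cast this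
    linarith
  -- At most `r` budgets and `2r + 2` grid prices, with `r ≥ 1`.
  have hK : (s.v 8 : ℝ) ≤ 5 * r := by
    rw [h.eq_K, h.eq_m]; push_cast; linarith
  -- The base is about the product of incidences and candidates, quadratic in `r`. The square passes
  -- to the outer exponent, so that `(O(y) / ε) ^ k` remains inside.
  have hbase : (s.v 13 : ℝ) ≤ (11 * r) ^ 2 := by
    rw [h.eq_base]; push_cast
    have : (s.v 5 : ℝ) * s.v 8 ≤ (2 * r) * (5 * r) :=
      mul_le_mul (by linarith) hK (Nat.cast_nonneg _) (by linarith)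
    nlinarith
  have h11 : 11 * y / ε = 11 * r := by rw [hr]; ring
  rw [h11]
  have hz1 : 1 ≤ 11 * r := by linarith
  have hT : (s.v 13 : ℝ) ^ s.v 2 ≤ ((11 * r) ^ k) ^ 2 := by
    calc (s.v 13 : ℝ) ^ s.v 2 ≤ ((11 * r) ^ 2) ^ s.v 2 :=
          pow_le_pow_left₀ (Nat.cast_nonneg _) hbase _
      _ ≤ ((11 * r) ^ 2) ^ k := pow_le_pow_right₀ (by nlinarith) (by rw [h.eq_k]; exact min_le_left _ _)
      _ = _ := by rw [← pow_mul, ← pow_mul, mul_comm 2 k]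
  have hz : 11 * r ≤ (11 * r) ^ k := le_self_pow₀ hz1 (by omega)
  push_cast
  nlinarith [(Nat.cast_nonneg n : (0 : ℝ) ≤ n)]

/-- For `k = 0` there are `m + 1` candidates and a single code, so `ε` does not influence the
running time. -/
theorem Instance.Prepared.iterations_le_of_zero {s : Store} (h : I.Prepared 0 ε s) :
    n + m + s.v 8 + s.v 13 ^ s.v 2 = n + 2 * m + 2 := by
  have h2 : s.v 2 = 0 := by rw [h.eq_k]; simp
  rw [h2, h.eq_K, h.eq_g, if_neg (by simp [h2]), h.eq_m]
  ring

/-- The running time is polynomial in the number of iterations of the loops. -/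
theorem Instance.approximates (hI : I.TreewidthAtMost k) (hε : 0 < ε) {A c : ℕ}
    (hA : 12 + Alg.program.size + 3 * Alg.program.deg ≤ A)
    (hc : 2 * Alg.program.depth + 2 ≤ c) {Y : ℝ} (hY : 1 ≤ Y)
    (hY0 : m = 0 → (n : ℝ) + 1 ≤ Y)
    (hY1 : 0 < m → ∀ s, I.Prepared k ε s →
      ((n + m + s.v 8 + s.v 13 ^ s.v 2 : ℕ) : ℝ) ≤ Y ^ 2) :
    machineProgram.Approximates I k ε (A * I.inputSize k ε ^ c) (A * Y ^ c) := by
  set L := I.inputSize k ε with hL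
  have hLle : 5 + 2 * m + m * n ≤ L := I.le_inputSize
  have hn2 : n < 2 ^ L := I.low_lt 0
  have hLl : L < 2 ^ L := Nat.lt_two_pow_self
  have hLc : L ^ 2 ≤ L ^ c := Nat.pow_le_pow_right (by omega) (by omega)
  have hw : 3 * L ^ 2 * Alg.program.deg < A * L ^ c := by
    have h1 : 1 ≤ L ^ 2 := Nat.one_le_pow _ _ (by omega)
    calc 3 * L ^ 2 * Alg.program.deg = (3 * Alg.program.deg) * L ^ 2 := by ring
      _ < A * L ^ 2 := Nat.mul_lt_mul_of_pos_right (by omega) h1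
      _ ≤ A * L ^ c := Nat.mul_le_mul_left _ hLc
  have hprep := I.run_prepare (k := k) (ε := ε)
  set s := Alg.prepare.run (Alg.init.run (I.store k ε)) with hs
  obtain ⟨X, hX1, hn, hm, hX, hXY⟩ : ∃ X : ℕ, 1 ≤ X ∧ n ≤ X ∧ m ≤ X ∧
      (0 < m → s.v 8 ≤ X ∧ s.v 13 ^ s.v 2 ≤ X) ∧ (X : ℝ) ≤ Y ^ 2 := by
    rcases Nat.eq_zero_or_pos m with hm | hm
    -- Without consumers the main part is skipped and only the output loop of length `n` matters.
    · refine ⟨n + 1, by omega, by omega, by omega, fun h => by omega, ?_⟩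
      have := hY0 hm
      push_cast
      nlinarith
    · exact ⟨_, by omega, by omega, by omega, fun _ => ⟨by omega, by omega⟩, hY1 hm s hprep⟩
  obtain ⟨t, c', h1, h2, h3⟩ := I.exec_machineProgram hI hε hw hn hm hX
  refine ⟨t, c', h1, ?_, h3⟩
  have hcost := Stm.cost_le hX1 Alg.program
  have hX0 : 1 ≤ X ^ Alg.program.depth := Nat.one_le_pow _ _ hX1
  have ht : t ≤ A * X ^ Alg.program.depth := by
    have h5 : (12 + Alg.program.size) * X ^ Alg.program.depth ≤ A * X ^ Alg.program.depth :=
      Nat.mul_le_mul_right _ (by omega)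
    have h4 : 12 * 1 ≤ 12 * X ^ Alg.program.depth := Nat.mul_le_mul_left _ hX0
    rw [add_mul] at h5
    omega
  calc (t : ℝ) ≤ ((A * X ^ Alg.program.depth : ℕ) : ℝ) := Nat.cast_le.2 ht
    _ = A * (X : ℝ) ^ Alg.program.depth := by push_cast; ring
    _ ≤ A * (Y ^ 2) ^ Alg.program.depth := by gcongr
    _ = A * Y ^ (2 * Alg.program.depth) := by rw [pow_mul]
    _ ≤ A * Y ^ c := by
      have := pow_le_pow_right₀ hY (show 2 * Alg.program.depth ≤ c by omega)
      gcongr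

/-- Size, degree and depth of the fixed program text supply the absolute constants. The two time
bounds differ only in the estimate for the number of incidences: `2m` for graphs, `(k + 1) m` in
general, since a bundle fits into a bag. -/
theorem machineProgram_spec : ∃ A c : ℕ,
    (∀ (n m : ℕ) (I : Instance n m) (k : ℕ) (ε : ℚ≥0),
      I.IsGraph → I.TreewidthAtMost k → 0 < ε → ε ≤ 1 →
        machineProgram.Approximates I k ε (A * (I.inputSize k ε) ^ c)
          ((A : ℝ) * ((n : ℝ) + ((A : ℝ) * (m : ℝ) / (ε : ℝ)) ^ k + 1) ^ c)) ∧
    (∀ (n m : ℕ) (I : Instance n m) (k : ℕ) (ε : ℚ≥0),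
      I.TreewidthAtMost k → 0 < ε → ε ≤ 1 →
        machineProgram.Approximates I k ε (A * (I.inputSize k ε) ^ c)
          ((A : ℝ) * ((n : ℝ) + (m : ℝ) +
            ((A : ℝ) * ((k : ℝ) + 1) * (m : ℝ) / (ε : ℝ)) ^ k + 1) ^ c)) := by
  obtain ⟨A, hA⟩ : ∃ A, A = 12 + Alg.program.size + 3 * Alg.program.deg := ⟨_, rfl⟩
  have hA11 : (11 : ℝ) ≤ A := by
    have : 11 ≤ A := by omega
    exact_mod_cast this
  have hmono : ∀ {n y Y : ℝ} {ε : ℚ≥0} {k : ℕ}, 0 ≤ y → 0 ≤ n →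
      n + (A * y / ε) ^ k + 1 ≤ Y → (n + (11 * y / ε) ^ k + 1) ^ 2 ≤ Y ^ 2 := by
    intro n y Y ε k hy hn hY
    have hε : (0 : ℝ) ≤ ε := NNRat.cast_nonneg ε
    have h0 : (0 : ℝ) ≤ (11 * y / ε) ^ k := by positivity
    have h1 : (11 * y / ε) ^ k ≤ (A * y / ε) ^ k := by gcongr
    exact pow_le_pow_left₀ (by linarith) (by linarith) 2
  refine ⟨A, 2 * Alg.program.depth + 2, fun n m I k ε hG hI hε hε1 => ?_,
    fun n m I k ε hI hε hε1 => ?_⟩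
  · have hε' : (0 : ℝ) ≤ ε := NNRat.cast_nonneg ε
    have hp : 0 ≤ ((A : ℝ) * (m : ℝ) / (ε : ℝ)) ^ k := by positivity
    have hn : (0 : ℝ) ≤ n := Nat.cast_nonneg n
    refine Instance.approximates hI hε hA.ge le_rfl (by linarith) (fun _ => by linarith) ?_
    intro hm s hs
    have hm1 : (1 : ℝ) ≤ m := by exact_mod_cast hm
    -- An edge needs a bag with two vertices. So `k = 0` does not occur for graphs with edges, and
    -- `m` is dominated by the power.
    have hk : 1 ≤ k := by
      have h1 := hI.card_bundle_le ⟨0, hm⟩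
      have h2 := hG ⟨0, hm⟩
      omega
    have hS : (s.v 5 : ℝ) ≤ 2 * m := by
      have : s.v 5 = 2 * m := by
        rw [hs.scanned.s, I.degSum_incid, Finset.sum_congr rfl fun e _ => hG e]
        simp [mul_comm]
      exact_mod_cast this.le
    exact (hs.iterations_le hε hε1 hk hm1 le_rfl hS).trans (hmono (by linarith) hn le_rfl)
  · have hε' : (0 : ℝ) ≤ ε := NNRat.cast_nonneg ε
    have hp : 0 ≤ ((A : ℝ) * ((k : ℝ) + 1) * (m : ℝ) / (ε : ℝ)) ^ k := by positivity
    have hn : (0 : ℝ) ≤ n := Nat.cast_nonneg n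
    have hm0 : (0 : ℝ) ≤ m := Nat.cast_nonneg m
    refine Instance.approximates hI hε hA.ge le_rfl (by linarith) (fun _ => by linarith) ?_
    intro hm s hs
    have hm1 : (1 : ℝ) ≤ m := by exact_mod_cast hm
    rcases Nat.eq_zero_or_pos k with rfl | hk
    · rw [hs.iterations_le_of_zero]
      push_cast
      rw [pow_zero]
      nlinarith
    · have hk0 : (0 : ℝ) ≤ k := Nat.cast_nonneg k
      have hy : (m : ℝ) ≤ ((k : ℝ) + 1) * m := by nlinarith
      have hS : (s.v 5 : ℝ) ≤ 2 * (((k : ℝ) + 1) * m) := by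
        have : s.v 5 ≤ (k + 1) * m := by
          rw [hs.scanned.s, I.degSum_incid]
          refine (Finset.sum_le_card_nsmul _ _ (k + 1) fun e _ => hI.card_bundle_le e).trans ?_
          simp [mul_comm]
        have : (s.v 5 : ℝ) ≤ ((k : ℝ) + 1) * m := by exact_mod_cast this
        nlinarith
      refine (hs.iterations_le hε hε1 hk (hm1.trans hy) hy hS).trans
        (hmono (by nlinarith) hn ?_)
      rw [← mul_assoc]
      linarith

end Time

end Pricing

/-- There are one program `P` and absolute constants `A`, `c` such that `P` is a
`(1 + ε)`-approximation algorithm, working with numbers of polynomially many bits, which takes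
`poly(n, O(m/ε)^k)` steps for graph vertex pricing on graphs of treewidth at most `k`, and
`poly(n, m, O((k+1)m/ε)^k)` steps for single-minded pricing on hypergraphs of treewidth at most
`k`. -/
theorem mainTheorem1 :
    ∃ (P : Pricing.Prog) (A c : ℕ),
      (∀ (n m : ℕ) (I : Pricing.Instance n m) (k : ℕ) (ε : ℚ≥0),
        I.IsGraph → I.TreewidthAtMost k → 0 < ε → ε ≤ 1 →
          P.Approximates I k ε (A * (I.inputSize k ε) ^ c)
            ((A : ℝ) * ((n : ℝ) + ((A : ℝ) * (m : ℝ) / (ε : ℝ)) ^ k + 1) ^ c)) ∧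
      (∀ (n m : ℕ) (I : Pricing.Instance n m) (k : ℕ) (ε : ℚ≥0),
        I.TreewidthAtMost k → 0 < ε → ε ≤ 1 →
          P.Approximates I k ε (A * (I.inputSize k ε) ^ c)
            ((A : ℝ) * ((n : ℝ) + (m : ℝ) +
              ((A : ℝ) * ((k : ℝ) + 1) * (m : ℝ) / (ε : ℝ)) ^ k + 1) ^ c)) := by
  exact ⟨Pricing.machineProgram, Pricing.machineProgram_spec⟩
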